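/- Let $(\mathcal X,d)$ be a Polish metric space (complete, separable), let $1\le p<q<\infty$, let $x_0\in\mathcal X$, and let $\nu_X,\nu_Y$ be Borel probability measures on $\mathcal X$. For $n\ge1$ put $c_n(x,y)=\sum_{i=1}^n d(x_i,y_i)^p$ on $\mathcal X^n\times\mathcal X^n$, and for $A\subseteq\mathcal X^n$, $t\ge0$ put $A^{c_n\le t}=\{y\in\mathcal X^n:\ c_n(x,y)\le t\text{ for some }x\in A\}$. For $\alpha,\tau\ge0$ define $$E_n(\alpha,\tau)=-\frac1n\ln\ \inf\Big\{\nu_Y^{\otimes n}\big(A^{c_n\le n\tau}\big):\ A\subseteq\mathcal X^n\text{ measurable},\ \nu_X^{\otimes n}(A)\ge e^{-n\alpha}\Big\}\in[0,\infty].$$ For probability measures let $D(\cdot\|\cdot)$ be the relative entropy and $\mathsf C(\mu,\nu)=\inf_{\pi}\int d(x,y)^p\,\mathrm d\pi(x,y)$, the infimum over all couplings $\pi$ of $\mu$ and $\nu$. For a probability measure $\pi_W$ on $\{0,1\}$ and transition probabilities $\pi_{X|W},\pi_{Y|W}$ from $\{0,1\}$ to $\mathcal X$ put $$D(\pi_{X|W}\|\nu|\pi_W)=\sum_{w}\pi_W(w)D(\pi_{X|W=w}\|\nu),\qquad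 \mathsf C(\pi_{X|W},\pi_{Y|W}|\pi_W)=\sum_w\pi_W(w)\,\mathsf C(\pi_{X|W=w},\pi_{Y|W=w}),$$ and define $$\psi(\alpha,\tau)=\sup_{\pi_{XW}:\ D(\pi_{X|W}\|\nu_X|\pi_W)\le\alpha}\ \ \inf_{\pi_{Y|W}:\ \mathsf C(\pi_{X|W},\pi_{Y|W}|\pi_W)\le\tau} D(\pi_{Y|W}\|\nu_Y|\pi_W)\in[0,\infty],$$ where $\pi_{XW}$ ranges over the probability measures on $\mathcal X\times\{0,1\}$ that are concentrated on a compact set, and a supremum over the empty set is $0$. Let $\operatorname{dom}\psi=\{(\alpha,\tau)\in[0,\infty)^2:\psi(\alpha,\tau)<\infty\}$. Assume that $\int d(y,x_0)^q\,\mathrm d\nu_Y(y)<\infty$, and that $\nu_X$ is compactly supported or, more generally, that $$L_p:=\limsup_{\lambda\to\infty}\frac1\lambda\ln\int e^{\lambda d(x,x_0)^p}\,\mathrm d\nu_X(x)<\infty.$$ Then $\lim_{n\to\infty}E_n(\alpha,\tau)=\psi(\alpha,\tau)$ for every $(\alpha,\tau)$ in the interior of $\operatorname{dom}\psi$ (as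 a subset of $\mathbb R^2$). If moreover $\nu_X=\nu_Y$, then $\lim_{n\to\infty}E_n(\alpha,\tau)=\psi(\alpha,\tau)$ for all $\alpha\ge0$ and $\tau\ge0$. -/

import Mathlib

open MeasureTheory ProbabilityTheory Filter Topology
open scoped NNReal ENNReal

namespace ThickIsoperimetry

noncomputable section

variable {𝒳 𝒴 Ω : Type*} [MeasurableSpace 𝒳] [MeasurableSpace 𝒴] [MeasurableSpace Ω]

/-- The additive cost `c_n(x, y) = ∑ i, c (x i) (y i)` on `𝒳ⁿ × 𝒴ⁿ`. -/
def addCost (c : 𝒳 → 𝒴 → ℝ≥0) (n : ℕ) (x : Fin n → 𝒳) (y : Fin n → 𝒴) : ℝ≥0 :=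
  ∑ i, c (x i) (y i)

/-- The `t`-enlargement `{y | c_n(x, y) ≤ t for some x ∈ A}` of `A ⊆ 𝒳ⁿ`. -/
def enlargement (c : 𝒳 → 𝒴 → ℝ≥0) (n : ℕ) (A : Set (Fin n → 𝒳)) (t : ℝ) :
    Set (Fin n → 𝒴) :=
  {y | ∃ x ∈ A, (addCost c n x y : ℝ) ≤ t}

/-- The isoperimetric function `Γ_n(a, t)`: the infimum of `ν_Y^{⊗n}(A^{c_n ≤ t})` over the measurable
`A ⊆ 𝒳ⁿ` with `ν_X^{⊗n}(A) ≥ a`. The enlargement of a measurable set need not be Borel; its value is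
that of the outer measure, which on analytic sets is the value of the completed measure. -/
def isoFun (c : 𝒳 → 𝒴 → ℝ≥0) (νX : Measure 𝒳) (νY : Measure 𝒴) (n : ℕ) (a t : ℝ) : ℝ≥0∞ :=
  ⨅ (A : Set (Fin n → 𝒳)) (_ : MeasurableSet A)
    (_ : ENNReal.ofReal a ≤ Measure.pi (fun _ : Fin n => νX) A),
    Measure.pi (fun _ : Fin n => νY) (enlargement c n A t)

/-- The isoperimetric exponent `E_n(α, τ) = -(1/n) ln Γ_n(e^{-nα}, nτ)`, with `ln 0 = -∞`. -/
def isoExponent (c : 𝒳 → 𝒴 → ℝ≥0) (νX : Measure 𝒳) (νY : Measure 𝒴) (n : ℕ) (α τ : ℝ) : EReal :=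
  -(((1 / n : ℝ) : EReal) * ENNReal.log (isoFun c νX νY n (Real.exp (-(n * α))) (n * τ)))

/-- The optimal transport cost `C(μ, ν)`, the infimum of `∫ c dπ` over the couplings `π`. -/
def transportCost (c : 𝒳 → 𝒴 → ℝ≥0) (μ : Measure 𝒳) (ν : Measure 𝒴) : ℝ≥0∞ :=
  ⨅ (π : Measure (𝒳 × 𝒴)) (_ : π.fst = μ ∧ π.snd = ν), ∫⁻ z, (c z.1 z.2 : ℝ≥0∞) ∂π

/-- The conditional transport cost `C(π_{X|W}, π_{Y|W} | π_W)`. -/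
def condTransportCost (c : 𝒳 → 𝒴 → ℝ≥0) (κ : Kernel Ω 𝒳) (η : Kernel Ω 𝒴) (πW : Measure Ω) :
    ℝ≥0∞ :=
  ∫⁻ w, transportCost c (κ w) (η w) ∂πW

/-- The conditional relative entropy `D(π_{X|W} ‖ ν | π_W)` of a transition probability with respect
to a probability measure `ν`. -/
def condRelEntropy (κ : Kernel Ω 𝒳) (ν : Measure 𝒳) (πW : Measure Ω) : ℝ≥0∞ :=
  ∫⁻ w, InformationTheory.klDiv (κ w) ν ∂πW

/-- The measure is concentrated on a compact set. -/
def ConcentratedOnCompact {S : Type*} [TopologicalSpace S] [MeasurableSpace S] (μ : Measure S) :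
    Prop :=
  ∃ K : Set S, IsCompact K ∧ μ Kᶜ = 0

/-- The function `ψ(α, τ)`. The joint law `π_{XW}` is given by its marginal `π_W` on `{0, 1}` and its
transition probability `π_{X|W} = κ`; it is concentrated on a compact set. The supremum is
taken in `[0, ∞]`, so that it is `0` when no `π_{XW}` satisfies the constraints. -/
def psi [TopologicalSpace 𝒳] (c : 𝒳 → 𝒴 → ℝ≥0) (νX : Measure 𝒳) (νY : Measure 𝒴) (α τ : ℝ) :
    ℝ≥0∞ :=
  ⨆ (πW : Measure Bool) (_ : IsProbabilityMeasure πW)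
    (κ : Kernel Bool 𝒳) (_ : IsMarkovKernel κ)
    (_ : ConcentratedOnCompact (Measure.compProd πW κ))
    (_ : condRelEntropy κ νX πW ≤ ENNReal.ofReal α),
    ⨅ (η : Kernel Bool 𝒴) (_ : IsMarkovKernel η)
      (_ : condTransportCost c κ η πW ≤ ENNReal.ofReal τ),
      condRelEntropy η νY πW

/-- The domain `{(α, τ) | α, τ ≥ 0, ψ(α, τ) < ∞}`, as a subset of the plane. -/
def domPsi [TopologicalSpace 𝒳] (c : 𝒳 → 𝒴 → ℝ≥0) (νX : Measure 𝒳) (νY : Measure 𝒴) :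
    Set (ℝ × ℝ) :=
  {z | 0 ≤ z.1 ∧ 0 ≤ z.2 ∧ psi c νX νY z.1 z.2 < ⊤}

/-- The cost `d^p`. -/
def distCost (S : Type*) [MetricSpace S] (p : ℝ) : S → S → ℝ≥0 :=
  fun x y => nndist x y ^ p

/-- `L_p = limsup_{l → ∞} (1/l) ln E[exp(l d(X, x₀)^p)]`, in the extended reals. -/
def expRate {S : Type*} [MetricSpace S] [MeasurableSpace S] (ν : Measure S) (p : ℝ) (x₀ : S) :
    EReal :=
  limsup (fun l : ℝ => ((1 / l : ℝ) : EReal) *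
    ENNReal.log (∫⁻ x, ENNReal.ofReal (Real.exp (l * dist x x₀ ^ p)) ∂ν)) atTop

end

end ThickIsoperimetry

/-! The exponent is found by the method of types, applied to conditional laws along a path. For
fixed `α > 0` and `t < τ` with `psi α t` finite, both inequalities hold at `(α, τ)`; the interior
and, for equal laws, most of the quadrant consist of such points.

Upper bound on the exponent (`isoFun_ge`). A finite partition replaces the points of a large set by
words `S` of cells. The product law conditioned on `S` has relative entropy at most `n α`, and by
the chain rule this is the expected sum of the relative entropies of the conditional laws of the
letters given the past (`pathExp_finDiv_tilt_le`). Up to a finite net, Markov's inequality and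
pigeonhole give one type of these conditional laws that occurs with probability bounded below
independently of `n` (`exists_frequent_type`). For that type, couplings with laws on the second
space are chosen with average cost below `τ` and average entropy near `psi`. A second coordinate
driven letter by letter by these couplings stays in the enlargement and, by a martingale law of
large numbers and a change of measure, shows that the enlargement has probability at least `exp (-n
(psi + ε))` (`pathProb_image_ge`, `pi_image_ge`).

A type involves many conditional laws, whereas `psi` allows only two. Convex duality turns the
constraint problem into a linear functional of Lagrangian values, and a finite average of points of
the plane is dominated by an average of two of them (`exists_two_point_average`,
`exists_reach_family`).

Lower bound on the exponent (`isoFun_le`). A two-point family that nearly attains `psi` has a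
Lagrange multiplier for the transport constraint, and by finite duality its two laws have potentials
certifying the Lagrangian bound (`exists_multiplier`, `exists_potential`). The words typical for
this family, with a fixed word of labels, form a set of probability at least `exp (-n α)`; the
product of the potentials and Chernoff's inequality bound the probability of its enlargement
(`isoFun_le_of_potentials`).

Convexity of `psi` in the transport constraint gives the left continuity needed to match the two
bounds. For equal laws the identity transport gives `psi α τ ≤ α`, so only the two edges remain. On
`α = 0` everything is trivial; on `τ = 0` enlargements do nothing and the question is how small
non-null sets can be. -/

namespace ThickIsoperimetry

noncomputable section

/-! ### Finite-horizon processes on finite alphabets -/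

section Path

variable {Z U V : Type*} [Fintype Z] [Fintype U] [Fintype V]

/-- Expectation of `f` under the law of the first `n` letters of the process whose next letter has
weights `r l` after the history `l`. -/
def pathExp {Z : Type*} [Fintype Z] : (List Z → Z → ℝ) → ℕ → (List Z → ℝ) → ℝ
  | _, 0, f => f []
  | r, n + 1, f => ∑ z, r [] z * pathExp (fun l => r (z :: l)) n (fun l => f (z :: l))

/-- Probability of a set of words of length `n`. -/
def pathProb (r : List Z → Z → ℝ) (n : ℕ) (S : Set (List Z)) : ℝ :=
  pathExp r n (S.indicator 1)

/-- The sum of the increments `X h z` along a word. -/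
def pathSum {Z : Type*} : (List Z → Z → ℝ) → List Z → ℝ
  | _, [] => 0
  | X, z :: l => X [] z + pathSum (fun h => X (z :: h)) l

/-- Transition probabilities given the history. -/
def IsTransition (r : List Z → Z → ℝ) : Prop :=
  ∀ l, (∀ z, 0 ≤ r l z) ∧ ∑ z, r l z = 1

/-- Relative entropy of weights on a finite set. -/
def finDiv (k P : U → ℝ) : ℝ := ∑ u, k u * Real.log (k u / P u)

lemma IsTransition.cons {r : List Z → Z → ℝ} (hr : IsTransition r) (z : Z) :
    IsTransition (fun l => r (z :: l)) := fun l => hr (z :: l)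

lemma pathExp_mono {r : List Z → Z → ℝ} (hr : ∀ l z, 0 ≤ r l z) {n : ℕ} {f g : List Z → ℝ}
    (h : ∀ l, l.length = n → f l ≤ g l) : pathExp r n f ≤ pathExp r n g := by
  induction n generalizing r f g with
  | zero => exact h [] rfl
  | succ n ih =>
    refine Finset.sum_le_sum fun z _ => mul_le_mul_of_nonneg_left ?_ (hr _ _)
    exact ih (fun l z' => hr _ _) fun l hl => h _ (by simp [hl])

lemma pathExp_congr {r : List Z → Z → ℝ} {n : ℕ} {f g : List Z → ℝ}
    (h : ∀ l, l.length = n → f l = g l) : pathExp r n f = pathExp r n g := by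
  induction n generalizing r f g with
  | zero => exact h [] rfl
  | succ n ih =>
    refine Finset.sum_congr rfl fun z _ => ?_
    rw [ih fun l hl => h _ (by simp [hl])]

lemma pathExp_add (r : List Z → Z → ℝ) (n : ℕ) (f g : List Z → ℝ) :
    pathExp r n (fun l => f l + g l) = pathExp r n f + pathExp r n g := by
  induction n generalizing r f g with
  | zero => rfl
  | succ n ih => simp only [pathExp, ih, mul_add, Finset.sum_add_distrib]

lemma pathExp_const_mul (r : List Z → Z → ℝ) (n : ℕ) (c : ℝ) (f : List Z → ℝ) :
    pathExp r n (fun l => c * f l) = c * pathExp r n f := by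
  induction n generalizing r f with
  | zero => rfl
  | succ n ih => simp only [pathExp, ih, Finset.mul_sum]; congr! 1; ring

lemma pathExp_zero (r : List Z → Z → ℝ) (n : ℕ) : pathExp r n (fun _ => 0) = 0 := by
  simpa using pathExp_const_mul r n 0 (fun _ => 0)

lemma pathExp_sum {ι : Type*} (s : Finset ι) (r : List Z → Z → ℝ) (n : ℕ)
    (f : ι → List Z → ℝ) :
    pathExp r n (fun l => ∑ i ∈ s, f i l) = ∑ i ∈ s, pathExp r n (f i) := by
  classical
  induction s using Finset.induction_on with
  | empty => simp [pathExp_zero]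
  | insert a s ha ih => simp only [Finset.sum_insert ha, pathExp_add, ih]

lemma pathExp_const {r : List Z → Z → ℝ} (hr : IsTransition r) (n : ℕ) (c : ℝ) :
    pathExp r n (fun _ => c) = c := by
  induction n generalizing r with
  | zero => rfl
  | succ n ih =>
    simp only [pathExp, ih (hr.cons _), ← Finset.sum_mul, (hr []).2, one_mul]

lemma pathExp_nonneg {r : List Z → Z → ℝ} (hr : ∀ l z, 0 ≤ r l z) {n : ℕ} {f : List Z → ℝ}
    (h : ∀ l, l.length = n → 0 ≤ f l) : 0 ≤ pathExp r n f := by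
  simpa [pathExp_zero] using pathExp_mono hr (f := fun _ => 0) h

lemma pathExp_pathSum_eq_zero {r : List Z → Z → ℝ} (hr : IsTransition r) (n : ℕ)
    {X : List Z → Z → ℝ} (hX : ∀ l, ∑ z, r l z * X l z = 0) :
    pathExp r n (pathSum X) = 0 := by
  induction n generalizing r X with
  | zero => rfl
  | succ n ih =>
    simp only [pathExp, pathSum, pathExp_add, pathExp_const (hr.cons _)]
    simp only [ih (hr.cons _) (fun l => hX _), add_zero, hX]

/-- Centered increments of a process are orthogonal, so no cross terms survive and the second moment
grows only linearly in the number of steps. -/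
lemma pathExp_pathSum_sq_le {r : List Z → Z → ℝ} (hr : IsTransition r) (n : ℕ)
    {X : List Z → Z → ℝ} (hX : ∀ l, ∑ z, r l z * X l z = 0) {M : ℝ} (hM : ∀ l z, |X l z| ≤ M) :
    pathExp r n (fun l => pathSum X l ^ 2) ≤ n * M ^ 2 := by
  induction n generalizing r X with
  | zero => simp [pathExp, pathSum]
  | succ n ih =>
    have h1 : ∀ z, pathExp (fun l => r (z :: l)) n (fun l => pathSum X (z :: l) ^ 2)
        ≤ (n + 1) * M ^ 2 := by
      intro z
      have e : ∀ l, pathSum X (z :: l) ^ 2 = X [] z ^ 2 +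
          (2 * X [] z * pathSum (fun h => X (z :: h)) l + pathSum (fun h => X (z :: h)) l ^ 2) := by
        intro l; simp only [pathSum]; ring
      simp only [e]
      rw [pathExp_add, pathExp_const (hr.cons _), pathExp_add, pathExp_const_mul,
        pathExp_pathSum_eq_zero (hr.cons _) n (fun l => hX _)]
      have := ih (hr.cons z) (X := fun h => X (z :: h)) (fun l => hX _) (fun l z => hM _ _)
      have h2 : X [] z ^ 2 ≤ M ^ 2 := sq_le_sq' (by linarith [neg_abs_le (X [] z), hM [] z])
        ((le_abs_self _).trans (hM _ _))
      linarith
    calc pathExp r (n + 1) (fun l => pathSum X l ^ 2)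
        ≤ ∑ z, r [] z * ((n + 1) * M ^ 2) :=
          Finset.sum_le_sum fun z _ => mul_le_mul_of_nonneg_left (h1 z) ((hr []).1 z)
      _ = _ := by rw [← Finset.sum_mul, (hr []).2]; push_cast; ring

lemma pathProb_mono {r : List Z → Z → ℝ} (hr : ∀ l z, 0 ≤ r l z) {n : ℕ} {S T : Set (List Z)}
    (h : ∀ l, l.length = n → l ∈ S → l ∈ T) : pathProb r n S ≤ pathProb r n T := by
  refine pathExp_mono hr fun l hl => ?_
  by_cases hS : l ∈ S
  · simp [hS, h l hl hS]
  · simp only [Set.indicator_of_notMem hS]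
    exact Set.indicator_nonneg (fun _ _ => zero_le_one) _

/-- Chebyshev's inequality for martingales with bounded increments. -/
lemma pathProb_pathSum_ge {r : List Z → Z → ℝ} (hr : IsTransition r) {n : ℕ} (hn : 0 < n)
    {X : List Z → Z → ℝ} (hX : ∀ l, ∑ z, r l z * X l z = 0) {M : ℝ} (hM : ∀ l z, |X l z| ≤ M)
    {ε : ℝ} (hε : 0 < ε) :
    pathProb r n {l | n * ε < pathSum X l} ≤ M ^ 2 / (n * ε ^ 2) := by
  have hn' : (0 : ℝ) < n := by exact_mod_cast hn
  have h1 := pathExp_pathSum_sq_le hr n hX hM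
  have h2 : pathProb r n {l | n * ε < pathSum X l} ≤
      pathExp r n (fun l => ((n * ε) ^ 2)⁻¹ * pathSum X l ^ 2) := by
    refine pathExp_mono (fun l z => (hr l).1 z) fun l _ => ?_
    by_cases h : l ∈ {l | n * ε < pathSum X l}
    · rw [Set.indicator_of_mem h]
      have h' : n * ε < pathSum X l := h
      rw [Pi.one_apply, inv_mul_eq_div, one_le_div (by positivity)]
      exact pow_le_pow_left₀ (by positivity) h'.le 2
    · rw [Set.indicator_of_notMem h]; positivity
  rw [pathExp_const_mul] at h2
  refine h2.trans ?_
  calc ((n * ε) ^ 2)⁻¹ * pathExp r n (fun l => pathSum X l ^ 2)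
      ≤ ((n * ε) ^ 2)⁻¹ * (n * M ^ 2) := by gcongr
    _ = _ := by field_simp

lemma pathProb_le_add_of_subset {r : List Z → Z → ℝ} (hr : ∀ l z, 0 ≤ r l z) {n : ℕ}
    {S T W G : Set (List Z)} (h : ∀ l, l.length = n → l ∈ S → l ∉ T → l ∉ W → l ∈ G) :
    pathProb r n S ≤ pathProb r n G + pathProb r n T + pathProb r n W := by
  unfold pathProb
  rw [← pathExp_add, ← pathExp_add]
  refine pathExp_mono hr fun l hl => ?_
  have h0 : ∀ S : Set (List Z), 0 ≤ S.indicator (1 : List Z → ℝ) l := fun S =>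
    Set.indicator_nonneg (fun _ _ => zero_le_one) _
  by_cases hS : l ∈ S
  · by_cases hT : l ∈ T
    · simp only [Set.indicator_of_mem hS, Set.indicator_of_mem hT]
      linarith [h0 G, h0 W]
    by_cases hW : l ∈ W
    · simp only [Set.indicator_of_mem hS, Set.indicator_of_mem hW]
      linarith [h0 G, h0 T]
    · simp only [Set.indicator_of_mem hS, Set.indicator_of_mem (h l hl hS hT hW)]
      linarith [h0 T, h0 W]
  · simp only [Set.indicator_of_notMem hS]
    linarith [h0 G, h0 T, h0 W]

/-- Pigeonhole over a finite family. The loss is the cardinality of the family, which does not grow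
with `n`; this is how a single type is selected. -/
lemma exists_pathProb_ge {ι : Type*} (s : Finset ι) {r : List Z → Z → ℝ}
    (hr : ∀ l z, 0 ≤ r l z) {n : ℕ} {S : Set (List Z)} {T : ι → Set (List Z)}
    (h : ∀ l, l.length = n → l ∈ S → ∃ i ∈ s, l ∈ T i) (hS : 0 < pathProb r n S) :
    ∃ i ∈ s, pathProb r n S / s.card ≤ pathProb r n (T i) := by
  have h1 : pathProb r n S ≤ ∑ i ∈ s, pathProb r n (T i) := by
    unfold pathProb
    rw [← pathExp_sum]
    refine pathExp_mono hr fun l hl => ?_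
    by_cases hlS : l ∈ S
    · obtain ⟨i, hi, hT⟩ := h l hl hlS
      rw [Set.indicator_of_mem hlS]
      calc (1 : List Z → ℝ) l = (T i).indicator 1 l := by rw [Set.indicator_of_mem hT]
        _ ≤ _ := Finset.single_le_sum (f := fun i => (T i).indicator (1 : List Z → ℝ) l)
          (fun j _ => Set.indicator_nonneg (fun _ _ => zero_le_one) _) hi
    · rw [Set.indicator_of_notMem hlS]
      exact Finset.sum_nonneg fun j _ => Set.indicator_nonneg (fun _ _ => zero_le_one) _
  by_contra! hc
  have hne : s.Nonempty := by
    by_contra hs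
    rw [Finset.not_nonempty_iff_eq_empty] at hs
    subst hs; simp at h1; linarith
  have := Finset.sum_lt_sum_of_nonempty hne hc
  rw [Finset.sum_const, nsmul_eq_mul, mul_div_cancel₀] at this
  · linarith
  · exact_mod_cast hne.card_pos.ne'

/-- Projection of a process on pairs to its first coordinate. -/
lemma pathExp_map_fst {r : List (U × V) → U × V → ℝ} {k : List U → U → ℝ}
    (h : ∀ l u, ∑ v, r l (u, v) = k (l.map Prod.fst) u) (n : ℕ) (f : List U → ℝ) :
    pathExp r n (fun l => f (l.map Prod.fst)) = pathExp k n f := by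
  induction n generalizing r k f with
  | zero => rfl
  | succ n ih =>
    simp only [pathExp, Fintype.sum_prod_type, List.map_cons]
    refine Finset.sum_congr rfl fun u _ => ?_
    have : ∀ v, pathExp (fun l => r ((u, v) :: l)) n (fun l => f (u :: l.map Prod.fst)) =
        pathExp (fun l => k (u :: l)) n (fun l => f (u :: l)) := fun v =>
      ih (r := fun l => r ((u, v) :: l)) (k := fun l => k (u :: l))
        (fun l u' => by simpa using h ((u, v) :: l) u') (fun l => f (u :: l))
    simp only [this, ← Finset.sum_mul, h, List.map_nil]

/-- Change of measure: the law of the second coordinates dominates the reweighted law of the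
pair process. -/
lemma pathExp_change_of_measure {r : List (U × V) → U × V → ℝ} (hr : ∀ l z, 0 ≤ r l z)
    {h : List (U × V) → V → ℝ} (hh : ∀ l v, ∑ u, r l (u, v) = h l v) {N : V → ℝ}
    (hN : ∀ v, 0 ≤ N v) (hac : ∀ l v, N v = 0 → h l v = 0) (n : ℕ) {g : List V → ℝ}
    (hg : ∀ l, 0 ≤ g l) :
    pathExp r n (fun l => g (l.map Prod.snd) *
      Real.exp (-pathSum (fun l z => Real.log (h l z.2 / N z.2)) l)) ≤
      pathExp (fun _ => N) n g := by
  induction n generalizing r h g with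
  | zero => simp [pathExp, pathSum]
  | succ n ih =>
    simp only [pathExp, Fintype.sum_prod_type, List.map_cons, pathSum]
    rw [Finset.sum_comm]
    refine Finset.sum_le_sum fun v _ => ?_
    have hE : 0 ≤ pathExp (fun _ => N) n (fun l => g (v :: l)) :=
      pathExp_nonneg (fun _ => hN) fun _ _ => hg _
    -- A letter of conditional weight zero contributes nothing on the left, which is why only an
    -- inequality holds. Otherwise the factor `exp (-log (h / N)) = N / h` turns the total weight
    -- `h` of the pairs ending in `v` into `N`.
    by_cases h0 : h [] v = 0
    · have : ∀ u, r [] (u, v) = 0 := by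
        intro u
        have := hh [] v
        rw [h0, Finset.sum_eq_zero_iff_of_nonneg (fun u _ => hr _ _)] at this
        exact this u (Finset.mem_univ _)
      simp only [this, zero_mul, Finset.sum_const_zero]
      exact mul_nonneg (hN v) hE
    · have hNv : N v ≠ 0 := fun h' => h0 (hac _ _ h')
      have hhpos : 0 < h [] v := lt_of_le_of_ne (by
        rw [← hh]; exact Finset.sum_nonneg fun u _ => hr _ _) (Ne.symm h0)
      have hNpos : 0 < N v := lt_of_le_of_ne (hN v) (Ne.symm hNv)
      have key : ∀ u, r [] (u, v) * pathExp (fun l => r ((u, v) :: l)) n (fun l =>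
          g (v :: l.map Prod.snd) * Real.exp (-(Real.log (h [] v / N v) +
            pathSum (fun l z => Real.log (h ((u, v) :: l) z.2 / N z.2)) l))) ≤
          r [] (u, v) * (N v / h [] v * pathExp (fun _ => N) n (fun l => g (v :: l))) := by
        intro u
        refine mul_le_mul_of_nonneg_left ?_ (hr _ _)
        have e : ∀ l : List (U × V), g (v :: l.map Prod.snd) *
            Real.exp (-(Real.log (h [] v / N v) +
            pathSum (fun l z => Real.log (h ((u, v) :: l) z.2 / N z.2)) l)) =
            N v / h [] v * (g (v :: l.map Prod.snd) * Real.exp (-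
            pathSum (fun l z => Real.log (h ((u, v) :: l) z.2 / N z.2)) l)) := by
          intro l
          rw [neg_add, Real.exp_add, Real.exp_neg, Real.exp_log (by positivity), inv_div]
          ring
        simp only [e]
        rw [pathExp_const_mul]
        refine mul_le_mul_of_nonneg_left ?_ (by positivity)
        exact ih (r := fun l => r ((u, v) :: l)) (h := fun l => h ((u, v) :: l))
          (fun _ _ => hr _ _) (fun _ _ => hh _ _) (fun _ _ => hac _ _)
          (g := fun l => g (v :: l)) (fun _ => hg _)
      refine (Finset.sum_le_sum fun u _ => key u).trans ?_
      rw [← Finset.sum_mul, hh]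
      rw [← mul_assoc, mul_div_cancel₀ _ h0]

/-- The transition probabilities of the product law with weights `P` tilted by `f`. -/
def tilt {U : Type*} [Fintype U] (P : U → ℝ) : ℕ → (List U → ℝ) → List U → U → ℝ
  | 0, _, _ => P
  | n + 1, f, [] => fun u =>
    -- The default `P` after histories of tilted mass zero, like `P` once the horizon is exhausted,
    -- keeps every row a probability vector carried by the support of `P`.
    if pathExp (fun _ => P) (n + 1) f = 0 then P u else
      P u * pathExp (fun _ => P) n (fun l => f (u :: l)) / pathExp (fun _ => P) (n + 1) f
  | n + 1, f, a :: l => tilt P n (fun l => f (a :: l)) l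

lemma isTransition_const {P : U → ℝ} (hP : ∀ u, 0 ≤ P u) (hP1 : ∑ u, P u = 1) :
    IsTransition (fun _ : List U => P) := fun _ => ⟨hP, hP1⟩

lemma tilt_isTransition {P : U → ℝ} (hP : ∀ u, 0 ≤ P u) (hP1 : ∑ u, P u = 1) (n : ℕ)
    {f : List U → ℝ} (hf : ∀ l, 0 ≤ f l) : IsTransition (tilt P n f) := by
  induction n generalizing f with
  | zero => intro l; simpa [tilt] using ⟨hP, hP1⟩
  | succ n ih =>
    intro l
    cases l with
    | cons a l => exact ih (fun l => hf _) l
    | nil =>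
      by_cases h0 : pathExp (fun _ => P) (n + 1) f = 0
      · simpa [tilt, h0] using ⟨hP, hP1⟩
      · simp only [tilt, h0, if_false]
        refine ⟨fun u => div_nonneg (mul_nonneg (hP u) (pathExp_nonneg (fun _ => hP) fun _ _ => hf _))
          (pathExp_nonneg (fun _ => hP) fun _ _ => hf _), ?_⟩
        rw [← Finset.sum_div]
        exact div_self h0

lemma tilt_eq_zero {P : U → ℝ} (n : ℕ) (f : List U → ℝ) (l : List U) {u : U} (hu : P u = 0) :
    tilt P n f l u = 0 := by
  induction n generalizing f l with
  | zero => simpa [tilt]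
  | succ n ih =>
    cases l with
    | nil => simp [tilt, hu]
    | cons a l => exact ih _ _

/-- The successive quotients defining the tilted weights telescope, so the tilted process is the
product law with density proportional to `f`. -/
lemma pathExp_tilt {P : U → ℝ} (hP : ∀ u, 0 ≤ P u) (n : ℕ) {f : List U → ℝ}
    (hf : ∀ l, 0 ≤ f l) (F : List U → ℝ) (h0 : pathExp (fun _ => P) n f ≠ 0) :
    pathExp (tilt P n f) n F * pathExp (fun _ => P) n f =
      pathExp (fun _ => P) n (fun l => f l * F l) := by
  induction n generalizing f F with
  | zero => simp [pathExp, mul_comm]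
  | succ n ih =>
    have e : pathExp (tilt P (n + 1) f) (n + 1) F * pathExp (fun _ => P) (n + 1) f =
        ∑ u, P u * (pathExp (fun _ => P) n (fun l => f (u :: l)) *
          pathExp (tilt P n (fun l => f (u :: l))) n (fun l => F (u :: l))) := by
      rw [pathExp, Finset.sum_mul]
      refine Finset.sum_congr rfl fun u _ => ?_
      simp only [tilt, h0, if_false]
      field_simp
    rw [e, pathExp]
    refine Finset.sum_congr rfl fun u _ => ?_
    congr 1
    by_cases hu : pathExp (fun _ => P) n (fun l => f (u :: l)) = 0
    · rw [hu, zero_mul]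
      by_contra hne
      -- There are finitely many words of length `n`, so `F` is bounded on them and `f * F` lies
      -- between multiples of `f`, whose expectation is zero here.
      have hle : ∃ C : ℝ, ∀ l : List U, l.length = n → |F (u :: l)| ≤ C := by
        have : Set.Finite {l : List U | l.length = n} := List.finite_length_eq U n
        obtain ⟨C, hC⟩ := (this.image (fun l => |F (u :: l)|)).bddAbove
        exact ⟨C, fun l hl => hC ⟨l, hl, rfl⟩⟩
      obtain ⟨C, hC⟩ := hle
      have h1 : pathExp (fun _ => P) n (fun l => f (u :: l) * F (u :: l)) ≤
          pathExp (fun _ => P) n (fun l => C * f (u :: l)) :=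
        pathExp_mono (fun _ => hP) fun l hl => by
          nlinarith [hf (u :: l), le_abs_self (F (u :: l)), hC l hl]
      have h2 : pathExp (fun _ => P) n (fun l => (-C) * f (u :: l)) ≤
          pathExp (fun _ => P) n (fun l => f (u :: l) * F (u :: l)) :=
        pathExp_mono (fun _ => hP) fun l hl => by
          nlinarith [hf (u :: l), neg_abs_le (F (u :: l)), hC l hl]
      rw [pathExp_const_mul, hu, mul_zero] at h1 h2
      exact hne (le_antisymm h2 h1)
    · rw [mul_comm]
      exact ih (fun l => hf _) _ hu

/-- The expected sum of the conditional relative entropies of the tilted law. -/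
lemma pathExp_finDiv_tilt_le {P : U → ℝ} (hP : ∀ u, 0 ≤ P u) (hP1 : ∑ u, P u = 1) (n : ℕ)
    {f : List U → ℝ} (hf : ∀ l, 0 ≤ f l) (hf1 : ∀ l, f l ≤ 1)
    (h0 : pathExp (fun _ => P) n f ≠ 0) :
    pathExp (tilt P n f) n (pathSum fun l _ => finDiv (tilt P n f l) P) ≤
      -Real.log (pathExp (fun _ => P) n f) := by
  induction n generalizing f with
  | zero =>
    simp only [pathExp, pathSum] at h0 ⊢
    have := Real.log_nonpos (hf []) (hf1 [])
    linarith
  | succ n ih =>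
    have hT := tilt_isTransition hP hP1 (n + 1) hf
    set E := pathExp (fun _ => P) (n + 1) f with hE
    have hEpos : 0 < E := lt_of_le_of_ne (pathExp_nonneg (fun _ => hP) fun _ _ => hf _) (Ne.symm h0)
    have hk : ∀ u, tilt P (n + 1) f [] u =
        P u * pathExp (fun _ => P) n (fun l => f (u :: l)) / E := by
      intro u; simp [tilt, h0, ← hE]
    -- Chain rule: the first letter contributes `log (E_u / E)`, where `E_u` is the mass of `f`
    -- after the letter `u`, and the induction hypothesis bounds the remaining entropies by `-log
    -- E_u`. The terms in `E_u` cancel.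
    have key : ∀ u, tilt P (n + 1) f [] u * (Real.log (tilt P (n + 1) f [] u / P u) +
        pathExp (tilt P n (fun l => f (u :: l))) n
          (pathSum fun l _ => finDiv (tilt P n (fun l => f (u :: l)) l) P)) ≤
        tilt P (n + 1) f [] u * (-Real.log E) := by
      intro u
      by_cases hku : tilt P (n + 1) f [] u = 0
      · simp [hku]
      refine mul_le_mul_of_nonneg_left ?_ ((hT []).1 u)
      have hPu : P u ≠ 0 := fun h => hku (by rw [hk, h]; simp)
      have hEu : pathExp (fun _ => P) n (fun l => f (u :: l)) ≠ 0 := fun h => hku (by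
        rw [hk, h]; simp)
      have := ih (f := fun l => f (u :: l)) (fun l => hf _) (fun l => hf1 _) hEu
      have e : tilt P (n + 1) f [] u / P u = pathExp (fun _ => P) n (fun l => f (u :: l)) / E := by
        rw [hk]; field_simp
      rw [e, Real.log_div hEu h0]
      linarith
    have e2 : pathExp (tilt P (n + 1) f) (n + 1)
        (pathSum fun l _ => finDiv (tilt P (n + 1) f l) P) =
        ∑ u, tilt P (n + 1) f [] u * (Real.log (tilt P (n + 1) f [] u / P u) +
        pathExp (tilt P n (fun l => f (u :: l))) n
          (pathSum fun l _ => finDiv (tilt P n (fun l => f (u :: l)) l) P)) := by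
      rw [pathExp]
      simp only [pathSum]
      have : ∀ u, pathExp (fun l => tilt P (n + 1) f (u :: l)) n (fun l =>
          finDiv (tilt P (n + 1) f []) P +
            pathSum (fun h _ => finDiv (tilt P (n + 1) f (u :: h)) P) l) =
          finDiv (tilt P (n + 1) f []) P + pathExp (tilt P n (fun l => f (u :: l))) n
          (pathSum fun l _ => finDiv (tilt P n (fun l => f (u :: l)) l) P) := by
        intro u
        rw [pathExp_add, pathExp_const (hT.cons u)]
        rfl
      simp only [this, mul_add, Finset.sum_add_distrib, ← Finset.sum_mul, (hT []).2, one_mul]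
      rfl
    rw [e2]
    refine (Finset.sum_le_sum fun u _ => key u).trans ?_
    rw [← Finset.sum_mul, (hT []).2, one_mul]

/-- The expectation under a product law as a sum over words indexed by `Fin n`. -/
lemma pathExp_const_eq_sum (P : Z → ℝ) (n : ℕ) (f : List Z → ℝ) :
    pathExp (fun _ => P) n f = ∑ x : Fin n → Z, (∏ i, P (x i)) * f (List.ofFn x) := by
  induction n generalizing f with
  | zero => simp [pathExp]
  | succ n ih =>
    rw [pathExp, ← (Fin.consEquiv (fun _ : Fin (n + 1) => Z)).sum_comp, Fintype.sum_prod_type]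
    refine Finset.sum_congr rfl fun z _ => ?_
    rw [ih, Finset.mul_sum]
    refine Finset.sum_congr rfl fun x _ => ?_
    simp [Fin.prod_univ_succ, Fin.consEquiv, List.ofFn_succ, mul_assoc]

lemma pathSum_ofFn_const {Z : Type*} {n : ℕ} (g : Z → ℝ) (x : Fin n → Z) :
    pathSum (fun _ => g) (List.ofFn x) = ∑ i, g (x i) := by
  induction n with
  | zero => simp [pathSum]
  | succ n ih => simp [List.ofFn_succ, pathSum, Fin.sum_univ_succ, ih]

end Path

end

end ThickIsoperimetry

namespace ThickIsoperimetry

noncomputable section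

/-! ### Relative entropy -/

section KL

open InformationTheory

variable {Y : Type*} [MeasurableSpace Y]

/-- The relative entropy of a measure with bounded density. -/
lemma klDiv_withDensity {ν : Measure Y} [IsProbabilityMeasure ν] {f : Y → ℝ} (hf : Measurable f)
    (h0 : ∀ y, 0 ≤ f y) {M : ℝ} (hM : ∀ y, f y ≤ M) (h1 : ∫ y, f y ∂ν = 1) :
    klDiv (ν.withDensity fun y => ENNReal.ofReal (f y)) ν =
      ENNReal.ofReal (∫ y, f y * Real.log (f y) ∂ν) := by
  have hfi : Integrable f ν := Integrable.of_bound hf.aestronglyMeasurable M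
    (ae_of_all _ fun y => by rw [Real.norm_of_nonneg (h0 y)]; exact hM y)
  have : IsFiniteMeasure (ν.withDensity fun y => ENNReal.ofReal (f y)) :=
    isFiniteMeasure_withDensity_ofReal hfi.2
  obtain ⟨C, hC⟩ : ∃ C, ∀ x ∈ Set.Icc (0 : ℝ) M, ‖x * Real.log x‖ ≤ C :=
    isCompact_Icc.exists_bound_of_continuousOn Real.continuous_mul_log.continuousOn
  have hli : Integrable (fun y => f y * Real.log (f y)) ν :=
    Integrable.of_bound (hf.mul (Real.measurable_log.comp hf)).aestronglyMeasurable C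
      (ae_of_all _ fun y => hC _ ⟨h0 y, hM y⟩)
  rw [klDiv_eq_lintegral_klFun_of_ac (withDensity_absolutelyContinuous _ _)]
  have h2 : ∀ᵐ y ∂ν, ENNReal.ofReal (klFun (((ν.withDensity fun y =>
      ENNReal.ofReal (f y)).rnDeriv ν y).toReal)) = ENNReal.ofReal (klFun (f y)) := by
    filter_upwards [Measure.rnDeriv_withDensity ν hf.ennreal_ofReal] with y hy
    rw [hy, ENNReal.toReal_ofReal (h0 y)]
  rw [lintegral_congr_ae h2, ← ofReal_integral_eq_lintegral_ofReal]
  · congr 1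
    simp only [klFun_apply]
    have e1 : ∫ y, (f y * Real.log (f y) + 1 - f y) ∂ν =
        ∫ y, (f y * Real.log (f y) + 1) ∂ν - ∫ y, f y ∂ν :=
      integral_sub (hli.add (integrable_const _)) hfi
    have e2 : ∫ y, (f y * Real.log (f y) + 1) ∂ν =
        ∫ y, f y * Real.log (f y) ∂ν + ∫ _, (1 : ℝ) ∂ν := integral_add hli (integrable_const _)
    rw [e1, e2, h1]
    simp
  · simp only [klFun_apply]
    exact (hli.add (integrable_const _)).sub hfi
  · exact ae_of_all _ fun y => klFun_nonneg (h0 y)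

/-- The variational inequality of Donsker and Varadhan, in linearized form. -/
lemma integral_log_le_klDiv {η ν : Measure Y} [IsProbabilityMeasure η] [IsProbabilityMeasure ν]
    (hfin : klDiv η ν ≠ ⊤) {g : Y → ℝ} (hg : Integrable g ν) (h0 : ∀ y, 0 ≤ g y)
    (hlog : Integrable (fun y => Real.log (g y)) η) (hpos : ∀ᵐ y ∂η, 0 < g y) :
    ∫ y, Real.log (g y) ∂η ≤ (klDiv η ν).toReal + ∫ y, g y ∂ν - 1 := by
  obtain ⟨hac, h_int⟩ := klDiv_ne_top_iff.1 hfin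
  rw [toReal_klDiv_of_measure_eq hac (by simp)]
  have h1 : ∫ y, llr η ν y ∂η - ∫ y, Real.log (g y) ∂η =
      ∫ y, (η.rnDeriv ν y).toReal • (llr η ν y - Real.log (g y)) ∂ν := by
    rw [integral_rnDeriv_smul hac, integral_sub h_int hlog]
  have hI : Integrable (fun y => (η.rnDeriv ν y).toReal • (llr η ν y - Real.log (g y))) ν :=
    (integrable_rnDeriv_smul_iff hac).2 (h_int.sub hlog)
  have hr : Integrable (fun y => (η.rnDeriv ν y).toReal) ν := Measure.integrable_toReal_rnDeriv
  -- Pointwise `r - g ≤ r (log r - log g)`, which is `log x ≤ x - 1` at `x = g / r`.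
  have h2 : ∫ y, (η.rnDeriv ν y).toReal ∂ν - ∫ y, g y ∂ν ≤
      ∫ y, (η.rnDeriv ν y).toReal • (llr η ν y - Real.log (g y)) ∂ν := by
    rw [← integral_sub hr hg]
    refine integral_mono_ae (hr.sub hg) hI ?_
    filter_upwards [Measure.ae_rnDeriv_ne_zero_imp_of_ae (ν := ν) hpos,
      Measure.rnDeriv_lt_top η ν] with y hy hlt
    simp only [smul_eq_mul, llr_def]
    set r := η.rnDeriv ν y with hrdef
    by_cases hr0 : r = 0
    · simp [hr0, h0 y]
    · have hrp : 0 < r.toReal := ENNReal.toReal_pos hr0 hlt.ne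
      have hgp := hy hr0
      have := Real.log_le_sub_one_of_pos (div_pos hgp hrp)
      rw [Real.log_div hgp.ne' hrp.ne'] at this
      have h3 : r.toReal * (Real.log (g y) - Real.log r.toReal) ≤ r.toReal * (g y / r.toReal - 1) :=
        mul_le_mul_of_nonneg_left this hrp.le
      have h4 : r.toReal * (g y / r.toReal - 1) = g y - r.toReal := by field_simp
      nlinarith
  have h3 : ∫ y, (η.rnDeriv ν y).toReal ∂ν = 1 := by
    rw [Measure.integral_toReal_rnDeriv hac]; simp
  linarith

/-- Convexity of the relative entropy in its first argument. -/
lemma klDiv_mix_le {μ μ' ν : Measure Y} [IsFiniteMeasure μ] [IsFiniteMeasure μ']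
    [IsFiniteMeasure ν] {a b : ℝ≥0} (hab : a + b = 1) :
    klDiv (a • μ + b • μ') ν ≤ a * klDiv μ ν + b * klDiv μ' ν := by
  rcases eq_or_ne a 0 with rfl | ha
  · have : b = 1 := by simpa using hab
    simp [this]
  rcases eq_or_ne b 0 with rfl | hb
  · have : a = 1 := by simpa using hab
    simp [this]
  have ha' : (a : ℝ≥0∞) ≠ 0 := by exact_mod_cast ha
  have hb' : (b : ℝ≥0∞) ≠ 0 := by exact_mod_cast hb
  -- Both weights are now nonzero, so a singular part on either side makes the right side infinite.
  by_cases h1 : μ ≪ ν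
  swap
  · simp [klDiv_of_not_ac h1, ENNReal.mul_top ha']
  by_cases h2 : μ' ≪ ν
  swap
  · simp [klDiv_of_not_ac h2, ENNReal.mul_top hb']
  have h3 : a • μ + b • μ' ≪ ν := by
    intro s hs
    simp [h1 hs, h2 hs]
  rw [klDiv_eq_lintegral_klFun_of_ac h1, klDiv_eq_lintegral_klFun_of_ac h2,
    klDiv_eq_lintegral_klFun_of_ac h3, ← lintegral_const_mul' _ _ ENNReal.coe_ne_top,
    ← lintegral_const_mul' _ _ ENNReal.coe_ne_top, ← lintegral_add_left]
  · refine lintegral_mono_ae ?_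
    filter_upwards [Measure.rnDeriv_add (a • μ) (b • μ') ν, Measure.rnDeriv_smul_left μ ν a,
      Measure.rnDeriv_smul_left μ' ν b, Measure.rnDeriv_lt_top μ ν,
      Measure.rnDeriv_lt_top μ' ν] with y e1 e2 e3 f1 f2
    rw [e1, Pi.add_apply, e2, e3, Pi.smul_apply, Pi.smul_apply]
    have : (a • μ.rnDeriv ν y + b • μ'.rnDeriv ν y).toReal =
        (a : ℝ) • (μ.rnDeriv ν y).toReal + (b : ℝ) • (μ'.rnDeriv ν y).toReal := by
      rw [ENNReal.toReal_add]
      · simp [ENNReal.smul_def]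
      · exact ENNReal.mul_ne_top ENNReal.coe_ne_top f1.ne
      · exact ENNReal.mul_ne_top ENNReal.coe_ne_top f2.ne
    rw [this]
    have hc := convexOn_klFun.2 (Set.mem_Ici.2 (ENNReal.toReal_nonneg (a := μ.rnDeriv ν y)))
      (Set.mem_Ici.2 (ENNReal.toReal_nonneg (a := μ'.rnDeriv ν y)))
      a.coe_nonneg b.coe_nonneg (show (a : ℝ) + b = 1 by exact_mod_cast hab)
    refine (ENNReal.ofReal_le_ofReal hc).trans ?_
    rw [ENNReal.ofReal_add (by
        exact mul_nonneg a.coe_nonneg (klFun_nonneg ENNReal.toReal_nonneg)) (by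
        exact mul_nonneg b.coe_nonneg (klFun_nonneg ENNReal.toReal_nonneg))]
    simp only [smul_eq_mul]
    rw [ENNReal.ofReal_mul a.coe_nonneg, ENNReal.ofReal_mul b.coe_nonneg, ENNReal.ofReal_coe_nnreal,
      ENNReal.ofReal_coe_nnreal]
  · exact (measurable_klFun.comp (Measure.measurable_rnDeriv μ ν).ennreal_toReal).ennreal_ofReal.const_mul _

end KL

/-! ### Separation and time sharing -/

/-- A point that is not strictly above a convex family in every coordinate is separated from it by
nonnegative weights. -/
lemma exists_nonneg_weights {ι : Type*} [Fintype ι] {S : Set (ι → ℝ)} (hne : S.Nonempty)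
    (hconv : ∀ x ∈ S, ∀ y ∈ S, ∀ a b : ℝ, 0 < a → 0 < b → a + b = 1 →
      ∃ z ∈ S, ∀ i, z i ≤ a * x i + b * y i)
    {z : ι → ℝ} (hz : ¬ ∃ s ∈ S, ∀ i, s i < z i) :
    ∃ w : ι → ℝ, (∀ i, 0 ≤ w i) ∧ w ≠ 0 ∧ ∀ s ∈ S, ∑ i, w i * z i ≤ ∑ i, w i * s i := by
  classical
  -- The set of points strictly above some element of `S` is open, convex because `S` is convex up
  -- to domination, and misses `z`. A separating functional has nonpositive coefficients since this
  -- set is closed upwards; their negatives are the weights.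
  set A : Set (ι → ℝ) := {y | ∃ s ∈ S, ∀ i, s i < y i} with hA
  have hAo : IsOpen A := by
    have : A = ⋃ s ∈ S, ⋂ i, {y : ι → ℝ | s i < y i} := by
      ext y; simp [hA]
    rw [this]
    refine isOpen_biUnion fun s _ => isOpen_iInter_of_finite fun i => ?_
    exact isOpen_lt continuous_const (continuous_apply i)
  have hAc : Convex ℝ A := by
    rw [convex_iff_forall_pos]
    rintro x ⟨s, hs, hsx⟩ y ⟨t, ht, hty⟩ a b ha hb hab
    obtain ⟨u, hu, hle⟩ := hconv s hs t ht a b ha hb hab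
    refine ⟨u, hu, fun i => (hle i).trans_lt ?_⟩
    simp only [Pi.add_apply, Pi.smul_apply, smul_eq_mul]
    nlinarith [mul_lt_mul_of_pos_left (hsx i) ha, mul_lt_mul_of_pos_left (hty i) hb]
  obtain ⟨f, hf⟩ := geometric_hahn_banach_open_point hAc hAo (x := z) (by simpa [hA] using hz)
  have hfe : ∀ y : ι → ℝ, f y = ∑ i, y i * f (Pi.single i 1) := by
    intro y
    conv_lhs => rw [← Finset.univ_sum_single y]
    rw [map_sum]
    refine Finset.sum_congr rfl fun i _ => ?_
    have : (Pi.single i (y i) : ι → ℝ) = y i • Pi.single i 1 := by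
      rw [← Pi.single_smul]; simp
    rw [this, map_smul, smul_eq_mul]
  obtain ⟨s₀, hs₀⟩ := hne
  have hle : ∀ s ∈ S, f s ≤ f z := by
    intro s hs
    have ht : Tendsto (fun ε : ℝ => f (s + ε • (1 : ι → ℝ))) (𝓝[>] 0) (𝓝 (f s)) := by
      have : Continuous fun ε : ℝ => f (s + ε • (1 : ι → ℝ)) := by fun_prop
      have h := this.tendsto 0
      simp only [zero_smul, add_zero] at h
      exact h.mono_left nhdsWithin_le_nhds
    refine le_of_tendsto ht ?_
    filter_upwards [self_mem_nhdsWithin] with ε hε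
    exact (hf _ ⟨s, hs, fun i => by simpa using hε⟩).le
  -- Moving up along a coordinate direction stays in `A`, where `f` is bounded above by `f z`; a
  -- positive coefficient would make it unbounded.
  have hsgn : ∀ i, f (Pi.single i 1) ≤ 0 := by
    intro i
    by_contra! hpos
    set y : ℝ → (ι → ℝ) := fun c => s₀ + 1 + c • Pi.single i 1
    have hy : ∀ c : ℝ, 0 ≤ c → f (y c) < f z := by
      intro c hc
      refine hf _ ⟨s₀, hs₀, fun j => ?_⟩
      have : 0 ≤ (c • (Pi.single i 1 : ι → ℝ)) j := by
        rw [Pi.smul_apply, smul_eq_mul, Pi.single_apply]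
        split_ifs <;> simp [hc]
      simp only [y, Pi.add_apply, Pi.one_apply]
      linarith
    have h2 : ∀ c : ℝ, f (y c) = f (s₀ + 1) + c * f (Pi.single i 1) := by
      intro c; simp only [y, map_add, map_smul, smul_eq_mul]
    have h3 := hy (|f z - f (s₀ + 1)| / f (Pi.single i 1)) (by positivity)
    rw [h2, div_mul_cancel₀ _ hpos.ne'] at h3
    linarith [le_abs_self (f z - f (s₀ + 1))]
  refine ⟨fun i => -f (Pi.single i 1), fun i => by linarith [hsgn i], ?_, ?_⟩
  · intro h0
    have : ∀ y, f y = 0 := by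
      intro y
      rw [hfe]
      refine Finset.sum_eq_zero fun i _ => ?_
      have := congrFun h0 i
      simp only [Pi.zero_apply, neg_eq_zero] at this
      rw [this, mul_zero]
    have h1 := hf (s₀ + 1) ⟨s₀, hs₀, fun i => by simp⟩
    rw [this, this] at h1
    exact lt_irrefl _ h1
  · intro s hs
    have := hle s hs
    rw [hfe s, hfe z] at this
    simp only [neg_mul, Finset.sum_neg_distrib, neg_le_neg_iff]
    simpa only [mul_comm] using this

/-- A finite average of points of the plane is dominated by an average of two of the points. -/
lemma exists_two_point_average {m : ℕ} {T d g : Fin m → ℝ} (hT : ∀ j, 0 ≤ T j)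
    (hT1 : ∑ j, T j = 1) :
    ∃ i j : Fin m, ∃ θ : ℝ, 0 ≤ θ ∧ θ ≤ 1 ∧ (1 - θ) * d i + θ * d j ≤ ∑ l, T l * d l ∧
      ∑ l, T l * g l ≤ (1 - θ) * g i + θ * g j := by
  set D := ∑ l, T l * d l with hD
  set G := ∑ l, T l * g l with hG
  have hD0 : ∑ l, T l * (d l - D) = 0 := by
    simp only [mul_sub, Finset.sum_sub_distrib, ← Finset.sum_mul, hT1]; rw [← hD]; ring
  have hG0 : ∑ l, T l * (g l - G) = 0 := by
    simp only [mul_sub, Finset.sum_sub_distrib, ← Finset.sum_mul, hT1]; rw [← hG]; ring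
  have hex : ∃ l, 0 < T l := by
    by_contra! h
    have : ∑ j, T j ≤ 0 := Finset.sum_nonpos fun j _ => h j
    linarith
  -- If no two-point average works, all points lie strictly below a line of nonnegative slope
  -- through the mean point `(D, G)`, or else all charged points are on the vertical line through it
  -- with second coordinate below `G`. Either way the mean cannot be `(D, G)`.
  by_contra! hc
  have hc1 : ∀ i, d i ≤ D → g i < G := by
    intro i hi
    have := hc i i 0 le_rfl zero_le_one (by linarith)
    linarith
  -- pairs on the two sides of the mean are on a line below the mean
  have hc2 : ∀ i j, d i < D → D < d j → (g j - G) * (D - d i) < (G - g i) * (d j - D) := by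
    intro i j hi hj
    have hpos : 0 < d j - d i := by linarith
    have := hc i j ((D - d i) / (d j - d i)) (div_nonneg (by linarith) hpos.le)
      (by rw [div_le_one hpos]; linarith) (le_of_eq (by field_simp; ring))
    have e : (1 - (D - d i) / (d j - d i)) * g i + (D - d i) / (d j - d i) * g j =
        ((d j - D) * g i + (D - d i) * g j) / (d j - d i) := by field_simp; ring
    rw [e, div_lt_iff₀ hpos] at this
    nlinarith
  -- a slope that separates
  obtain ⟨s, hs0, hs⟩ : ∃ s : ℝ, 0 ≤ s ∧ ∀ l, g l - G < s * (d l - D) := by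
    by_cases hL : ∃ i, d i < D
    · have hfin : (Finset.univ.filter fun i => d i < D).Nonempty := by
        obtain ⟨i, hi⟩ := hL; exact ⟨i, by simp [hi]⟩
      obtain ⟨i, hi, hmin⟩ := Finset.exists_min_image _ (fun i => (G - g i) / (D - d i)) hfin
      simp only [Finset.mem_filter, Finset.mem_univ, true_and] at hi hmin
      have hip : 0 < D - d i := by linarith
      have hi0 := hc1 i hi.le
      set s₁ := (G - g i) / (D - d i) with hs₁
      have hs₁p : 0 < s₁ := div_pos (by linarith) hip
      -- every point to the right is strictly below slope `s₁`; move `s₁` slightly down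
      obtain ⟨s, hs1, hs2, hs3⟩ : ∃ s : ℝ, 0 ≤ s ∧ s < s₁ ∧
          ∀ j, D < d j → g j - G < s * (d j - D) := by
        have hev : ∀ᶠ s in 𝓝[<] s₁, ∀ j, D < d j → g j - G < s * (d j - D) := by
          rw [eventually_all]
          intro j
          by_cases hj : D < d j
          · have h1 : g j - G < s₁ * (d j - D) := by
              rw [hs₁, div_mul_eq_mul_div, lt_div_iff₀ hip]
              exact hc2 i j hi hj
            have : Tendsto (fun s : ℝ => s * (d j - D)) (𝓝[<] s₁) (𝓝 (s₁ * (d j - D))) :=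
              (by fun_prop : Continuous fun s : ℝ => s * (d j - D)).continuousAt.tendsto.mono_left
                nhdsWithin_le_nhds
            filter_upwards [this.eventually (lt_mem_nhds h1)] with s hs _ using hs
          · exact Eventually.of_forall fun s h => absurd h hj
        have hev2 : ∀ᶠ s in 𝓝[<] s₁, 0 < s ∧ s < s₁ :=
          (Filter.Eventually.filter_mono nhdsWithin_le_nhds (lt_mem_nhds hs₁p)).and
            self_mem_nhdsWithin
        obtain ⟨s, h1, h2⟩ := (hev.and hev2).exists
        exact ⟨s, h2.1.le, h2.2, h1⟩
      refine ⟨s, hs1, fun l => ?_⟩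
      rcases lt_trichotomy (d l) D with h | h | h
      · have h1 := hmin l h
        have h2 : s₁ * (D - d l) ≤ G - g l := by rwa [le_div_iff₀ (by linarith)] at h1
        nlinarith
      · have := hc1 l h.le
        rw [h]; linarith
      · exact hs3 l h
    · push Not at hL
      -- With no point to the left of the mean `D`, every charged point has first coordinate exactly
      -- `D`.
      have hall : ∀ l, 0 < T l → d l = D := by
        intro l hl
        have := (Finset.sum_eq_zero_iff_of_nonneg (fun l _ =>
          mul_nonneg (hT l) (by linarith [hL l]))).1 hD0 l (Finset.mem_univ _)
        rcases mul_eq_zero.1 this with h | h <;> linarith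
      exfalso
      have : ∑ l, T l * (g l - G) < 0 := by
        obtain ⟨l, hl⟩ := hex
        refine Finset.sum_neg' (fun j _ => ?_) ⟨l, Finset.mem_univ _, ?_⟩
        · rcases (hT j).eq_or_lt with h | h
          · rw [← h]; simp
          · exact mul_nonpos_of_nonneg_of_nonpos (hT j) (by linarith [hc1 j (hall j h).le])
        · exact mul_neg_of_pos_of_neg hl (by linarith [hc1 l (hall l hl).le])
      linarith
  have : ∑ l, T l * (g l - G) < ∑ l, T l * (s * (d l - D)) := by
    obtain ⟨l, hl⟩ := hex
    exact Finset.sum_lt_sum (fun j _ => mul_le_mul_of_nonneg_left (hs j).le (hT j))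
      ⟨l, Finset.mem_univ _, mul_lt_mul_of_pos_left (hs l) hl⟩
  have h2 : ∑ l, T l * (s * (d l - D)) = s * ∑ l, T l * (d l - D) := by
    rw [Finset.mul_sum]; congr! 1; ring
  rw [h2, hD0, hG0] at this
  linarith

end

end ThickIsoperimetry

namespace ThickIsoperimetry

noncomputable section

/-! ### Types of conditional laws along a path -/

section Types

variable {Z U V : Type*}

lemma pathSum_add (X X' : List Z → Z → ℝ) (l : List Z) :
    pathSum (fun h z => X h z + X' h z) l = pathSum X l + pathSum X' l := by
  induction l generalizing X X' with
  | nil => simp [pathSum]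
  | cons z l ih => simp only [pathSum, ih]; ring

lemma pathSum_const_mul (c : ℝ) (X : List Z → Z → ℝ) (l : List Z) :
    pathSum (fun h z => c * X h z) l = c * pathSum X l := by
  induction l generalizing X with
  | nil => simp [pathSum]
  | cons z l ih => simp only [pathSum, ih]; ring

lemma pathSum_const (c : ℝ) (l : List Z) : pathSum (fun _ _ => c) l = l.length * c := by
  induction l with
  | nil => simp [pathSum]
  | cons z l ih => simp only [pathSum, ih, List.length_cons]; push_cast; ring

lemma pathSum_sum {ι : Type*} (s : Finset ι) (X : ι → List Z → Z → ℝ) (l : List Z) :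
    pathSum (fun h z => ∑ i ∈ s, X i h z) l = ∑ i ∈ s, pathSum (X i) l := by
  induction l generalizing X with
  | nil => simp [pathSum]
  | cons z l ih => simp only [pathSum, ih, Finset.sum_add_distrib]

lemma pathSum_mono {X X' : List Z → Z → ℝ} (h : ∀ l z, X l z ≤ X' l z) (l : List Z) :
    pathSum X l ≤ pathSum X' l := by
  induction l generalizing X X' with
  | nil => simp [pathSum]
  | cons z l ih => exact add_le_add (h _ _) (ih fun _ _ => h _ _)

lemma pathSum_map_fst (X : List U → U → ℝ) (l : List (U × V)) :
    pathSum (fun h z => X (h.map Prod.fst) z.1) l = pathSum X (l.map Prod.fst) := by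
  induction l generalizing X with
  | nil => simp [pathSum]
  | cons z l ih =>
    simp only [pathSum, List.map_cons, List.map_nil]
    rw [ih (fun h => X (z.1 :: h))]

variable [Fintype U] [Fintype V]

/-- Along a path, the sum of a function of a label is the weighted sum of the label counts. -/
lemma pathSum_label {m : ℕ} (J : List Z → Fin m) (d : Fin m → ℝ) (l : List Z) :
    pathSum (fun h _ => d (J h)) l =
      ∑ j, d j * pathSum (fun h _ => if J h = j then 1 else 0) l := by
  simp only [← pathSum_const_mul]
  rw [← pathSum_sum]
  congr 1
  funext h z
  simp

/-- The probability vectors on `U` that charge only the support of `P`. -/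
def supportedSimplex (P : U → ℝ) : Set (U → ℝ) :=
  {k | k ∈ stdSimplex ℝ U ∧ ∀ u, P u = 0 → k u = 0}

/-- Where `P u = 0` the term is zero by the convention for division by zero; elsewhere it is a
rescaled `x log x`, continuous at zero. -/
lemma continuous_finDiv (P : U → ℝ) : Continuous fun k : U → ℝ => finDiv k P := by
  unfold finDiv
  refine continuous_finsetSum _ fun u _ => ?_
  by_cases hP : P u = 0
  · simp only [hP, div_zero, Real.log_zero, mul_zero]; exact continuous_const
  · have : (fun k : U → ℝ => k u * Real.log (k u / P u)) =
        fun k => P u * ((k u / P u) * Real.log (k u / P u)) := by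
      funext k; field_simp
    rw [this]
    exact continuous_const.mul (Real.continuous_mul_log.comp (by fun_prop))

/-- Gibbs' inequality. -/
lemma finDiv_nonneg {k N : V → ℝ} (hk : ∀ v, 0 ≤ k v) (hk1 : ∑ v, k v = 1) (hN : ∀ v, 0 ≤ N v)
    (hN1 : ∑ v, N v ≤ 1) (hac : ∀ v, N v = 0 → k v = 0) : 0 ≤ finDiv k N := by
  have : ∑ v, (k v - N v) ≤ finDiv k N := by
    refine Finset.sum_le_sum fun v _ => ?_
    rcases (hk v).eq_or_lt with h | h
    · rw [← h]; simp [hN v]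
    · have hNp : 0 < N v := lt_of_le_of_ne (hN v) fun h' => h.ne' (hac v h'.symm)
      have := Real.log_le_sub_one_of_pos (div_pos hNp h)
      rw [Real.log_div hNp.ne' h.ne'] at this
      rw [Real.log_div h.ne' hNp.ne']
      have h3 := mul_le_mul_of_nonneg_left this h.le
      have h4 : k v * (N v / k v - 1) = N v - k v := by field_simp
      nlinarith
  rw [Finset.sum_sub_distrib, hk1] at this
  linarith

lemma isCompact_supportedSimplex (P : U → ℝ) : IsCompact (supportedSimplex P) := by
  have : supportedSimplex P = stdSimplex ℝ U ∩ ⋂ u, {k : U → ℝ | P u = 0 → k u = 0} := by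
    ext k; simp [supportedSimplex]
  rw [this]
  refine (isCompact_stdSimplex ℝ U).inter_right (isClosed_iInter fun u => ?_)
  by_cases h : P u = 0
  · simp only [h, forall_const]
    exact isClosed_eq (continuous_apply u) continuous_const
  · simp [h]

/-- A finite net of the probability vectors, with multiplicative approximation from below. -/
lemma exists_net_simplex {P : U → ℝ} (hP : P ∈ stdSimplex ℝ U) {δ ε : ℝ} (hδ : 0 < δ)
    (hε : 0 < ε) : ∃ m : ℕ, ∃ kb : Fin m → U → ℝ, (∀ j, kb j ∈ supportedSimplex P) ∧
      ∃ cell : (U → ℝ) → Fin m, ∀ k ∈ supportedSimplex P,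
        (∀ u, (1 - δ) * kb (cell k) u ≤ k u) ∧ finDiv (kb (cell k)) P ≤ finDiv k P + ε := by
  classical
  -- The multiplicative bound is imposed on neighbourhoods only where the center is positive;
  -- elsewhere it reduces to `0 ≤ k u`. This form of approximation leaves a nonnegative residual
  -- when a scaled coupling of the center is completed to one of `k`.
  obtain ⟨t, ht, hcov⟩ := (isCompact_supportedSimplex P).elim_nhds_subcover
    (fun k₀ => {k : U → ℝ | (∀ u, 0 < k₀ u → (1 - δ) * k₀ u < k u) ∧
      finDiv k₀ P < finDiv k P + ε}) (by
    intro k₀ hk₀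
    refine Filter.Eventually.and ?_ ?_
    · rw [eventually_all]
      intro u
      by_cases h : 0 < k₀ u
      · have h1 : (1 - δ) * k₀ u < k₀ u := by nlinarith
        filter_upwards [(continuous_apply u).continuousAt.eventually (lt_mem_nhds h1)] with k hk _
          using hk
      · exact Eventually.of_forall fun k h' => absurd h' h
    · have h1 : finDiv k₀ P < finDiv k₀ P + ε := by linarith
      exact ((continuous_finDiv P).add continuous_const).continuousAt.eventually (lt_mem_nhds h1))
  let e := t.equivFin
  have hne : P ∈ ⋃ x ∈ t, {k : U → ℝ | (∀ u, 0 < x u → (1 - δ) * x u < k u) ∧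
      finDiv x P < finDiv k P + ε} := hcov ⟨hP, fun _ h => h⟩
  have h0 : ∃ x, x ∈ t := by simp only [Set.mem_iUnion] at hne; exact ⟨_, hne.choose_spec.choose⟩
  have hex : ∀ k : U → ℝ, ∃ j : Fin t.card, k ∈ supportedSimplex P →
      (∀ u, (1 - δ) * ((e.symm j : t) : U → ℝ) u ≤ k u) ∧
        finDiv ((e.symm j : t) : U → ℝ) P ≤ finDiv k P + ε := by
    intro k
    by_cases hk : k ∈ supportedSimplex P
    · have := hcov hk
      simp only [Set.mem_iUnion] at this
      obtain ⟨x, hx, h1, h2⟩ := this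
      refine ⟨e ⟨x, hx⟩, fun _ => ?_⟩
      rw [Equiv.symm_apply_apply]
      refine ⟨fun u => ?_, h2.le⟩
      rcases ((ht x hx).1.1 u).eq_or_lt with h | h
      · change (1 - δ) * x u ≤ k u
        rw [← h, mul_zero]; exact hk.1.1 u
      · exact (h1 u h).le
    · exact ⟨e ⟨_, h0.choose_spec⟩, fun h => absurd h hk⟩
  choose cell hcell using hex
  exact ⟨t.card, fun j => (e.symm j : t), fun j => ht _ (e.symm j).2, cell, hcell⟩

/-- A finite net of the weight vectors, with multiplicative approximation from above. -/
lemma exists_net_weights {m : ℕ} (hm : 0 < m) {d : Fin m → ℝ} (hd : ∀ j, 0 ≤ d j) {δ ε : ℝ}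
    (hδ : 0 < δ) (hε : 0 < ε) :
    ∃ t : Finset (Fin m → ℝ), (∀ T ∈ t, T ∈ stdSimplex ℝ (Fin m) ∧ ∀ j, 0 < T j) ∧
      ∀ T ∈ stdSimplex ℝ (Fin m), ∃ T' ∈ t, (∀ j, T j ≤ (1 + δ) * T' j) ∧
        ∑ j, T' j * d j ≤ ∑ j, T j * d j + ε := by
  classical
  have hm' : (0 : ℝ) < m := by exact_mod_cast hm
  set A := ∑ j, d j with hA
  have hA0 : 0 ≤ A := Finset.sum_nonneg fun j _ => hd j
  obtain ⟨η, hη0, hη1, hη2⟩ : ∃ η : ℝ, 0 < η ∧ η < δ ∧ η * A / m < ε / 2 := by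
    refine ⟨min (δ / 2) (ε * m / (4 * (A + 1))), by positivity, by
      linarith [min_le_left (δ / 2) (ε * m / (4 * (A + 1)))], ?_⟩
    have h1 := min_le_right (δ / 2) (ε * m / (4 * (A + 1)))
    rw [div_lt_iff₀ hm']
    calc min (δ / 2) (ε * m / (4 * (A + 1))) * A ≤ ε * m / (4 * (A + 1)) * (A + 1) := by
          apply mul_le_mul h1 (by linarith) hA0 (by positivity)
      _ = ε * m / 4 := by field_simp
      _ < ε / 2 * m := by nlinarith [mul_pos hε hm']
  -- Mixing with a little uniform mass makes all weights positive, as the single-letter bound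
  -- requires, while `(1 + η) * sm T` still dominates `T`. The bound on `η * A / m` limits the
  -- change in the average of `d`.
  let sm : (Fin m → ℝ) → (Fin m → ℝ) := fun T j => (T j + η / m) / (1 + η)
  have hsm1 : ∀ T ∈ stdSimplex ℝ (Fin m), sm T ∈ stdSimplex ℝ (Fin m) ∧ ∀ j, 0 < sm T j := by
    intro T hT
    have hpos : ∀ j, 0 < sm T j := fun j => by
      have := hT.1 j
      simp only [sm]; positivity
    refine ⟨⟨fun j => (hpos j).le, ?_⟩, hpos⟩
    simp only [sm]
    rw [← Finset.sum_div, Finset.sum_add_distrib, hT.2]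
    simp only [Finset.sum_const, Finset.card_univ, Fintype.card_fin, nsmul_eq_mul]
    rw [mul_div_cancel₀ _ hm'.ne', div_self (by positivity)]
  obtain ⟨t, ht, hcov⟩ := (isCompact_stdSimplex ℝ (Fin m)).elim_nhds_subcover
    (fun T₀ => {T : Fin m → ℝ | (∀ j, T j < (1 + δ) * sm T₀ j) ∧
      ∑ j, T₀ j * d j < ∑ j, T j * d j + ε / 2}) (by
    intro T₀ hT₀
    refine Filter.Eventually.and ?_ ?_
    · rw [eventually_all]
      intro j
      have h1 : T₀ j < (1 + δ) * sm T₀ j := by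
        have h2 : T₀ j < (1 + η) * sm T₀ j := by
          simp only [sm]
          rw [mul_div_cancel₀ _ (by positivity)]
          have : 0 < η / m := by positivity
          linarith
        have := (hsm1 T₀ hT₀).2 j
        nlinarith
      exact (continuous_apply j).continuousAt.eventually (gt_mem_nhds h1)
    · have h1 : ∑ j, T₀ j * d j < ∑ j, T₀ j * d j + ε / 2 := by linarith
      have hc : Continuous fun T : Fin m → ℝ => ∑ j, T j * d j + ε / 2 := by fun_prop
      exact hc.continuousAt.eventually (lt_mem_nhds h1))
  refine ⟨t.image sm, ?_, ?_⟩
  · intro T hT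
    obtain ⟨T₀, h1, rfl⟩ := Finset.mem_image.1 hT
    exact hsm1 _ (ht _ h1)
  · intro T hT
    have := hcov hT
    simp only [Set.mem_iUnion] at this
    obtain ⟨T₀, hT₀, h1, h2⟩ := this
    refine ⟨sm T₀, Finset.mem_image_of_mem _ hT₀, fun j => (h1 j).le, ?_⟩
    have e : ∑ j, sm T₀ j * d j = (∑ j, T₀ j * d j + η * A / m) / (1 + η) := by
      rw [hA, Finset.mul_sum, Finset.sum_div, ← Finset.sum_add_distrib, Finset.sum_div]
      refine Finset.sum_congr rfl fun j _ => ?_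
      simp only [sm]; ring
    have h3 : 0 ≤ ∑ j, T₀ j * d j := Finset.sum_nonneg fun j _ => mul_nonneg ((ht _ hT₀).1 j) (hd j)
    have h4 : (∑ j, T₀ j * d j + η * A / m) / (1 + η) ≤ ∑ j, T₀ j * d j + η * A / m :=
      div_le_self (by positivity) (by linarith)
    linarith

lemma tilt_mem_supportedSimplex {P : U → ℝ} (hP : P ∈ stdSimplex ℝ U) (n : ℕ) {f : List U → ℝ}
    (hf : ∀ l, 0 ≤ f l) (l : List U) : tilt P n f l ∈ supportedSimplex P :=
  ⟨⟨(tilt_isTransition hP.1 hP.2 n hf l).1, (tilt_isTransition hP.1 hP.2 n hf l).2⟩,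
    fun _ hu => tilt_eq_zero n f l hu⟩

set_option maxHeartbeats 1000000 in
/-- Conditioning a product law on an event of probability at least `exp (-n α)`, the types of the
conditional laws along the path take, up to a finite net, one value with a probability bounded
below. -/
lemma exists_frequent_type {P : U → ℝ} (hP : P ∈ stdSimplex ℝ U) {α α₁ δ : ℝ} (hα : 0 ≤ α)
    (hα₁ : α < α₁) (hδ : 0 < δ) :
    ∃ m : ℕ, ∃ kb : Fin m → U → ℝ, (∀ j, kb j ∈ supportedSimplex P) ∧
      ∃ cell : (U → ℝ) → Fin m,
        (∀ k ∈ supportedSimplex P, ∀ u, (1 - δ) * kb (cell k) u ≤ k u) ∧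
      ∃ t : Finset (Fin m → ℝ), (∀ T ∈ t, T ∈ stdSimplex ℝ (Fin m) ∧ (∀ j, 0 < T j) ∧
        ∑ j, T j * finDiv (kb j) P ≤ α₁) ∧
      ∃ γ : ℝ, 0 < γ ∧ ∀ n : ℕ, 0 < n → ∀ S : Set (List U),
        Real.exp (-(n * α)) ≤ pathProb (fun _ => P) n S →
        ∃ T ∈ t, γ ≤ pathProb (tilt P n (S.indicator 1)) n (S ∩ {l | ∀ j,
          pathSum (fun h _ => if cell (tilt P n (S.indicator 1) h) = j then 1 else 0) l ≤
            (1 + δ) * n * T j}) := by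
  classical
  -- One `ε` is spent in Markov's inequality, one on the net of laws and one on the net of weights,
  -- so the average entropy of the selected type is at most `α + 3 ε`.
  set ε := (α₁ - α) / 4 with hε
  have hε0 : 0 < ε := by rw [hε]; linarith
  obtain ⟨m, kb, hkb, cell, hcell⟩ := exists_net_simplex hP hδ hε0
  have hP' : P ∈ supportedSimplex P := ⟨hP, fun _ h => h⟩
  have hm : 0 < m := Fin.pos (cell P)
  have hd : ∀ j, 0 ≤ finDiv (kb j) P := fun j =>
    finDiv_nonneg (hkb j).1.1 (hkb j).1.2 hP.1 hP.2.le (hkb j).2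
  obtain ⟨t, ht, hnet⟩ := exists_net_weights hm hd hδ hε0
  refine ⟨m, kb, hkb, cell, fun k hk => (hcell k hk).1,
    t.filter fun T => ∑ j, T j * finDiv (kb j) P ≤ α₁, ?_, ε / (α + ε) / (t.card + 1),
    by positivity, ?_⟩
  · intro T hT
    rw [Finset.mem_filter] at hT
    exact ⟨(ht T hT.1).1, (ht T hT.1).2, hT.2⟩
  intro n hn S hS
  have hn' : (0 : ℝ) < n := by exact_mod_cast hn
  set f : List U → ℝ := S.indicator 1 with hf
  have hf0 : ∀ l, 0 ≤ f l := fun l => Set.indicator_nonneg (fun _ _ => zero_le_one) l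
  have hf1 : ∀ l, f l ≤ 1 := fun l => Set.indicator_le_self' (fun _ _ => zero_le_one) l
  set κ := tilt P n f with hκ
  have hκT : IsTransition κ := tilt_isTransition hP.1 hP.2 n hf0
  have hκm : ∀ l, κ l ∈ supportedSimplex P := tilt_mem_supportedSimplex hP n hf0
  have hEpos : 0 < pathExp (fun _ => P) n f := (Real.exp_pos _).trans_le hS
  set X : List U → ℝ := pathSum fun l _ => finDiv (κ l) P with hX
  have hX0 : ∀ l, 0 ≤ X l := fun l => by
    have := pathSum_mono (X := fun (_ : List U) (_ : U) => (0 : ℝ))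
      (X' := fun l _ => finDiv (κ l) P)
      (fun l _ => finDiv_nonneg (hκm l).1.1 (hκm l).1.2 hP.1 hP.2.le (hκm l).2) l
    simpa [pathSum_const] using this
  have hEX : pathExp κ n X ≤ n * α := by
    refine (pathExp_finDiv_tilt_le hP.1 hP.2 n hf0 hf1 hEpos.ne').trans ?_
    have := Real.log_le_log (Real.exp_pos _) hS
    rw [Real.log_exp] at this
    unfold pathProb at this
    linarith
  -- Tilting by an indicator is conditioning, so the event has probability one afterwards.
  have hPS : pathProb κ n S = 1 := by
    have h1 := pathExp_tilt hP.1 n hf0 f hEpos.ne'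
    have h2 : pathExp (fun _ => P) n (fun l => f l * f l) = pathExp (fun _ => P) n f :=
      pathExp_congr fun l _ => by
        by_cases h : l ∈ S <;> simp [hf, h]
    rw [h2] at h1
    exact (mul_eq_right₀ hEpos.ne').1 h1
  have hMarkov : pathProb κ n {l | n * (α + ε) < X l} ≤ α / (α + ε) := by
    have h1 : pathProb κ n {l | n * (α + ε) < X l} ≤
        pathExp κ n (fun l => (n * (α + ε))⁻¹ * X l) := by
      refine pathExp_mono (fun l z => (hκT l).1 z) fun l _ => ?_
      by_cases h : l ∈ {l | n * (α + ε) < X l}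
      · rw [Set.indicator_of_mem h, Pi.one_apply, inv_mul_eq_div, one_le_div (by positivity)]
        exact le_of_lt h
      · rw [Set.indicator_of_notMem h]
        exact mul_nonneg (by positivity) (hX0 l)
    rw [pathExp_const_mul] at h1
    refine h1.trans ?_
    calc (n * (α + ε))⁻¹ * pathExp κ n X ≤ (n * (α + ε))⁻¹ * (n * α) := by gcongr
      _ = _ := by field_simp
  -- Markov's inequality leaves a probability of total entropy at most `n (α + ε)` that is small but
  -- independent of `n`; no concentration of the entropy is needed.
  have hgood : ε / (α + ε) ≤ pathProb κ n (S ∩ {l | X l ≤ n * (α + ε)}) := by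
    have h1 := pathProb_le_add_of_subset (fun l z => (hκT l).1 z) (n := n) (S := S)
      (T := {l | n * (α + ε) < X l}) (W := ∅) (G := S ∩ {l | X l ≤ n * (α + ε)})
      (fun l _ hlS hlT _ => ⟨hlS, not_lt.1 (Set.notMem_ofPred_iff.1 hlT)⟩)
    have h2 : pathProb κ n ∅ = 0 := by
      unfold pathProb; simpa using pathExp_zero κ n
    have h3 : ε / (α + ε) = 1 - α / (α + ε) := by field_simp; ring
    rw [h3]
    linarith
  have hgp : 0 < ε / (α + ε) := by positivity
  have hcover : ∀ l : List U, l.length = n → l ∈ S ∩ {l | X l ≤ n * (α + ε)} →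
      ∃ T ∈ t.filter fun T => ∑ j, T j * finDiv (kb j) P ≤ α₁, l ∈ S ∩ {l | ∀ j,
        pathSum (fun h _ => if cell (κ h) = j then 1 else 0) l ≤ (1 + δ) * n * T j} := by
    rintro l hl ⟨hlS, hlX⟩
    set N : Fin m → ℝ := fun j => pathSum (fun h _ => if cell (κ h) = j then 1 else 0) l with hN
    have hN0 : ∀ j, 0 ≤ N j := fun j => by
      have := pathSum_mono (X := fun (_ : List U) (_ : U) => (0 : ℝ))
        (X' := fun h _ => if cell (κ h) = j then 1 else 0)
        (fun l _ => by split_ifs <;> simp) l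
      simpa [pathSum_const] using this
    have hlab := fun d => pathSum_label (fun h => cell (κ h)) d l
    have hN1 : ∑ j, N j = n := by
      have := hlab (fun _ => 1)
      rw [pathSum_const, hl] at this
      simpa using this.symm
    have hTm : (fun j => N j / n) ∈ stdSimplex ℝ (Fin m) :=
      ⟨fun j => div_nonneg (hN0 j) hn'.le, by rw [← Finset.sum_div, hN1, div_self hn'.ne']⟩
    obtain ⟨T', hT', h1, h2⟩ := hnet _ hTm
    -- The empirical frequencies of the cells along the word are a weight vector; its neighbour in
    -- the net inherits the entropy bound, hence survives the filter, and bounds the counts up to `1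
    -- + δ`.
    refine ⟨T', Finset.mem_filter.2 ⟨hT', h2.trans ?_⟩, hlS, fun j => ?_⟩
    · have h3 : ∑ j, N j / n * finDiv (kb j) P =
          (∑ j, finDiv (kb j) P * N j) / n := by
        rw [Finset.sum_div]; congr! 1; ring
      rw [h3, ← hlab]
      have h4 : pathSum (fun h _ => finDiv (kb (cell (κ h))) P) l ≤ X l + n * ε := by
        have := pathSum_mono (X := fun h _ => finDiv (kb (cell (κ h))) P)
          (X' := fun h (_ : U) => finDiv (κ h) P + ε) (fun h _ => (hcell _ (hκm h)).2) l
        rw [pathSum_add, pathSum_const, hl] at this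
        exact this
      have h5 : pathSum (fun h _ => finDiv (kb (cell (κ h))) P) l / n ≤ α + 2 * ε := by
        rw [div_le_iff₀ hn']
        have : X l ≤ n * (α + ε) := hlX
        linarith
      linarith
    · have := h1 j
      simp only [div_le_iff₀ hn'] at this
      calc N j ≤ (1 + δ) * T' j * n := this
        _ = _ := by ring
  obtain ⟨T, hT, hTp⟩ := exists_pathProb_ge (t.filter fun T => ∑ j, T j * finDiv (kb j) P ≤ α₁)
    (fun l z => (hκT l).1 z) (n := n) (S := S ∩ {l | X l ≤ n * (α + ε)})
    (T := fun T => S ∩ {l | ∀ j, pathSum (fun h _ => if cell (κ h) = j then 1 else 0) l ≤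
            (1 + δ) * n * T j}) hcover (hgp.trans_le hgood)
  refine ⟨T, hT, le_trans ?_ hTp⟩
  have hc : 0 < (t.filter fun T => ∑ j, T j * finDiv (kb j) P ≤ α₁).card :=
    Finset.card_pos.2 ⟨T, hT⟩
  have hc' : ((t.filter fun T => ∑ j, T j * finDiv (kb j) P ≤ α₁).card : ℝ) ≤ t.card + 1 := by
    have := Finset.card_filter_le t fun T => ∑ j, T j * finDiv (kb j) P ≤ α₁
    have h' : ((t.filter fun T => ∑ j, T j * finDiv (kb j) P ≤ α₁).card : ℝ) ≤ t.card := by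
      exact_mod_cast this
    linarith
  exact div_le_div₀ (hgp.le.trans hgood) hgood (by exact_mod_cast hc) hc'

/-- A subcoupling is completed to a coupling by the product of the residual marginals. -/
lemma exists_coupling_of_subcoupling {k : U → ℝ} {h : V → ℝ} {s c : U → V → ℝ} {δ K K' : ℝ}
    (hδ : 0 < δ) (hδ1 : δ < 1) (hk1 : ∑ u, k u = 1) (hh1 : ∑ v, h v = 1)
    (hs : ∀ u v, 0 ≤ s u v) (hsk : ∀ u, (1 - δ) * ∑ v, s u v ≤ k u)
    (hsh : ∀ v, ∑ u, s u v ≤ h v) (hhs : ∀ v, h v ≤ (1 + δ) * ∑ u, s u v)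
    (hc : ∀ u v, 0 ≤ c u v) (hK : 0 ≤ K) (hcc : ∀ u u' v, c u v ≤ K + K' * c u' v) :
    ∃ r : U → V → ℝ, (∀ u v, 0 ≤ r u v) ∧ (∀ u, ∑ v, r u v = k u) ∧ (∀ v, ∑ u, r u v = h v) ∧
      ∑ u, ∑ v, r u v * c u v ≤ ∑ u, ∑ v, s u v * c u v +
        2 * δ * (K + K' * ∑ u, ∑ v, s u v * c u v) := by
  set σ := ∑ u, ∑ v, s u v with hσ
  have hσ' : ∑ v, ∑ u, s u v = σ := Finset.sum_comm
  have hσ0 : 0 ≤ σ := Finset.sum_nonneg fun u _ => Finset.sum_nonneg fun v _ => hs u v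
  have hσ1 : σ ≤ 1 := by
    rw [← hσ', ← hh1]; exact Finset.sum_le_sum fun v _ => hsh v
  set w := 1 - (1 - δ) * σ with hw
  have hwp : 0 < w := by rw [hw]; nlinarith
  set A : U → ℝ := fun u => k u - (1 - δ) * ∑ v, s u v with hA
  set B : V → ℝ := fun v => h v - (1 - δ) * ∑ u, s u v with hB
  have hA0 : ∀ u, 0 ≤ A u := fun u => sub_nonneg.2 (hsk u)
  have hsv : ∀ v, 0 ≤ ∑ u, s u v := fun v => Finset.sum_nonneg fun u _ => hs u v
  have hB0 : ∀ v, 0 ≤ B v := fun v => by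
    simp only [hB]; nlinarith [hsh v, hsv v]
  -- The residual of the second marginal is controlled by the marginal of `s` itself, because `h`
  -- exceeds that marginal by at most the factor `1 + δ`.
  have hB2 : ∀ v, B v ≤ 2 * δ * ∑ u, s u v := fun v => by
    simp only [hB]; linarith [hhs v]
  have hA1 : ∑ u, A u = w := by
    simp only [hA, Finset.sum_sub_distrib, hk1, ← Finset.mul_sum]; rw [hw, hσ]
  have hB1 : ∑ v, B v = w := by
    simp only [hB, Finset.sum_sub_distrib, hh1, ← Finset.mul_sum]; rw [hw, hσ']
  refine ⟨fun u v => (1 - δ) * s u v + A u * B v / w, fun u v => ?_, fun u => ?_, fun v => ?_, ?_⟩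
  · exact add_nonneg (mul_nonneg (by linarith) (hs u v))
      (div_nonneg (mul_nonneg (hA0 u) (hB0 v)) hwp.le)
  · rw [Finset.sum_add_distrib, ← Finset.mul_sum, ← Finset.sum_div, ← Finset.mul_sum, hB1,
      mul_div_assoc, div_self hwp.ne']
    simp only [hA]; ring
  · rw [Finset.sum_add_distrib, ← Finset.mul_sum, ← Finset.sum_div, ← Finset.sum_mul, hA1,
      mul_div_right_comm, div_self hwp.ne']
    simp only [hB]; ring
  · set C := ∑ u, ∑ v, s u v * c u v with hC
    have hC0 : 0 ≤ C := Finset.sum_nonneg fun u _ => Finset.sum_nonneg fun v _ =>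
      mul_nonneg (hs u v) (hc u v)
    have e : ∑ u, ∑ v, ((1 - δ) * s u v + A u * B v / w) * c u v =
        (1 - δ) * C + ∑ u, A u / w * ∑ v, B v * c u v := by
      rw [hC, Finset.mul_sum, ← Finset.sum_add_distrib]
      refine Finset.sum_congr rfl fun u _ => ?_
      rw [Finset.mul_sum, Finset.mul_sum, ← Finset.sum_add_distrib]
      refine Finset.sum_congr rfl fun v _ => ?_
      ring
    rw [e]
    -- The residuals are coupled independently, so the first letter is arbitrary. By `hcc` it can be
    -- exchanged for the letter `u'` that `s` pairs with `v`, at the price of `K` and `K'`.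
    have h1 : ∀ u, ∑ v, B v * c u v ≤ 2 * δ * (K + K' * C) := by
      intro u
      calc ∑ v, B v * c u v ≤ ∑ v, (2 * δ * ∑ u', s u' v) * c u v :=
            Finset.sum_le_sum fun v _ => mul_le_mul_of_nonneg_right (hB2 v) (hc u v)
        _ = 2 * δ * ∑ v, ∑ u', s u' v * c u v := by
            rw [Finset.mul_sum]; congr! 1; rw [mul_assoc, Finset.sum_mul]
        _ ≤ 2 * δ * ∑ v, ∑ u', s u' v * (K + K' * c u' v) := by
            refine mul_le_mul_of_nonneg_left ?_ (by linarith)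
            exact Finset.sum_le_sum fun v _ => Finset.sum_le_sum fun u' _ =>
              mul_le_mul_of_nonneg_left (hcc u u' v) (hs u' v)
        _ = 2 * δ * (K * σ + K' * C) := by
            congr 1
            rw [Finset.sum_comm, hσ, hC, Finset.mul_sum, Finset.mul_sum, ← Finset.sum_add_distrib]
            refine Finset.sum_congr rfl fun u _ => ?_
            rw [Finset.mul_sum, Finset.mul_sum, ← Finset.sum_add_distrib]
            refine Finset.sum_congr rfl fun v _ => ?_
            ring
        _ ≤ 2 * δ * (K + K' * C) := by
            refine mul_le_mul_of_nonneg_left ?_ (by linarith)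
            nlinarith
    have h2 : ∑ u, A u / w * ∑ v, B v * c u v ≤ ∑ u, A u / w * (2 * δ * (K + K' * C)) :=
      Finset.sum_le_sum fun u _ => mul_le_mul_of_nonneg_left (h1 u) (div_nonneg (hA0 u) hwp.le)
    rw [← Finset.sum_mul, ← Finset.sum_div, hA1, div_self hwp.ne', one_mul] at h2
    nlinarith

/-- The image of a set of words under a finite family of couplings indexed by the type of the
conditional law. -/
lemma pathProb_image_ge {P : U → ℝ} (hP : P ∈ stdSimplex ℝ U) {N : V → ℝ} (hN : ∀ v, 0 ≤ N v)
    (hN1 : ∑ v, N v ≤ 1) {c : U → V → ℝ} (hc : ∀ u v, 0 ≤ c u v) {δ K K' : ℝ}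
    (hδ : 0 < δ) (hδ1 : δ < 1) (hK : 0 ≤ K) (hK' : 0 ≤ K')
    (hcc : ∀ u u' v, c u v ≤ K + K' * c u' v)
    {m : ℕ} {kb : Fin m → U → ℝ} {cell : (U → ℝ) → Fin m}
    (hcell : ∀ k ∈ supportedSimplex P, ∀ u, (1 - δ) * kb (cell k) u ≤ k u)
    {s : Fin m → U → V → ℝ} {h : Fin m → V → ℝ} (hs : ∀ j u v, 0 ≤ s j u v)
    (hsk : ∀ j u, ∑ v, s j u v ≤ kb j u) (hh1 : ∀ j, ∑ v, h j v = 1)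
    (hsh : ∀ j v, ∑ u, s j u v ≤ h j v) (hhs : ∀ j v, h j v ≤ (1 + δ) * ∑ u, s j u v)
    (hac : ∀ j v, N v = 0 → h j v = 0)
    {C D : Fin m → ℝ} (hC : ∀ j, ∑ u, ∑ v, s j u v * c u v ≤ C j)
    (hD : ∀ j, finDiv (h j) N ≤ D j)
    {T : Fin m → ℝ} (hT1 : ∑ j, T j = 1) {ε γ : ℝ} (hε : 0 < ε) (hγ : 0 < γ) :
    ∃ n₀ : ℕ, ∀ n ≥ n₀, ∀ S : Set (List U), γ ≤ pathProb (tilt P n (S.indicator 1)) n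
        (S ∩ {l | ∀ j, pathSum (fun h _ =>
          if cell (tilt P n (S.indicator 1) h) = j then 1 else 0) l ≤ (1 + δ) * n * T j}) →
      Real.exp (-(n * ((1 + δ) * ∑ j, T j * D j + ε))) * (γ / 2) ≤
        pathProb (fun _ => N) n {v | ∃ l : List (U × V), l.map Prod.snd = v ∧ l.map Prod.fst ∈ S ∧
          pathSum (fun _ z => c z.1 z.2) l ≤ n * ((1 + δ) * (∑ j, T j * C j + 2 * δ *
            (K + K' * ∑ j, T j * C j)) + ε)} := by
  classical
  -- a bound for all increments
  have hsj : ∀ j v, 0 ≤ ∑ u, s j u v := fun j v => Finset.sum_nonneg fun u _ => hs j u v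
  have hh0 : ∀ j v, 0 ≤ h j v := fun j v => (hsj j v).trans (hsh j v)
  have hDn : ∀ j, 0 ≤ finDiv (h j) N := fun j => finDiv_nonneg (hh0 j) (hh1 j) hN hN1 (hac j)
  set M₁ := ∑ u, ∑ v, c u v with hM₁
  have hcM : ∀ u v, c u v ≤ M₁ := fun u v =>
    (Finset.single_le_sum (f := fun v => c u v) (fun v _ => hc u v) (Finset.mem_univ v)).trans
      (Finset.single_le_sum (f := fun u => ∑ v, c u v)
        (fun u _ => Finset.sum_nonneg fun v _ => hc u v) (Finset.mem_univ u))
  have hM₁0 : 0 ≤ M₁ := Finset.sum_nonneg fun u _ => Finset.sum_nonneg fun v _ => hc u v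
  set M₂ := ∑ j, (finDiv (h j) N + ∑ v, |Real.log (h j v / N v)|) with hM₂
  have hM₂0 : 0 ≤ M₂ := Finset.sum_nonneg fun j _ => add_nonneg (hDn j)
    (Finset.sum_nonneg fun v _ => abs_nonneg _)
  have hLM : ∀ j v, |Real.log (h j v / N v) - finDiv (h j) N| ≤ M₂ := by
    intro j v
    have h1 : |Real.log (h j v / N v)| ≤ ∑ v, |Real.log (h j v / N v)| :=
      Finset.single_le_sum (f := fun v => |Real.log (h j v / N v)|) (fun v _ => abs_nonneg _)
        (Finset.mem_univ v)
    have h2 : finDiv (h j) N + ∑ v, |Real.log (h j v / N v)| ≤ M₂ :=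
      Finset.single_le_sum (f := fun j => finDiv (h j) N + ∑ v, |Real.log (h j v / N v)|)
        (fun j _ => add_nonneg (hDn j) (Finset.sum_nonneg fun v _ => abs_nonneg _))
        (Finset.mem_univ j)
    have h3 := abs_sub (Real.log (h j v / N v)) (finDiv (h j) N)
    rw [abs_of_nonneg (hDn j)] at h3
    linarith
  set M := M₁ + M₂ with hM
  -- Beyond this length each of the two Chebyshev bounds is at most `γ / 4`, so half of the
  -- probability `γ` survives both.
  obtain ⟨n₀, hn₀⟩ := exists_nat_gt (4 * M ^ 2 / (ε ^ 2 * γ))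
  refine ⟨n₀ + 1, fun n hn S hS => ?_⟩
  have hnpos : 0 < n := by omega
  have hn' : (0 : ℝ) < n := by exact_mod_cast hnpos
  have hcheb : M ^ 2 / (n * ε ^ 2) ≤ γ / 4 := by
    have h1 : 4 * M ^ 2 / (ε ^ 2 * γ) < n := hn₀.trans (by exact_mod_cast (by omega : n₀ < n))
    rw [div_lt_iff₀ (by positivity)] at h1
    rw [div_le_iff₀ (by positivity)]
    nlinarith
  set f : List U → ℝ := S.indicator 1 with hf
  have hf0 : ∀ l, 0 ≤ f l := fun l => Set.indicator_nonneg (fun _ _ => zero_le_one) l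
  set κ := tilt P n f with hκ
  have hκm : ∀ l, κ l ∈ supportedSimplex P := tilt_mem_supportedSimplex hP n hf0
  -- The first marginal is the true conditional law `k`, but the second is `h` of its cell. Hence
  -- the conditional law of the second letter takes finitely many values, and its entropy along a
  -- path depends only on label counts.
  have hex : ∀ k ∈ supportedSimplex P, ∃ r : U → V → ℝ, (∀ u v, 0 ≤ r u v) ∧
      (∀ u, ∑ v, r u v = k u) ∧ (∀ v, ∑ u, r u v = h (cell k) v) ∧
      ∑ u, ∑ v, r u v * c u v ≤ C (cell k) + 2 * δ * (K + K' * C (cell k)) := by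
    intro k hk
    obtain ⟨r, h1, h2, h3, h4⟩ := exists_coupling_of_subcoupling hδ hδ1 hk.1.2 (hh1 (cell k))
      (hs (cell k)) (fun u => (mul_le_mul_of_nonneg_left (hsk (cell k) u) (by linarith)).trans
        (hcell k hk u)) (hsh (cell k)) (hhs (cell k)) hc hK hcc
    refine ⟨r, h1, h2, h3, h4.trans ?_⟩
    have := hC (cell k)
    gcongr
  choose! r hr0 hr1 hr2 hr3 using hex
  set J : List (U × V) → Fin m := fun l => cell (κ (l.map Prod.fst)) with hJ
  set R : List (U × V) → U × V → ℝ := fun l z => r (κ (l.map Prod.fst)) z.1 z.2 with hR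
  have hR0 : ∀ l z, 0 ≤ R l z := fun l z => hr0 _ (hκm _) _ _
  have hRfst : ∀ l u, ∑ v, R l (u, v) = κ (l.map Prod.fst) u := fun l u => hr1 _ (hκm _) u
  have hRsnd : ∀ l v, ∑ u, R l (u, v) = h (J l) v := fun l v => hr2 _ (hκm _) v
  have hRT : IsTransition R := fun l => ⟨hR0 l, by
    rw [Fintype.sum_prod_type]; simp only [hRfst]; exact (hκm _).1.2⟩
  set C' : Fin m → ℝ := fun j => C j + 2 * δ * (K + K' * C j) with hC'
  have hC0 : ∀ j, 0 ≤ C j := fun j => (Finset.sum_nonneg fun u _ => Finset.sum_nonneg fun v _ =>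
    mul_nonneg (hs j u v) (hc u v)).trans (hC j)
  have hC'0 : ∀ j, 0 ≤ C' j := fun j => by
    have := hC0 j; simp only [hC']; positivity
  set mc : List (U × V) → ℝ := fun l => ∑ z, R l z * c z.1 z.2 with hmc
  have hmcC : ∀ l, mc l ≤ C' (J l) := fun l => by
    simp only [hmc, Fintype.sum_prod_type]; exact hr3 _ (hκm _)
  have hmc0 : ∀ l, 0 ≤ mc l := fun l => Finset.sum_nonneg fun z _ => mul_nonneg (hR0 l z) (hc _ _)
  have hmcM : ∀ l, mc l ≤ M₁ := fun l => by
    calc mc l ≤ ∑ z, R l z * M₁ := Finset.sum_le_sum fun z _ =>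
          mul_le_mul_of_nonneg_left (hcM _ _) (hR0 l z)
      _ = M₁ := by rw [← Finset.sum_mul, (hRT l).2, one_mul]
  -- The two martingale differences are the cost and the log-likelihood ratio of the second letter,
  -- each minus its conditional mean given the past.
  set X₁ : List (U × V) → U × V → ℝ := fun l z => c z.1 z.2 - mc l with hX₁
  set X₂ : List (U × V) → U × V → ℝ := fun l z =>
    Real.log (h (J l) z.2 / N z.2) - finDiv (h (J l)) N with hX₂
  have hX₁0 : ∀ l, ∑ z, R l z * X₁ l z = 0 := fun l => by
    simp only [hX₁, mul_sub, Finset.sum_sub_distrib, ← Finset.sum_mul, (hRT l).2, one_mul]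
    simp only [hmc, sub_self]
  have hX₂0 : ∀ l, ∑ z, R l z * X₂ l z = 0 := fun l => by
    simp only [hX₂, mul_sub, Finset.sum_sub_distrib, ← Finset.sum_mul, (hRT l).2, one_mul]
    rw [Fintype.sum_prod_type, Finset.sum_comm]
    simp only [← Finset.sum_mul, hRsnd]
    simp only [finDiv, sub_self]
  have hX₁M : ∀ l z, |X₁ l z| ≤ M := fun l z => by
    rw [abs_le]; constructor <;> simp only [hX₁] <;>
      linarith [hcM z.1 z.2, hc z.1 z.2, hmc0 l, hmcM l]
  have hX₂M : ∀ l z, |X₂ l z| ≤ M := fun l z => (hLM _ _).trans (by linarith)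
  have hp1 := (pathProb_pathSum_ge hRT hnpos hX₁0 hX₁M hε).trans hcheb
  have hp2 := (pathProb_pathSum_ge hRT hnpos hX₂0 hX₂M hε).trans hcheb
  set G : Set (List U) := S ∩ {l | ∀ j, pathSum (fun h _ =>
          if cell (κ h) = j then 1 else 0) l ≤ (1 + δ) * n * T j} with hG
  have hGR : pathProb R n {l | l.map Prod.fst ∈ G} = pathProb κ n G := by
    unfold pathProb
    rw [← pathExp_map_fst hRfst]
    rfl
  set good : Set (List (U × V)) := {l | l.map Prod.fst ∈ G ∧ pathSum X₁ l ≤ n * ε ∧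
    pathSum X₂ l ≤ n * ε} with hgood
  have hgp : γ / 2 ≤ pathProb R n good := by
    have := pathProb_le_add_of_subset hR0 (n := n) (S := {l | l.map Prod.fst ∈ G})
      (T := {l | n * ε < pathSum X₁ l}) (W := {l | n * ε < pathSum X₂ l}) (G := good)
      (fun l _ h1 h2 h3 => ⟨h1, not_lt.1 h2, not_lt.1 h3⟩)
    rw [hGR] at this
    linarith
  -- On the good event the label counts obey the type, so any nonnegative function of the label sums
  -- to at most `1 + δ` times its average under `T`.
  have hlabel : ∀ l, l ∈ good → ∀ d : Fin m → ℝ, (∀ j, 0 ≤ d j) →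
      pathSum (fun h _ => d (J h)) l ≤ n * ((1 + δ) * ∑ j, T j * d j) := by
    intro l hl d hd
    rw [pathSum_label]
    have h1 : ∀ j, pathSum (fun h (_ : U × V) => if J h = j then (1 : ℝ) else 0) l ≤
        (1 + δ) * n * T j := by
      intro j
      have := hl.1.2 j
      rw [← pathSum_map_fst] at this
      exact this
    calc ∑ j, d j * pathSum (fun h (_ : U × V) => if J h = j then (1 : ℝ) else 0) l
        ≤ ∑ j, d j * ((1 + δ) * n * T j) :=
          Finset.sum_le_sum fun j _ => mul_le_mul_of_nonneg_left (h1 j) (hd j)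
      _ = _ := by
          rw [Finset.mul_sum, Finset.mul_sum]
          refine Finset.sum_congr rfl fun j _ => by ring
  have hsumC' : ∑ j, T j * C' j = ∑ j, T j * C j + 2 * δ * (K + K' * ∑ j, T j * C j) := by
    have : ∀ j, T j * C' j = T j * C j + (2 * δ * K * T j + 2 * δ * K' * (T j * C j)) := by
      intro j; simp only [hC']; ring
    simp only [this, Finset.sum_add_distrib, ← Finset.mul_sum, hT1]
    ring
  have hgoodC : ∀ l ∈ good, pathSum (fun _ z => c z.1 z.2) l ≤
      n * ((1 + δ) * (∑ j, T j * C j + 2 * δ * (K + K' * ∑ j, T j * C j)) + ε) := by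
    intro l hl
    have h1 : pathSum (fun _ z => c z.1 z.2) l = pathSum X₁ l + pathSum (fun h _ => mc h) l := by
      rw [← pathSum_add]; congr 1; funext l z; simp only [hX₁]; ring
    have h2 := pathSum_mono (X := fun h (_ : U × V) => mc h) (X' := fun h _ => C' (J h))
      (fun h _ => hmcC h) l
    have h3 := hlabel l hl C' hC'0
    rw [hsumC'] at h3
    rw [h1]
    have := hl.2.1
    linarith
  have hgoodD : ∀ l ∈ good, pathSum (fun l z => Real.log (h (J l) z.2 / N z.2)) l ≤
      n * ((1 + δ) * ∑ j, T j * D j + ε) := by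
    intro l hl
    have h1 : pathSum (fun l z => Real.log (h (J l) z.2 / N z.2)) l =
        pathSum X₂ l + pathSum (fun l _ => finDiv (h (J l)) N) l := by
      rw [← pathSum_add]; congr 1; funext l z; simp only [hX₂]; ring
    have h2 := pathSum_mono (X := fun l (_ : U × V) => finDiv (h (J l)) N)
      (X' := fun h _ => D (J h)) (fun h _ => hD _) l
    have h3 := hlabel l hl D (fun j => (hDn j).trans (hD j))
    rw [h1]
    have := hl.2.2
    linarith
  set B : Set (List V) := {v | ∃ l : List (U × V), l.map Prod.snd = v ∧ l.map Prod.fst ∈ S ∧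
          pathSum (fun _ z => c z.1 z.2) l ≤ n * ((1 + δ) * (∑ j, T j * C j + 2 * δ *
            (K + K' * ∑ j, T j * C j)) + ε)} with hB
  -- On good paths the likelihood ratio is at most `exp (n (... + ε))`, so passing from the pair
  -- process to the product law `N` loses no more than this factor.
  have hcm := pathExp_change_of_measure hR0 hRsnd hN (fun l v hv => hac _ v hv) n
    (g := B.indicator 1) (fun l => Set.indicator_nonneg (fun _ _ => zero_le_one) l)
  refine le_trans ?_ hcm
  calc Real.exp (-(n * ((1 + δ) * ∑ j, T j * D j + ε))) * (γ / 2)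
      ≤ Real.exp (-(n * ((1 + δ) * ∑ j, T j * D j + ε))) * pathProb R n good := by gcongr
    _ = pathExp R n (fun l => Real.exp (-(n * ((1 + δ) * ∑ j, T j * D j + ε))) *
        good.indicator 1 l) := (pathExp_const_mul _ _ _ _).symm
    _ ≤ _ := by
        refine pathExp_mono hR0 fun l _ => ?_
        by_cases hl : l ∈ good
        · have hlB : l.map Prod.snd ∈ B := ⟨l, rfl, hl.1.1, hgoodC l hl⟩
          rw [Set.indicator_of_mem hl, Set.indicator_of_mem hlB, Pi.one_apply, Pi.one_apply,
            mul_one, one_mul]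
          exact Real.exp_le_exp.2 (neg_le_neg (hgoodD l hl))
        · rw [Set.indicator_of_notMem hl, mul_zero]
          exact mul_nonneg (Set.indicator_nonneg (fun _ _ => zero_le_one) _) (Real.exp_pos _).le

end Types

end

end ThickIsoperimetry

namespace ThickIsoperimetry

noncomputable section

/-! ### Images of large sets over a finite alphabet -/

section Image

open InformationTheory

variable {U V Y : Type*} [Fintype U] [Fintype V] [MeasurableSpace Y]

/-- The product measure of a union of products of disjoint cells. -/
lemma pi_iUnion_cells {ν : Measure Y} [IsProbabilityMeasure ν] {A : V → Set Y}
    (hA : ∀ v, MeasurableSet (A v)) (hd : Pairwise (Function.onFun Disjoint A)) (n : ℕ)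
    (W : Set (Fin n → V)) :
    Measure.pi (fun _ : Fin n => ν) (⋃ v ∈ W, Set.univ.pi fun i => A (v i)) =
      ENNReal.ofReal (∑ v, W.indicator (fun v => ∏ i, ν.real (A (v i))) v) := by
  classical
  have h1 : (⋃ v ∈ W, Set.univ.pi fun i => A (v i)) =
      ⋃ v ∈ Finset.univ.filter (· ∈ W), Set.univ.pi fun i => A (v i) := by simp
  rw [h1, measure_biUnion_finset]
  · rw [ENNReal.ofReal_sum_of_nonneg, Finset.sum_filter]
    · refine Finset.sum_congr rfl fun v _ => ?_
      by_cases hv : v ∈ W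
      · rw [if_pos hv, Set.indicator_of_mem hv, Measure.pi_pi,
          ENNReal.ofReal_prod_of_nonneg (fun i _ => measureReal_nonneg)]
        simp
      · rw [if_neg hv, Set.indicator_of_notMem hv, ENNReal.ofReal_zero]
    · exact fun v _ => Set.indicator_nonneg
        (fun v _ => Finset.prod_nonneg fun i _ => measureReal_nonneg) v
  · intro v _ w _ hvw
    obtain ⟨i, hi⟩ := Function.ne_iff.1 hvw
    rw [Function.onFun, Set.disjoint_left]
    intro y hy hy'
    exact Set.disjoint_left.1 (hd hi) (hy i trivial) (hy' i trivial)
  · exact fun v _ => MeasurableSet.univ_pi fun i => hA _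

/-- The relative entropy of the conditional law on a finite partition of an event. -/
lemma finDiv_cells_le {η ν : Measure Y} [IsProbabilityMeasure η] [IsProbabilityMeasure ν]
    {D : ℝ} (hD0 : 0 ≤ D) (hD : klDiv η ν ≤ ENNReal.ofReal D) {A : V → Set Y}
    (hA : ∀ v, MeasurableSet (A v)) (hd : Pairwise (Function.onFun Disjoint A)) {E : Set Y}
    (hE : E = ⋃ v, A v) (hEp : 0 < η.real E) :
    finDiv (fun v => η.real (A v) / η.real E) (fun v => ν.real (A v)) ≤
      (D + ν.real Eᶜ) / η.real E := by
  classical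
  have hfin : klDiv η ν ≠ ⊤ := (hD.trans_lt ENNReal.ofReal_lt_top).ne
  have hac : η ≪ ν := (klDiv_ne_top_iff.1 hfin).1
  have hEm : MeasurableSet E := hE ▸ MeasurableSet.iUnion hA
  set a : V → ℝ := fun v => η.real (A v) / η.real E / ν.real (A v) with ha
  have ha0 : ∀ v, 0 ≤ a v := fun v => by simp only [ha]; positivity
  -- Test function for the Donsker–Varadhan inequality: the density ratio of the conditional law on
  -- each cell, and `1` outside `E`, where its logarithm vanishes. Its integral exceeds one by at
  -- most `ν Eᶜ`, the extra term in the bound.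
  set g : Y → ℝ := fun y => ∑ v, (A v).indicator (fun _ => a v) y + Eᶜ.indicator (fun _ => 1) y
    with hg
  have hgA : ∀ v, ∀ y ∈ A v, g y = a v := by
    intro v y hy
    have hyE : y ∉ Eᶜ := by simp only [hE, Set.mem_compl_iff, not_not, Set.mem_iUnion]; exact ⟨v, hy⟩
    simp only [hg, Set.indicator_of_notMem hyE, add_zero]
    rw [Finset.sum_eq_single v]
    · rw [Set.indicator_of_mem hy]
    · intro w _ hw
      exact Set.indicator_of_notMem (fun hy' => Set.disjoint_left.1 (hd hw) hy' hy) _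
    · simp
  have hgE : ∀ y ∈ Eᶜ, g y = 1 := by
    intro y hy
    simp only [hg, Set.indicator_of_mem hy]
    rw [Finset.sum_eq_zero, zero_add]
    intro v _
    exact Set.indicator_of_notMem (fun hy' => hy (hE ▸ Set.mem_iUnion.2 ⟨v, hy'⟩)) _
  have hlog : (fun y => Real.log (g y)) =
      fun y => ∑ v, (A v).indicator (fun _ => Real.log (a v)) y := by
    funext y
    by_cases hy : y ∈ E
    · have hy' := hy
      rw [hE, Set.mem_iUnion] at hy'
      obtain ⟨v, hv⟩ := hy'
      rw [hgA v y hv, Finset.sum_eq_single v]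
      · rw [Set.indicator_of_mem hv]
      · intro w _ hw
        exact Set.indicator_of_notMem (fun hy' => Set.disjoint_left.1 (hd hw) hy' hv) _
      · simp
    · rw [hgE y hy, Real.log_one, Finset.sum_eq_zero]
      intro v _
      exact Set.indicator_of_notMem (fun hy' => hy (hE ▸ Set.mem_iUnion.2 ⟨v, hy'⟩)) _
  have hi1 : ∀ (μ : Measure Y) [IsProbabilityMeasure μ] (b : V → ℝ) (v : V),
      Integrable ((A v).indicator fun _ => b v) μ := fun μ _ b v =>
    (integrable_const _).indicator (hA v)
  have hgi : Integrable g ν := (integrable_finsetSum _ fun v _ => hi1 ν a v).add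
    ((integrable_const _).indicator hEm.compl)
  have hg0 : ∀ y, 0 ≤ g y := by
    intro y
    refine add_nonneg (Finset.sum_nonneg fun v _ => Set.indicator_nonneg (fun _ _ => ha0 v) _)
      (Set.indicator_nonneg (fun _ _ => zero_le_one) _)
  have hpos : ∀ᵐ y ∂η, 0 < g y := by
    have h0 : ∀ v, a v = 0 → η (A v) = 0 := by
      intro v hv
      simp only [ha, div_eq_zero_iff] at hv
      rcases hv with (h | h) | h
      · exact (measureReal_eq_zero_iff).1 h
      · exact absurd h hEp.ne'
      · exact hac ((measureReal_eq_zero_iff).1 h)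
    have h1 : ∀ v, ∀ᵐ y ∂η, y ∈ A v → 0 < a v := by
      intro v
      rcases (ha0 v).eq_or_lt with h | h
      · have := measure_eq_zero_iff_ae_notMem.1 (h0 v h.symm)
        filter_upwards [this] with y hy hy' using absurd hy' hy
      · exact ae_of_all _ fun _ _ => h
    filter_upwards [ae_all_iff.2 h1] with y hy
    by_cases hyE : y ∈ E
    · have hy' := hyE
      rw [hE, Set.mem_iUnion] at hy'
      obtain ⟨v, hv⟩ := hy'
      rw [hgA v y hv]; exact hy v hv
    · rw [hgE y hyE]; exact one_pos
  have key := integral_log_le_klDiv hfin hgi hg0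
    (by rw [hlog]; exact integrable_finsetSum _ fun v _ => hi1 η (fun v => Real.log (a v)) v) hpos
  rw [hlog, integral_finsetSum _ fun v _ => hi1 η (fun v => Real.log (a v)) v] at key
  simp only [integral_indicator_const _ (hA _), smul_eq_mul] at key
  have hgint : ∫ y, g y ∂ν ≤ 1 + ν.real Eᶜ := by
    have e1 : ∫ y, g y ∂ν = ∫ y, ∑ v, (A v).indicator (fun _ => a v) y ∂ν +
        ∫ y, Eᶜ.indicator (fun _ => (1 : ℝ)) y ∂ν :=
      integral_add (integrable_finsetSum _ fun v _ => hi1 ν a v)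
        ((integrable_const _).indicator hEm.compl)
    rw [e1, integral_finsetSum _ fun v _ => hi1 ν a v, integral_indicator_const _ hEm.compl]
    simp only [integral_indicator_const _ (hA _), smul_eq_mul, mul_one]
    have h2 : ∑ v, ν.real (A v) * a v ≤ ∑ v, η.real (A v) / η.real E := by
      refine Finset.sum_le_sum fun v _ => ?_
      simp only [ha]
      by_cases h : ν.real (A v) = 0
      · rw [h, zero_mul]; positivity
      · rw [mul_div_cancel₀ _ h]
    have h3 : ∑ v, η.real (A v) = η.real E := by
      rw [hE, measureReal_iUnion_fintype hd hA]
    rw [← Finset.sum_div, h3, div_self hEp.ne'] at h2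
    linarith
  have hDr : (klDiv η ν).toReal ≤ D := ENNReal.toReal_le_of_le_ofReal hD0 hD
  rw [le_div_iff₀ hEp]
  have e : finDiv (fun v => η.real (A v) / η.real E) (fun v => ν.real (A v)) * η.real E =
      ∑ v, η.real (A v) * Real.log (a v) := by
    rw [finDiv, Finset.sum_mul]
    refine Finset.sum_congr rfl fun v _ => ?_
    simp only [ha]
    field_simp
  rw [e]
  linarith

/-- The cell of the points where the functions `c u` have given roundings. -/
def roundCell (c : U → Y → ℝ) (ε : ℝ) {M : ℕ} (v : U → Fin M) : Set Y :=
  {y | ∀ u, ⌊c u y / ε⌋₊ = v u}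

lemma measurableSet_roundCell {c : U → Y → ℝ} (hc : ∀ u, Measurable (c u)) (ε : ℝ) {M : ℕ}
    (v : U → Fin M) : MeasurableSet (roundCell c ε v) := by
  have : roundCell c ε v = ⋂ u, (fun y => ⌊c u y / ε⌋₊) ⁻¹' {(v u : ℕ)} := by
    ext y; simp [roundCell]
  rw [this]
  exact MeasurableSet.iInter fun u => (Nat.measurable_floor.comp ((hc u).div_const ε))
    (measurableSet_singleton _)

lemma pairwise_disjoint_roundCell {U Y : Type*} (c : U → Y → ℝ) (ε : ℝ) (M : ℕ) :
    Pairwise (Function.onFun Disjoint fun v : U → Fin M => roundCell c ε v) := by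
  intro v w hvw
  rw [Function.onFun, Set.disjoint_left]
  intro y hy hy'
  exact hvw (funext fun u => Fin.ext ((hy u).symm.trans (hy' u)))

/-- A point has finitely many costs, all finite, so it lies in a cell once `M` is large. Finitely
many cells thus carry almost all the mass. -/
lemma tendsto_measureReal_roundCell {c : U → Y → ℝ} (ε : ℝ)
    (η : Measure Y) [IsProbabilityMeasure η] :
    Tendsto (fun M : ℕ => η.real (⋃ v : U → Fin M, roundCell c ε v)) atTop (𝓝 1) := by
  have e : ∀ M : ℕ, (⋃ v : U → Fin M, roundCell c ε v) = {y | ∀ u, ⌊c u y / ε⌋₊ < M} := by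
    intro M; ext y
    simp only [Set.mem_iUnion, roundCell, Set.mem_ofPred_eq]
    constructor
    · rintro ⟨v, hv⟩ u; rw [hv u]; exact (v u).2
    · intro h; exact ⟨fun u => ⟨_, h u⟩, fun u => rfl⟩
  have hmono : Monotone fun M : ℕ => {y | ∀ u, ⌊c u y / ε⌋₊ < M} := by
    intro M M' h y hy u
    exact (hy u).trans_le h
  have h1 := tendsto_measure_iUnion_atTop (μ := η) hmono
  have h2 : (⋃ M : ℕ, {y | ∀ u, ⌊c u y / ε⌋₊ < M}) = Set.univ := by
    refine Set.eq_univ_of_forall fun y => Set.mem_iUnion.2 ⟨∑ u, ⌊c u y / ε⌋₊ + 1, fun u => ?_⟩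
    exact Nat.lt_succ_of_le (Finset.single_le_sum (f := fun u => ⌊c u y / ε⌋₊)
      (fun _ _ => Nat.zero_le _) (Finset.mem_univ u))
  rw [h2, measure_univ] at h1
  simp only [e]
  exact (ENNReal.tendsto_toReal ENNReal.one_ne_top).comp h1

variable [MeasurableSpace U] [DiscreteMeasurableSpace U]

/-- The single-letter bound: every finite family of laws on `U` with average relative entropy at
most `α` has couplings with laws on `Y` of average cost at most `t` and average relative entropy at
most `B`. -/
def SingleLetter (P : U → ℝ) (ν : Measure Y) (c : U → Y → ℝ) (α t B : ℝ) : Prop :=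
  ∀ (m : ℕ) (T : Fin m → ℝ) (k : Fin m → U → ℝ), (∀ j, 0 < T j) → ∑ j, T j = 1 →
    (∀ j, k j ∈ supportedSimplex P) → ∑ j, T j * finDiv (k j) P ≤ α →
    ∃ (π : Fin m → Measure (U × Y)) (C D : Fin m → ℝ),
      (∀ j, IsProbabilityMeasure (π j)) ∧ (∀ j u, (π j).real (Prod.fst ⁻¹' {u}) = k j u) ∧
      (∀ j, 0 ≤ C j) ∧ (∀ j, 0 ≤ D j) ∧
      (∀ j, ∫⁻ z, ENNReal.ofReal (c z.1 z.2) ∂π j ≤ ENNReal.ofReal (C j)) ∧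
      (∀ j, klDiv (π j).snd ν ≤ ENNReal.ofReal (D j)) ∧
      ∑ j, T j * C j ≤ t ∧ ∑ j, T j * D j ≤ B

/-- The rounded cost of a coupling. -/
lemma sum_roundCell_le {π : Measure (U × Y)} [IsProbabilityMeasure π] {c : U → Y → ℝ}
    (hcm : ∀ u, Measurable (c u)) (hc0 : ∀ u y, 0 ≤ c u y) {ε C : ℝ} (hε : 0 < ε) (hC0 : 0 ≤ C)
    (hC : ∫⁻ z, ENNReal.ofReal (c z.1 z.2) ∂π ≤ ENNReal.ofReal C) {M : ℕ}
    {V : Type*} [Fintype V] {g : V → U → Fin M} (hg : Function.Injective g) :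
    ∑ u, ∑ v, π.real ({u} ×ˢ roundCell c ε (g v)) * (ε * ((g v u : ℕ) + 1)) ≤ C + ε := by
  classical
  have hcm' : Measurable fun z : U × Y => c z.1 z.2 := measurable_from_prod_countable_right hcm
  set A : U × V → Set (U × Y) := fun p => {p.1} ×ˢ roundCell c ε (g p.2) with hA
  have hAm : ∀ p, MeasurableSet (A p) := fun p =>
    (measurableSet_singleton _).prod (measurableSet_roundCell hcm ε _)
  have hAd : Pairwise (Function.onFun Disjoint A) := by
    rintro ⟨u, v⟩ ⟨u', v'⟩ hne
    rw [Function.onFun, Set.disjoint_left]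
    rintro ⟨a, y⟩ ⟨h1, h2⟩ ⟨h3, h4⟩
    simp only [Set.mem_singleton_iff] at h1 h3
    subst h1; subst h3
    refine hne (Prod.ext rfl (hg ?_))
    by_contra hvv
    exact Set.disjoint_left.1 (pairwise_disjoint_roundCell c ε M hvv) h2 h4
  have h_int : Integrable (fun z : U × Y => c z.1 z.2) π :=
    ⟨hcm'.aestronglyMeasurable, by
      rw [hasFiniteIntegral_iff_ofReal (ae_of_all _ fun z => hc0 _ _)]
      exact hC.trans_lt ENNReal.ofReal_lt_top⟩
  have hle : ∫ z, c z.1 z.2 ∂π ≤ C := by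
    rw [integral_eq_lintegral_of_nonneg_ae (ae_of_all _ fun z => hc0 _ _)
      hcm'.aestronglyMeasurable]
    exact ENNReal.toReal_le_of_le_ofReal hC0 hC
  have h1 : ∑ p : U × V, π.real (A p) * (ε * ((g p.2 p.1 : ℕ) + 1)) =
      ∫ z, ∑ p : U × V, (A p).indicator (fun _ => ε * ((g p.2 p.1 : ℕ) + 1 : ℝ)) z ∂π := by
    rw [integral_finsetSum _ fun p _ => (integrable_const _).indicator (hAm p)]
    simp only [integral_indicator_const _ (hAm _), smul_eq_mul]
  -- On a cell the true cost is at least the rounded-down value, so rounding up adds at most `ε`;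
  -- off the cells the left side is zero.
  have h2 : ∫ z, ∑ p : U × V, (A p).indicator (fun _ => ε * ((g p.2 p.1 : ℕ) + 1 : ℝ)) z ∂π ≤
      ∫ z, (c z.1 z.2 + ε) ∂π := by
    refine integral_mono (integrable_finsetSum _ fun p _ =>
      (integrable_const _).indicator (hAm p)) (h_int.add (integrable_const _)) fun z => ?_
    by_cases hz : ∃ p, z ∈ A p
    · obtain ⟨p, hp⟩ := hz
      change ∑ p : U × V, (A p).indicator (fun _ => ε * ((g p.2 p.1 : ℕ) + 1 : ℝ)) z ≤ _
      rw [Finset.sum_eq_single p]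
      · rw [Set.indicator_of_mem hp]
        have e1 : z.1 = p.1 := hp.1
        have e2 := hp.2 p.1
        have : ((g p.2 p.1 : ℕ) : ℝ) ≤ c z.1 z.2 / ε := by
          rw [← e2, e1]; exact Nat.floor_le (div_nonneg (hc0 _ _) hε.le)
        rw [le_div_iff₀ hε] at this
        linarith
      · intro q _ hq
        exact Set.indicator_of_notMem (fun h => Set.disjoint_left.1 (hAd hq) h hp) _
      · simp
    · push Not at hz
      change ∑ p : U × V, (A p).indicator (fun _ => ε * ((g p.2 p.1 : ℕ) + 1 : ℝ)) z ≤ _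
      rw [Finset.sum_eq_zero fun p _ => Set.indicator_of_notMem (hz p) _]
      exact add_nonneg (hc0 _ _) hε.le
  have h3 : ∫ z, (c z.1 z.2 + ε) ∂π = ∫ z, c z.1 z.2 ∂π + ε := by
    rw [integral_add h_int (integrable_const _)]; simp
  rw [← Fintype.sum_prod_type' (f := fun u v => π.real ({u} ×ˢ roundCell c ε (g v)) *
    (ε * ((g v u : ℕ) + 1)))]
  change ∑ p : U × V, π.real (A p) * (ε * ((g p.2 p.1 : ℕ) + 1)) ≤ _
  linarith

end Image

end

end ThickIsoperimetry

namespace ThickIsoperimetry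

noncomputable section

/-! ### Images of large sets in a general second space, by truncation and rounding -/

section Image

open InformationTheory

variable {U Y : Type*} [Fintype U] [MeasurableSpace Y] [MeasurableSpace U]
  [DiscreteMeasurableSpace U]

lemma sum_measureReal_singleton_prod (π : Measure (U × Y)) [IsProbabilityMeasure π] {A : Set Y}
    (hA : MeasurableSet A) : ∑ u, π.real ({u} ×ˢ A) = π.snd.real A := by
  classical
  rw [measureReal_def, Measure.snd_apply hA]
  have : Prod.snd ⁻¹' A = ⋃ u : U, ({u} ×ˢ A : Set (U × Y)) := by
    ext z; simp
  rw [this, ← measureReal_def, measureReal_iUnion_fintype]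
  · intro u v huv
    rw [Function.onFun, Set.disjoint_left]
    rintro z ⟨h1, _⟩ ⟨h2, _⟩
    exact huv (h1.symm.trans h2)
  · exact fun u => (measurableSet_singleton u).prod hA

lemma pathProb_ofFn_image {U : Type*} [Fintype U] (P : U → ℝ) {n : ℕ} (S : Set (Fin n → U)) :
    pathProb (fun _ => P) n (Set.image List.ofFn S) =
      ∑ u, S.indicator (fun u => ∏ i, P (u i)) u := by
  rw [pathProb, pathExp_const_eq_sum]
  refine Finset.sum_congr rfl fun u _ => ?_
  by_cases hu : u ∈ S
  · rw [Set.indicator_of_mem hu, Set.indicator_of_mem (Set.mem_image_of_mem _ hu)]; simp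
  · rw [Set.indicator_of_notMem hu, Set.indicator_of_notMem, mul_zero]
    rintro ⟨w, hw, he⟩
    exact hu (List.ofFn_injective he ▸ hw)

/-- Under the single-letter bound, the image of a set of words of probability at least
`exp (-n α)` has probability at least `exp (-n (B + ε))`. -/
theorem pi_image_ge {P : U → ℝ} (hP : P ∈ stdSimplex ℝ U) {ν : Measure Y}
    [IsProbabilityMeasure ν] {c : U → Y → ℝ} (hcm : ∀ u, Measurable (c u))
    (hc0 : ∀ u y, 0 ≤ c u y) {K K' : ℝ} (hK : 0 ≤ K) (hK' : 0 ≤ K')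
    (hcc : ∀ u u' y, c u y ≤ K + K' * c u' y) {α α₁ t τ B ε : ℝ} (hα : 0 ≤ α) (hα₁ : α < α₁)
    (ht : t < τ) (hε : 0 < ε) (hSL : SingleLetter P ν c α₁ t B) :
    ∃ n₀ : ℕ, ∀ n ≥ n₀, ∀ S : Set (Fin n → U),
      Real.exp (-(n * α)) ≤ ∑ u, S.indicator (fun u => ∏ i, P (u i)) u →
      ENNReal.ofReal (Real.exp (-(n * (B + ε)))) ≤
        Measure.pi (fun _ : Fin n => ν) {y | ∃ u ∈ S, ∑ i, c (u i) (y i) ≤ n * τ} := by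
  classical
  -- One parameter serves for the nets, the rounding of costs, the truncation and the fluctuations;
  -- the two inequalities collect all the resulting errors.
  obtain ⟨δ, hδ, hδ1, hδτ, hδB⟩ : ∃ δ : ℝ, 0 < δ ∧ δ < 1 ∧
      (1 + δ) * ((t + δ) + 2 * δ * ((K + δ) + K' * (t + δ))) + δ < τ ∧
      (1 + δ) * (B + δ) + δ < B + ε / 2 := by
    have h1 : ∀ᶠ δ : ℝ in 𝓝[>] 0, (1 + δ) * ((t + δ) + 2 * δ * ((K + δ) + K' * (t + δ))) + δ < τ := by
      have hc : Continuous fun δ : ℝ =>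
        (1 + δ) * ((t + δ) + 2 * δ * ((K + δ) + K' * (t + δ))) + δ := by fun_prop
      exact (hc.continuousAt.eventually (gt_mem_nhds (by simpa using ht))).filter_mono
        nhdsWithin_le_nhds
    have h2 : ∀ᶠ δ : ℝ in 𝓝[>] 0, (1 + δ) * (B + δ) + δ < B + ε / 2 := by
      have hc : Continuous fun δ : ℝ => (1 + δ) * (B + δ) + δ := by fun_prop
      exact (hc.continuousAt.eventually (gt_mem_nhds (by simp [hε]))).filter_mono
        nhdsWithin_le_nhds
    have h3 : ∀ᶠ δ : ℝ in 𝓝[>] 0, δ < 1 :=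
      Filter.Eventually.filter_mono nhdsWithin_le_nhds (gt_mem_nhds one_pos)
    have h4 : ∀ᶠ δ : ℝ in 𝓝[>] 0, 0 < δ := self_mem_nhdsWithin
    obtain ⟨δ, h⟩ := (h4.and (h3.and (h1.and h2))).exists
    exact ⟨δ, h⟩
  obtain ⟨m, kb, hkb, cell, hcell, tn, htn, γ, hγ, hfreq⟩ := exists_frequent_type hP hα hα₁ hδ
  have hSL' : ∀ T ∈ tn, ∃ (π : Fin m → Measure (U × Y)) (C D : Fin m → ℝ),
      (∀ j, IsProbabilityMeasure (π j)) ∧ (∀ j u, (π j).real (Prod.fst ⁻¹' {u}) = kb j u) ∧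
      (∀ j, 0 ≤ C j) ∧ (∀ j, 0 ≤ D j) ∧
      (∀ j, ∫⁻ z, ENNReal.ofReal (c z.1 z.2) ∂π j ≤ ENNReal.ofReal (C j)) ∧
      (∀ j, klDiv (π j).snd ν ≤ ENNReal.ofReal (D j)) ∧
      ∑ j, T j * C j ≤ t ∧ ∑ j, T j * D j ≤ B := fun T hT =>
    hSL m T kb (htn T hT).2.1 (htn T hT).1.2 hkb (htn T hT).2.2
  choose! π C D hπ hπk hC0 hD0 hC hD hTC hTD using hSL'
  -- truncation level
  obtain ⟨M, hM⟩ : ∃ M : ℕ, ∀ T ∈ tn, ∀ j,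
      1 / (1 + δ) < (π T j).snd.real (⋃ v : U → Fin M, roundCell c δ v) ∧
      (D T j + ν.real (⋃ v : U → Fin M, roundCell c δ v)ᶜ) /
        (π T j).snd.real (⋃ v : U → Fin M, roundCell c δ v) < D T j + δ := by
    have : ∀ᶠ M : ℕ in atTop, ∀ T ∈ tn, ∀ j,
      1 / (1 + δ) < (π T j).snd.real (⋃ v : U → Fin M, roundCell c δ v) ∧
      (D T j + ν.real (⋃ v : U → Fin M, roundCell c δ v)ᶜ) /
        (π T j).snd.real (⋃ v : U → Fin M, roundCell c δ v) < D T j + δ := by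
      rw [Filter.eventually_all_finset]
      intro T hT
      rw [eventually_all]
      intro j
      have := hπ T hT j
      have h1 := tendsto_measureReal_roundCell (c := c) δ (π T j).snd
      have h2 := tendsto_measureReal_roundCell (c := c) δ ν
      have h3 : Tendsto (fun M : ℕ => ν.real (⋃ v : U → Fin M, roundCell c δ v)ᶜ) atTop (𝓝 0) := by
        have e : ∀ M : ℕ, ν.real (⋃ v : U → Fin M, roundCell c δ v)ᶜ =
            1 - ν.real (⋃ v : U → Fin M, roundCell c δ v) := fun M =>
          probReal_compl_eq_one_sub (MeasurableSet.iUnion fun v => measurableSet_roundCell hcm δ v)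
        simp only [e]
        simpa using h2.const_sub 1
      have h4 := (h3.const_add (D T j)).div h1 one_ne_zero
      refine (h1.eventually (lt_mem_nhds ?_)).and (h4.eventually (gt_mem_nhds ?_))
      · rw [div_lt_one (by linarith)]; linarith
      · simp [hδ]
    exact this.exists
  -- Empty cells are discarded: a point of the cell is what transfers `hcc` from the costs to their
  -- rounded versions.
  let V := {v : U → Fin M // (roundCell c δ v).Nonempty}
  set A : V → Set Y := fun v => roundCell c δ v.1 with hAdef
  have hAm : ∀ v, MeasurableSet (A v) := fun v => measurableSet_roundCell hcm δ _
  have hAd : Pairwise (Function.onFun Disjoint A) := fun v w hvw =>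
    pairwise_disjoint_roundCell c δ M fun h => hvw (Subtype.ext h)
  set E : Set Y := ⋃ v : U → Fin M, roundCell c δ v with hEdef
  have hE : E = ⋃ v, A v := by
    ext y
    simp only [hEdef, Set.mem_iUnion, hAdef]
    exact ⟨fun ⟨v, hv⟩ => ⟨⟨v, y, hv⟩, hv⟩, fun ⟨v, hv⟩ => ⟨v.1, hv⟩⟩
  set N : V → ℝ := fun v => ν.real (A v) with hN
  have hN0 : ∀ v, 0 ≤ N v := fun v => measureReal_nonneg
  have hN1 : ∑ v, N v ≤ 1 := by
    rw [← measureReal_iUnion_fintype hAd hAm]; exact measureReal_le_one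
  set cV : U → V → ℝ := fun u v => δ * ((v.1 u : ℕ) + 1) with hcV
  have hcV0 : ∀ u v, 0 ≤ cV u v := fun u v => by simp only [hcV]; positivity
  have hcVle : ∀ u v, ∀ y ∈ A v, c u y ≤ cV u v := by
    intro u v y hy
    have h1 := Nat.lt_floor_add_one (c u y / δ)
    rw [hy u, div_lt_iff₀ hδ] at h1
    simp only [hcV]; linarith
  have hcVge : ∀ u v, ∀ y ∈ A v, cV u v ≤ c u y + δ := by
    intro u v y hy
    have h1 := Nat.floor_le (div_nonneg (hc0 u y) hδ.le)
    rw [hy u, le_div_iff₀ hδ] at h1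
    simp only [hcV]; linarith
  have hcVcc : ∀ u u' v, cV u v ≤ (K + δ) + K' * cV u' v := by
    intro u u' v
    obtain ⟨y, hy⟩ := v.2
    have h1 := hcVge u v y hy
    have h2 := hcc u u' y
    have h3 := mul_le_mul_of_nonneg_left (hcVle u' v y hy) hK'
    linarith
  have hmain : ∀ T ∈ tn, ∃ n₀ : ℕ, ∀ n ≥ n₀, ∀ S : Set (List U),
      γ ≤ pathProb (tilt P n (S.indicator 1)) n
        (S ∩ {l | ∀ j, pathSum (fun h _ =>
          if cell (tilt P n (S.indicator 1) h) = j then 1 else 0) l ≤ (1 + δ) * n * T j}) →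
      Real.exp (-(n * (B + ε / 2))) * (γ / 2) ≤
        pathProb (fun _ => N) n {v | ∃ l : List (U × V), l.map Prod.snd = v ∧ l.map Prod.fst ∈ S ∧
          pathSum (fun _ z => cV z.1 z.2) l ≤ n * τ} := by
    intro T hT
    have hprob := hπ T hT
    have hEp : ∀ j, 0 < (π T j).snd.real E := fun j =>
      lt_trans (by positivity) (hM T hT j).1
    have hsum : ∀ j (v : V), ∑ u, (π T j).real ({u} ×ˢ A v) = (π T j).snd.real (A v) := fun j v =>
      sum_measureReal_singleton_prod _ (hAm v)
    have hEinv : ∀ j, 1 / (π T j).snd.real E ≤ 1 + δ := fun j => by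
      have := (hM T hT j).1
      rw [div_lt_iff₀ (by linarith)] at this
      rw [div_le_iff₀ (hEp j)]
      linarith
    obtain ⟨n₀, hn₀⟩ := pathProb_image_ge hP hN0 hN1 hcV0 hδ hδ1 (by linarith : 0 ≤ K + δ) hK'
      hcVcc hcell
      -- The mass outside `E` is dropped, so this is only a subcoupling. Since `E` carries more than
      -- `1 / (1 + δ)` of the second marginal, the renormalized law `h` exceeds the marginal of `s`
      -- by at most the factor `1 + δ`.
      (s := fun j u v => (π T j).real ({u} ×ˢ A v))
      (h := fun j v => (π T j).snd.real (A v) / (π T j).snd.real E)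
      (fun j u v => measureReal_nonneg)
      (fun j u => by
        rw [← hπk T hT j u, ← measureReal_iUnion_fintype]
        · exact measureReal_mono (by
            intro z hz
            obtain ⟨v, hv⟩ := Set.mem_iUnion.1 hz
            exact hv.1)
        · intro v w hvw
          rw [Function.onFun, Set.disjoint_left]
          rintro z ⟨_, h1⟩ ⟨_, h2⟩
          exact Set.disjoint_left.1 (hAd hvw) h1 h2
        · exact fun v => (measurableSet_singleton u).prod (hAm v))
      (fun j => by
        rw [← Finset.sum_div, ← measureReal_iUnion_fintype hAd hAm, ← hE,
          div_self (hEp j).ne'])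
      (fun j v => by
        rw [hsum]
        exact le_div_self measureReal_nonneg (hEp j) measureReal_le_one)
      (fun j v => by
        rw [hsum, div_eq_mul_one_div, mul_comm]
        exact mul_le_mul_of_nonneg_right (hEinv j) measureReal_nonneg)
      (fun j v hv => by
        have hac : (π T j).snd ≪ ν := (klDiv_ne_top_iff.1
          ((hD T hT j).trans_lt ENNReal.ofReal_lt_top).ne).1
        have : (π T j).snd (A v) = 0 := hac ((measureReal_eq_zero_iff).1 hv)
        rw [measureReal_def, this]; simp)
      (C := fun j => C T j + δ) (D := fun j => D T j + δ)
      (fun j => sum_roundCell_le hcm hc0 hδ (hC0 T hT j) (hC T hT j) Subtype.val_injective)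
      (fun j => (finDiv_cells_le (hD0 T hT j) (hD T hT j) hAm hAd hE (hEp j)).trans
        (hM T hT j).2.le)
      (htn T hT).1.2 hδ hγ
    have e1 : ∑ j, T j * (C T j + δ) = ∑ j, T j * C T j + δ := by
      simp only [mul_add, Finset.sum_add_distrib, ← Finset.sum_mul, (htn T hT).1.2, one_mul]
    have e2 : ∑ j, T j * (D T j + δ) = ∑ j, T j * D T j + δ := by
      simp only [mul_add, Finset.sum_add_distrib, ← Finset.sum_mul, (htn T hT).1.2, one_mul]
    refine ⟨n₀, fun n hn S hS => ?_⟩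
    have h1 := hn₀ n hn S hS
    refine (le_trans ?_ h1).trans (pathProb_mono (fun _ => hN0) ?_)
    · refine mul_le_mul_of_nonneg_right (Real.exp_le_exp.2 (neg_le_neg ?_)) (by positivity)
      refine mul_le_mul_of_nonneg_left ?_ (Nat.cast_nonneg _)
      rw [e2]
      have := hTD T hT
      nlinarith
    · rintro v - ⟨l, hl1, hl2, hl3⟩
      refine ⟨l, hl1, hl2, hl3.trans ?_⟩
      refine mul_le_mul_of_nonneg_left ?_ (Nat.cast_nonneg _)
      rw [e1]
      have h2 := hTC T hT
      refine le_trans ?_ hδτ.le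
      gcongr
  choose! n₀ hn₀ using hmain
  -- The constant `γ / 2` does not depend on `n` and is absorbed by half of `ε`.
  obtain ⟨n₁, hn₁⟩ : ∃ n₁ : ℕ, ∀ n ≥ n₁, Real.exp (-(n * (ε / 2))) ≤ γ / 2 := by
    have h1 : Tendsto (fun n : ℕ => Real.exp (-(n * (ε / 2)))) atTop (𝓝 0) :=
      Real.tendsto_exp_neg_atTop_nhds_zero.comp
        (tendsto_natCast_atTop_atTop.atTop_mul_const (by positivity))
    exact eventually_atTop.1 ((h1.eventually (gt_mem_nhds (by positivity : 0 < γ / 2))).mono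
      fun _ h => h.le)
  refine ⟨max (max n₁ 1) (tn.sup n₀), fun n hn S hS => ?_⟩
  have hnpos : 0 < n := by have := le_max_right n₁ 1; omega
  obtain ⟨T, hT, hTp⟩ := hfreq n hnpos (Set.image List.ofFn S) (by rwa [pathProb_ofFn_image])
  have hnT : n₀ T ≤ n := (Finset.le_sup hT).trans ((le_max_right _ _).trans hn)
  have h2 := hn₀ T hT n hnT _ hTp
  have h3 : Real.exp (-(n * (B + ε))) ≤ Real.exp (-(n * (B + ε / 2))) * (γ / 2) := by
    have : Real.exp (-(n * (B + ε))) =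
        Real.exp (-(n * (B + ε / 2))) * Real.exp (-(n * (ε / 2))) := by
      rw [← Real.exp_add]; congr 1; ring
    rw [this]
    exact mul_le_mul_of_nonneg_left (hn₁ n (by omega)) (Real.exp_pos _).le
  set W : Set (List V) := {v | ∃ l : List (U × V), l.map Prod.snd = v ∧
    l.map Prod.fst ∈ Set.image List.ofFn S ∧ pathSum (fun _ z => cV z.1 z.2) l ≤ n * τ} with hW
  have h4 : pathProb (fun _ => N) n W =
      ∑ v : Fin n → V, {v : Fin n → V | List.ofFn v ∈ W}.indicator (fun v => ∏ i, N (v i)) v := by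
    rw [pathProb, pathExp_const_eq_sum]
    refine Finset.sum_congr rfl fun v _ => ?_
    by_cases hv : List.ofFn v ∈ W
    · rw [Set.indicator_of_mem hv, Set.indicator_of_mem (show v ∈ {v | List.ofFn v ∈ W} from hv)]
      simp
    · rw [Set.indicator_of_notMem hv,
        Set.indicator_of_notMem (show v ∉ {v | List.ofFn v ∈ W} from hv), mul_zero]
  refine (ENNReal.ofReal_le_ofReal (h3.trans h2)).trans ?_
  rw [h4, ← pi_iUnion_cells hAm hAd]
  refine measure_mono ?_
  intro y hy
  simp only [Set.mem_iUnion] at hy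
  obtain ⟨v, ⟨l, hl1, ⟨u, hu, hl2⟩, hl3⟩, hyv⟩ := hy
  have hlen : l.length = n := by
    have := congrArg List.length hl1
    simpa using this
  obtain ⟨z, rfl⟩ : ∃ z : Fin n → U × V, l = List.ofFn z := by
    subst hlen
    exact ⟨l.get, (List.ofFn_get l).symm⟩
  rw [List.map_ofFn] at hl1 hl2
  have hl1' := List.ofFn_injective hl1
  have hl2' := List.ofFn_injective hl2
  refine ⟨u, hu, le_trans ?_ hl3⟩
  rw [pathSum_ofFn_const (fun z : U × V => cV z.1 z.2) z]
  refine Finset.sum_le_sum fun i _ => ?_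
  have h5 : (z i).1 = u i := (congrFun hl2' i).symm
  have h6 : (z i).2 = v i := congrFun hl1' i
  rw [h5, h6]
  exact hcVle _ _ _ (hyv i trivial)

end Image

end

end ThickIsoperimetry

namespace ThickIsoperimetry

noncomputable section

/-! ### The single-letter problem in terms of reachable pairs -/

section Reach

open InformationTheory

variable {X Y : Type*} [MeasurableSpace X] [MeasurableSpace Y]

/-- Some law `η` has relative entropy at most `u` and is at transport cost at most `v` from `κ`. -/
def Reach (c : X → Y → ℝ≥0) (ν : Measure Y) (κ : Measure X) (u v : ℝ) : Prop :=
  0 ≤ u ∧ 0 ≤ v ∧ ∃ η : Measure Y, IsProbabilityMeasure η ∧ klDiv η ν ≤ ENNReal.ofReal u ∧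
    transportCost c κ η ≤ ENNReal.ofReal v

lemma exists_coupling_of_transportCost_lt {c : X → Y → ℝ≥0} {κ : Measure X} {η : Measure Y}
    {r : ℝ≥0∞} (h : transportCost c κ η < r) :
    ∃ π : Measure (X × Y), π.fst = κ ∧ π.snd = η ∧ ∫⁻ z, (c z.1 z.2 : ℝ≥0∞) ∂π < r := by
  unfold transportCost at h
  simp only [iInf_lt_iff] at h
  obtain ⟨π, ⟨h1, h2⟩, h3⟩ := h
  exact ⟨π, h1, h2, h3⟩

lemma transportCost_le {c : X → Y → ℝ≥0} {κ : Measure X} {η : Measure Y} (π : Measure (X × Y))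
    (h1 : π.fst = κ) (h2 : π.snd = η) :
    transportCost c κ η ≤ ∫⁻ z, (c z.1 z.2 : ℝ≥0∞) ∂π :=
  iInf₂_le π ⟨h1, h2⟩

/-- Convexity of the transport cost in its second argument. -/
lemma transportCost_mix_le (c : X → Y → ℝ≥0) (κ : Measure X) (η η' : Measure Y) {a b : ℝ≥0}
    (hab : a + b = 1) {v v' : ℝ} (hv0 : 0 ≤ v) (hv'0 : 0 ≤ v')
    (hv : transportCost c κ η ≤ ENNReal.ofReal v)
    (hv' : transportCost c κ η' ≤ ENNReal.ofReal v') :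
    transportCost c κ (a • η + b • η') ≤ ENNReal.ofReal (a * v + b * v') := by
  -- Only nearly optimal couplings are used, so that existence of optimal ones is not needed.
  refine ENNReal.le_of_forall_pos_le_add fun ε hε _ => ?_
  have hlt : ∀ w : ℝ, ENNReal.ofReal w < ENNReal.ofReal w + ε := fun w =>
    ENNReal.lt_add_right ENNReal.ofReal_ne_top (by exact_mod_cast hε.ne')
  obtain ⟨π, h1, h2, h3⟩ := exists_coupling_of_transportCost_lt (hv.trans_lt (hlt v))
  obtain ⟨π', h1', h2', h3'⟩ := exists_coupling_of_transportCost_lt (hv'.trans_lt (hlt v'))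
  refine (transportCost_le (a • π + b • π') ?_ ?_).trans ?_
  · rw [Measure.fst_add]
    have : ∀ (r : ℝ≥0) (ρ : Measure (X × Y)), (r • ρ).fst = r • ρ.fst := fun r ρ => by
      simp [Measure.fst, Measure.map_smul]
    rw [this, this, h1, h1', ← add_smul, hab, one_smul]
  · rw [Measure.snd_add]
    have : ∀ (r : ℝ≥0) (ρ : Measure (X × Y)), (r • ρ).snd = r • ρ.snd := fun r ρ => by
      simp [Measure.snd, Measure.map_smul]
    rw [this, this, h2, h2']
  · rw [lintegral_add_measure]
    have e : ∀ (r : ℝ≥0) (ρ : Measure (X × Y)), ∫⁻ z, (c z.1 z.2 : ℝ≥0∞) ∂(r • ρ) =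
        r * ∫⁻ z, (c z.1 z.2 : ℝ≥0∞) ∂ρ := fun r ρ => by
      rw [lintegral_smul_measure]; rfl
    rw [e, e]
    calc (a : ℝ≥0∞) * ∫⁻ z, (c z.1 z.2 : ℝ≥0∞) ∂π + b * ∫⁻ z, (c z.1 z.2 : ℝ≥0∞) ∂π'
        ≤ a * (ENNReal.ofReal v + ε) + b * (ENNReal.ofReal v' + ε) := by gcongr
      _ = a * ENNReal.ofReal v + b * ENNReal.ofReal v' + (a + b) * ε := by ring
      _ = ENNReal.ofReal (a * v + b * v') + ε := by
          rw [ENNReal.ofReal_add (by positivity) (by positivity),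
            ENNReal.ofReal_mul (by positivity), ENNReal.ofReal_mul (by positivity),
            ENNReal.ofReal_coe_nnreal, ENNReal.ofReal_coe_nnreal]
          have : (a : ℝ≥0∞) + b = 1 := by exact_mod_cast hab
          rw [this, one_mul]

/-- Reachable pairs form a convex set. -/
lemma Reach.mix {c : X → Y → ℝ≥0} {ν : Measure Y} [IsProbabilityMeasure ν] {κ : Measure X}
    {u v u' v' : ℝ} (h : Reach c ν κ u v) (h' : Reach c ν κ u' v') {a b : ℝ} (ha : 0 ≤ a)
    (hb : 0 ≤ b) (hab : a + b = 1) : Reach c ν κ (a * u + b * u') (a * v + b * v') := by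
  obtain ⟨hu, hv, η, hη, h1, h2⟩ := h
  obtain ⟨hu', hv', η', hη', h1', h2'⟩ := h'
  lift a to ℝ≥0 using ha
  lift b to ℝ≥0 using hb
  have hab' : a + b = 1 := by exact_mod_cast hab
  refine ⟨by positivity, by positivity, a • η + b • η', ⟨?_⟩, ?_, ?_⟩
  · simp only [Measure.add_apply, Measure.smul_apply, measure_univ]
    rw [← add_smul, hab', one_smul]
  · refine (klDiv_mix_le hab').trans ?_
    calc (a : ℝ≥0∞) * klDiv η ν + b * klDiv η' ν
        ≤ a * ENNReal.ofReal u + b * ENNReal.ofReal u' := by gcongr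
      _ = _ := by
          rw [ENNReal.ofReal_add (by positivity) (by positivity),
            ENNReal.ofReal_mul (by positivity), ENNReal.ofReal_mul (by positivity),
            ENNReal.ofReal_coe_nnreal, ENNReal.ofReal_coe_nnreal]
  · exact transportCost_mix_le c κ η η' hab' hv hv' h2 h2'

lemma Reach.mono {c : X → Y → ℝ≥0} {ν : Measure Y} {κ : Measure X} {u v u' v' : ℝ}
    (h : Reach c ν κ u v) (hu : u ≤ u') (hv : v ≤ v') : Reach c ν κ u' v' := by
  obtain ⟨h1, h2, η, h3, h4, h5⟩ := h
  exact ⟨h1.trans hu, h2.trans hv, η, h3, h4.trans (ENNReal.ofReal_le_ofReal hu),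
    h5.trans (ENNReal.ofReal_le_ofReal hv)⟩

/-- The law on two points with given weights. -/
def boolMeasure (a b : ℝ≥0) : Measure Bool := a • Measure.dirac false + b • Measure.dirac true

lemma lintegral_boolMeasure (a b : ℝ≥0) (f : Bool → ℝ≥0∞) :
    ∫⁻ w, f w ∂boolMeasure a b = a * f false + b * f true := by
  rw [boolMeasure, lintegral_add_measure]
  have e : ∀ (r : ℝ≥0) (w : Bool), ∫⁻ w, f w ∂(r • Measure.dirac w) = r * f w := fun r w => by
    rw [show r • Measure.dirac w = (r : ℝ≥0∞) • Measure.dirac w from rfl, lintegral_smul_measure,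
      lintegral_dirac]; rfl
  rw [e, e]

/-- Two-point kernels. -/
def boolKernel (κ₀ κ₁ : Measure X) : Kernel Bool X :=
  ⟨fun w => cond w κ₁ κ₀, measurable_of_countable _⟩

lemma boolKernel_isMarkov (κ₀ κ₁ : Measure X) [IsProbabilityMeasure κ₀] [IsProbabilityMeasure κ₁] :
    IsMarkovKernel (boolKernel κ₀ κ₁) :=
  ⟨fun w => by cases w <;> simp only [boolKernel] <;> assumption⟩

lemma isProbabilityMeasure_boolMeasure {a b : ℝ≥0} (hab : a + b = 1) :
    IsProbabilityMeasure (boolMeasure a b) := ⟨by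
  simp only [boolMeasure, Measure.add_apply, Measure.smul_apply, measure_univ]
  rw [← add_smul, hab, one_smul]⟩

variable [TopologicalSpace X]

/-- A two-point family that is feasible for `psi` has reachable pairs below every bound on `psi`. -/
lemma exists_reach_of_psi_lt [T2Space X] [BorelSpace X] [SecondCountableTopology X]
    {c : X → Y → ℝ≥0} {νX : Measure X}
    {νY : Measure Y} {α t B : ℝ} (ht : 0 ≤ t) {κ₀ κ₁ : Measure X} [IsProbabilityMeasure κ₀]
    [IsProbabilityMeasure κ₁] (h₀ : ConcentratedOnCompact κ₀) (h₁ : ConcentratedOnCompact κ₁)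
    {d₀ d₁ : ℝ} (hd₀0 : 0 ≤ d₀) (hd₁0 : 0 ≤ d₁)
    (hd₀ : klDiv κ₀ νX ≤ ENNReal.ofReal d₀) (hd₁ : klDiv κ₁ νX ≤ ENNReal.ofReal d₁)
    {a b : ℝ} (ha : 0 ≤ a) (hb : 0 ≤ b) (hab : a + b = 1) (hd : a * d₀ + b * d₁ ≤ α)
    (hψ : psi c νX νY α t < ENNReal.ofReal B) :
    ∃ u₀ v₀ u₁ v₁ : ℝ, (0 < a → Reach c νY κ₀ u₀ v₀) ∧ (0 < b → Reach c νY κ₁ u₁ v₁) ∧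
      a * u₀ + b * u₁ ≤ B ∧ a * v₀ + b * v₁ ≤ t := by
  lift a to ℝ≥0 using ha
  lift b to ℝ≥0 using hb
  have hab' : a + b = 1 := by exact_mod_cast hab
  have hB : 0 < B := ENNReal.ofReal_pos.1 (bot_le.trans_lt hψ)
  have := boolKernel_isMarkov κ₀ κ₁
  have := isProbabilityMeasure_boolMeasure hab'
  have hconc : ConcentratedOnCompact (Measure.compProd (boolMeasure a b) (boolKernel κ₀ κ₁)) := by
    obtain ⟨K₀, hK₀, hK₀'⟩ := h₀
    obtain ⟨K₁, hK₁, hK₁'⟩ := h₁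
    refine ⟨Set.univ ×ˢ (K₀ ∪ K₁), isCompact_univ.prod (hK₀.union hK₁), ?_⟩
    have hm : MeasurableSet (Set.univ ×ˢ (K₀ ∪ K₁) : Set (Bool × X))ᶜ :=
      (MeasurableSet.univ.prod (hK₀.union hK₁).measurableSet).compl
    rw [Measure.compProd_apply hm, lintegral_boolMeasure]
    have e : ∀ w, Prod.mk w ⁻¹' (Set.univ ×ˢ (K₀ ∪ K₁) : Set (Bool × X))ᶜ = (K₀ ∪ K₁)ᶜ := by
      intro w; ext x; simp
    rw [e, e]
    have h1 : boolKernel κ₀ κ₁ false (K₀ ∪ K₁)ᶜ = 0 :=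
      measure_mono_null (Set.compl_subset_compl.2 Set.subset_union_left) hK₀'
    have h2 : boolKernel κ₀ κ₁ true (K₀ ∪ K₁)ᶜ = 0 :=
      measure_mono_null (Set.compl_subset_compl.2 Set.subset_union_right) hK₁'
    rw [h1, h2]; simp
  have hent : condRelEntropy (boolKernel κ₀ κ₁) νX (boolMeasure a b) ≤ ENNReal.ofReal α := by
    rw [condRelEntropy, lintegral_boolMeasure]
    calc (a : ℝ≥0∞) * klDiv κ₀ νX + b * klDiv κ₁ νX
        ≤ a * ENNReal.ofReal d₀ + b * ENNReal.ofReal d₁ := by gcongr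
      _ = ENNReal.ofReal (a * d₀ + b * d₁) := by
          rw [ENNReal.ofReal_add (by positivity) (by positivity),
            ENNReal.ofReal_mul (by positivity), ENNReal.ofReal_mul (by positivity),
            ENNReal.ofReal_coe_nnreal, ENNReal.ofReal_coe_nnreal]
      _ ≤ _ := ENNReal.ofReal_le_ofReal hd
  have hinf : ⨅ (η : Kernel Bool Y) (_ : IsMarkovKernel η)
      (_ : condTransportCost c (boolKernel κ₀ κ₁) η (boolMeasure a b) ≤ ENNReal.ofReal t),
      condRelEntropy η νY (boolMeasure a b) < ENNReal.ofReal B := by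
    refine lt_of_le_of_lt ?_ hψ
    unfold psi
    refine le_iSup_of_le (boolMeasure a b) (le_iSup_of_le inferInstance
      (le_iSup_of_le (boolKernel κ₀ κ₁) (le_iSup_of_le inferInstance
      (le_iSup_of_le hconc (le_iSup_of_le hent le_rfl)))))
  simp only [iInf_lt_iff] at hinf
  obtain ⟨η, hη, hcost, hdiv⟩ := hinf
  rw [condTransportCost, lintegral_boolMeasure] at hcost
  rw [condRelEntropy, lintegral_boolMeasure] at hdiv
  change (a : ℝ≥0∞) * transportCost c κ₀ (η false) + b * transportCost c κ₁ (η true) ≤ _ at hcost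
  -- Entropy and cost are known to be finite only at a label of positive weight, whence the
  -- conditional form of the two reachability claims.
  have hfin : ∀ {r : ℝ≥0} {x : ℝ≥0∞}, (r : ℝ≥0∞) * x < ⊤ → 0 < (r : ℝ) → x ≠ ⊤ := by
    intro r x h hr hx
    rw [hx, ENNReal.mul_top (by exact_mod_cast hr.ne')] at h
    exact lt_irrefl _ h
  have hc₀ : (a : ℝ≥0∞) * transportCost c κ₀ (η false) < ⊤ :=
    (le_self_add.trans hcost).trans_lt ENNReal.ofReal_lt_top
  have hc₁ : (b : ℝ≥0∞) * transportCost c κ₁ (η true) < ⊤ :=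
    (le_add_self.trans hcost).trans_lt ENNReal.ofReal_lt_top
  have hk₀ : (a : ℝ≥0∞) * klDiv (η false) νY < ⊤ :=
    (le_self_add.trans hdiv.le).trans_lt ENNReal.ofReal_lt_top
  have hk₁ : (b : ℝ≥0∞) * klDiv (η true) νY < ⊤ :=
    (le_add_self.trans hdiv.le).trans_lt ENNReal.ofReal_lt_top
  refine ⟨(klDiv (η false) νY).toReal, (transportCost c κ₀ (η false)).toReal,
    (klDiv (η true) νY).toReal, (transportCost c κ₁ (η true)).toReal, fun h => ?_, fun h => ?_,
    ?_, ?_⟩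
  · exact ⟨ENNReal.toReal_nonneg, ENNReal.toReal_nonneg, η false, inferInstance,
      by rw [ENNReal.ofReal_toReal (hfin hk₀ h)], by rw [ENNReal.ofReal_toReal (hfin hc₀ h)]⟩
  · exact ⟨ENNReal.toReal_nonneg, ENNReal.toReal_nonneg, η true, inferInstance,
      by rw [ENNReal.ofReal_toReal (hfin hk₁ h)], by rw [ENNReal.ofReal_toReal (hfin hc₁ h)]⟩
  · have := ENNReal.toReal_le_of_le_ofReal hB.le hdiv.le
    rw [ENNReal.toReal_add hk₀.ne hk₁.ne, ENNReal.toReal_mul, ENNReal.toReal_mul] at this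
    exact this
  · have := ENNReal.toReal_le_of_le_ofReal ht hcost
    rw [ENNReal.toReal_add hc₀.ne hc₁.ne, ENNReal.toReal_mul, ENNReal.toReal_mul] at this
    exact this

/-- A bound strictly below `psi` is a bound for the reachable pairs of a two-point family. -/
lemma exists_family_of_lt_psi [T2Space X] [BorelSpace X] [SecondCountableTopology X]
    {c : X → Y → ℝ≥0} {νX : Measure X} {νY : Measure Y} {α t m : ℝ} (hα : 0 ≤ α)
    (hm : 0 ≤ m) (hψ : ENNReal.ofReal m < psi c νX νY α t) :
    ∃ (κ₀ κ₁ : Measure X) (a b d₀ d₁ : ℝ), IsProbabilityMeasure κ₀ ∧ IsProbabilityMeasure κ₁ ∧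
      ConcentratedOnCompact κ₀ ∧ ConcentratedOnCompact κ₁ ∧ 0 ≤ a ∧ 0 ≤ b ∧ a + b = 1 ∧
      0 ≤ d₀ ∧ 0 ≤ d₁ ∧ klDiv κ₀ νX ≤ ENNReal.ofReal d₀ ∧ klDiv κ₁ νX ≤ ENNReal.ofReal d₁ ∧
      a * d₀ + b * d₁ ≤ α ∧ ∀ u₀ v₀ u₁ v₁ : ℝ, Reach c νY κ₀ u₀ v₀ → Reach c νY κ₁ u₁ v₁ →
        a * v₀ + b * v₁ ≤ t → m < a * u₀ + b * u₁ := by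
  unfold psi at hψ
  simp only [lt_iSup_iff] at hψ
  obtain ⟨πW, hπW, κ, hκ, ⟨K, hK, hK0⟩, hent, hlt⟩ := hψ
  have hlint : ∀ f : Bool → ℝ≥0∞, ∫⁻ w, f w ∂πW = πW {false} * f false + πW {true} * f true := by
    intro f
    rw [lintegral_fintype, Fintype.sum_bool, mul_comm, mul_comm (f false), add_comm]
  have hsum : πW {false} + πW {true} = 1 := by
    have := hlint fun _ => 1
    rw [lintegral_one, measure_univ, mul_one, mul_one] at this
    exact this.symm
  have ha' : πW {false} ≠ ⊤ := measure_ne_top _ _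
  have hb' : πW {true} ≠ ⊤ := measure_ne_top _ _
  set a := (πW {false}).toReal with ha
  set b := (πW {true}).toReal with hb
  have hab : a + b = 1 := by
    rw [ha, hb, ← ENNReal.toReal_add ha' hb', hsum, ENNReal.toReal_one]
  have haE : πW {false} = ENNReal.ofReal a := (ENNReal.ofReal_toReal ha').symm
  have hbE : πW {true} = ENNReal.ofReal b := (ENNReal.ofReal_toReal hb').symm
  have ha0 : 0 ≤ a := ENNReal.toReal_nonneg
  have hb0 : 0 ≤ b := ENNReal.toReal_nonneg
  have hconc : ∀ w, πW {w} ≠ 0 → ConcentratedOnCompact (κ w) := by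
    intro w hw
    refine ⟨Set.image Prod.snd K, hK.image continuous_snd, ?_⟩
    rw [Measure.compProd_apply hK.measurableSet.compl, hlint] at hK0
    have : κ w (Prod.mk w ⁻¹' Kᶜ) = 0 := by
      rw [add_eq_zero] at hK0
      cases w
      · exact (mul_eq_zero.1 hK0.1).resolve_left hw
      · exact (mul_eq_zero.1 hK0.2).resolve_left hw
    refine measure_mono_null ?_ this
    intro x hx hx'
    exact hx ⟨_, hx', rfl⟩
  have hfin : ∀ w, πW {w} ≠ 0 → klDiv (κ w) νX ≠ ⊤ := by
    intro w hw htop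
    rw [condRelEntropy, hlint] at hent
    have : πW {w} * klDiv (κ w) νX ≤ ENNReal.ofReal α := by
      cases w
      · exact le_self_add.trans hent
      · exact le_add_self.trans hent
    rw [htop, ENNReal.mul_top hw] at this
    exact absurd this (by simp)
  -- replace the kernel at points of weight zero
  obtain ⟨w₀, hw₀, hw₀'⟩ : ∃ w₀ : Bool, πW {w₀} ≠ 0 ∧ (πW {false} ≠ 0 → w₀ = false) := by
    by_cases h : πW {false} = 0
    · refine ⟨true, ?_, fun h' => absurd h h'⟩
      rw [h, zero_add] at hsum; rw [hsum]; exact one_ne_zero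
    · exact ⟨false, h, fun _ => rfl⟩
  obtain ⟨w₁, hw₁, hw₁'⟩ : ∃ w₁ : Bool, πW {w₁} ≠ 0 ∧ (πW {true} ≠ 0 → w₁ = true) := by
    by_cases h : πW {true} = 0
    · refine ⟨false, ?_, fun h' => absurd h h'⟩
      rw [h, add_zero] at hsum; rw [hsum]; exact one_ne_zero
    · exact ⟨true, h, fun _ => rfl⟩
  have e₀ : ∀ F : Measure X → ℝ≥0∞, πW {false} * F (κ w₀) = πW {false} * F (κ false) := by
    intro F
    by_cases h : πW {false} = 0
    · rw [h, zero_mul, zero_mul]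
    · rw [hw₀' h]
  have e₁ : ∀ F : Measure X → ℝ≥0∞, πW {true} * F (κ w₁) = πW {true} * F (κ true) := by
    intro F
    by_cases h : πW {true} = 0
    · rw [h, zero_mul, zero_mul]
    · rw [hw₁' h]
  refine ⟨κ w₀, κ w₁, a, b, (klDiv (κ w₀) νX).toReal, (klDiv (κ w₁) νX).toReal, inferInstance,
    inferInstance, hconc _ hw₀, hconc _ hw₁, ha0, hb0, hab,
    ENNReal.toReal_nonneg, ENNReal.toReal_nonneg, by rw [ENNReal.ofReal_toReal (hfin _ hw₀)],
    by rw [ENNReal.ofReal_toReal (hfin _ hw₁)], ?_, ?_⟩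
  · rw [condRelEntropy, hlint, ← e₀ (fun μ => klDiv μ νX), ← e₁ (fun μ => klDiv μ νX)] at hent
    have := ENNReal.toReal_le_of_le_ofReal hα hent
    rw [ENNReal.toReal_add (ENNReal.mul_ne_top ha' (hfin _ hw₀))
      (ENNReal.mul_ne_top hb' (hfin _ hw₁)), ENNReal.toReal_mul, ENNReal.toReal_mul] at this
    exact this
  · rintro u₀ v₀ u₁ v₁ ⟨hu₀, hv₀, η₀, hη₀, hk₀, hc₀⟩ ⟨hu₁, hv₁, η₁, hη₁, hk₁, hc₁⟩ hcost
    have hM := boolKernel_isMarkov η₀ η₁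
    have hc : condTransportCost c κ (boolKernel η₀ η₁) πW ≤ ENNReal.ofReal t := by
      rw [condTransportCost, hlint]
      change πW {false} * transportCost c (κ false) η₀ + πW {true} * transportCost c (κ true) η₁ ≤ _
      rw [← e₀ (fun μ => transportCost c μ η₀), ← e₁ (fun μ => transportCost c μ η₁)]
      calc πW {false} * transportCost c (κ w₀) η₀ + πW {true} * transportCost c (κ w₁) η₁
          ≤ ENNReal.ofReal a * ENNReal.ofReal v₀ + ENNReal.ofReal b * ENNReal.ofReal v₁ := by
            rw [haE, hbE]; gcongr
        _ = ENNReal.ofReal (a * v₀ + b * v₁) := by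
            rw [ENNReal.ofReal_add (by positivity) (by positivity), ENNReal.ofReal_mul ha0,
              ENNReal.ofReal_mul hb0]
        _ ≤ _ := ENNReal.ofReal_le_ofReal hcost
    have h1 : ENNReal.ofReal m < condRelEntropy (boolKernel η₀ η₁) νY πW :=
      hlt.trans_le (iInf_le_of_le _ (iInf_le_of_le hM (iInf_le_of_le hc le_rfl)))
    rw [condRelEntropy, hlint] at h1
    change _ < πW {false} * klDiv η₀ νY + πW {true} * klDiv η₁ νY at h1
    have h2 : ENNReal.ofReal m < ENNReal.ofReal (a * u₀ + b * u₁) := by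
      refine h1.trans_le ?_
      rw [ENNReal.ofReal_add (by positivity) (by positivity), ENNReal.ofReal_mul ha0,
              ENNReal.ofReal_mul hb0, haE, hbE]
      gcongr
    exact (ENNReal.ofReal_lt_ofReal_iff_of_nonneg hm).1 h2

/-- The two-point families of `psi` control all finite families. -/
lemma exists_reach_family [T2Space X] [BorelSpace X] [SecondCountableTopology X]
    {c : X → Y → ℝ≥0} {νX : Measure X} {νY : Measure Y} [IsProbabilityMeasure νY]
    {m : ℕ} {T : Fin m → ℝ} (hT : ∀ j, 0 < T j)
    (hT1 : ∑ j, T j = 1) {κ : Fin m → Measure X} (hκ : ∀ j, IsProbabilityMeasure (κ j))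
    (hκc : ∀ j, ConcentratedOnCompact (κ j)) {d : Fin m → ℝ} (hd0 : ∀ j, 0 ≤ d j)
    (hd : ∀ j, klDiv (κ j) νX ≤ ENNReal.ofReal (d j)) {α t' t B ε : ℝ}
    (hα : ∑ j, T j * d j ≤ α) (ht' : 0 ≤ t') (htt : t' < t) (hB : 0 ≤ B)
    (hψ : psi c νX νY α t' ≤ ENNReal.ofReal B) (hε : 0 < ε)
    (hne : ∀ j, ∃ u v, Reach c νY (κ j) u v) :
    ∃ u v : Fin m → ℝ, (∀ j, Reach c νY (κ j) (u j) (v j)) ∧ ∑ j, T j * u j ≤ B + ε ∧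
      ∑ j, T j * v j ≤ t := by
  by_contra hcon
  push Not at hcon
  -- Average pairs (entropy, cost) attainable by the whole family. If the target `(B + ε, t)` is not
  -- strictly above any of them, it is separated from them by a nonnegative functional `(p, q)`.
  set S : Set (Fin 2 → ℝ) := {x | ∃ u v : Fin m → ℝ, (∀ j, Reach c νY (κ j) (u j) (v j)) ∧
    x 0 = ∑ j, T j * u j ∧ x 1 = ∑ j, T j * v j} with hS
  choose u₀ v₀ huv₀ using hne
  obtain ⟨w, hw0, hwne, hw⟩ := exists_nonneg_weights (S := S)
    ⟨![∑ j, T j * u₀ j, ∑ j, T j * v₀ j], u₀, v₀, huv₀, rfl, rfl⟩ (by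
      rintro x ⟨u, v, h, hx0, hx1⟩ y ⟨u', v', h', hy0, hy1⟩ a b ha hb hab
      refine ⟨fun i => a * x i + b * y i, ⟨fun j => a * u j + b * u' j, fun j => a * v j + b * v' j,
        fun j => (h j).mix (h' j) ha.le hb.le hab, ?_, ?_⟩, fun i => le_rfl⟩
      · simp only [hx0, hy0, Finset.mul_sum, ← Finset.sum_add_distrib]; congr! 1; ring
      · simp only [hx1, hy1, Finset.mul_sum, ← Finset.sum_add_distrib]; congr! 1; ring)
    (z := ![B + ε, t]) (by
      rintro ⟨x, ⟨u, v, h, hx0, hx1⟩, hlt⟩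
      have h0 := hlt 0
      have h1 := hlt 1
      simp only [Matrix.cons_val_zero, Matrix.cons_val_one] at h0 h1
      rw [hx0] at h0
      rw [hx1] at h1
      exact absurd (hcon u v h h0.le) (not_lt.2 h1.le))
  simp only [Fin.sum_univ_two, Matrix.cons_val_zero, Matrix.cons_val_one] at hw
  set p := w 0 with hp
  set q := w 1 with hq
  have hp0 : 0 ≤ p := hw0 0
  have hq0 : 0 ≤ q := hw0 1
  set G : Fin m → Set ℝ := fun j => {r | ∃ u v, Reach c νY (κ j) u v ∧ r = p * u + q * v} with hG
  have hGne : ∀ j, (G j).Nonempty := fun j => ⟨_, u₀ j, v₀ j, huv₀ j, rfl⟩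
  have hGb : ∀ j, BddBelow (G j) := fun j => ⟨0, by
    rintro r ⟨u, v, h, rfl⟩
    exact add_nonneg (mul_nonneg hp0 h.1) (mul_nonneg hq0 h.2.1)⟩
  -- The optimal Lagrangian value of each law. The infimum decouples over the family, so separation
  -- becomes a lower bound on the average of `g`.
  set g : Fin m → ℝ := fun j => sInf (G j) with hg
  have hgL : p * (B + ε) + q * t ≤ ∑ j, T j * g j := by
    refine le_of_forall_pos_le_add fun ε' hε' => ?_
    have hch : ∀ j, ∃ u v, Reach c νY (κ j) u v ∧ p * u + q * v < g j + ε' := by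
      intro j
      obtain ⟨r, ⟨u, v, h, rfl⟩, hr⟩ := exists_lt_of_csInf_lt (hGne j)
        (show sInf (G j) < g j + ε' by simp only [hg]; linarith)
      exact ⟨u, v, h, hr⟩
    choose u v huv hlt using hch
    have h1 := hw ![∑ j, T j * u j, ∑ j, T j * v j] ⟨u, v, huv, rfl, rfl⟩
    simp only [Matrix.cons_val_zero, Matrix.cons_val_one] at h1
    refine h1.trans ?_
    calc p * ∑ j, T j * u j + q * ∑ j, T j * v j = ∑ j, T j * (p * u j + q * v j) := by
          simp only [Finset.mul_sum, ← Finset.sum_add_distrib]; congr! 1; ring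
      _ ≤ ∑ j, T j * (g j + ε') := Finset.sum_le_sum fun j _ =>
          mul_le_mul_of_nonneg_left (hlt j).le (hT j).le
      _ = _ := by simp only [mul_add, Finset.sum_add_distrib, ← Finset.sum_mul, hT1, one_mul]
  -- Two laws with average entropy no larger and average Lagrangian value no smaller than those of
  -- the family; to these two the bound on `psi` applies.
  obtain ⟨i, j, θ, hθ0, hθ1, hθd, hθg⟩ := exists_two_point_average (d := d) (g := g)
    (fun j => (hT j).le) hT1
  have := hκ i
  have := hκ j
  obtain ⟨ui, vi, uj, vj, hi, hj, hu, hv⟩ := exists_reach_of_psi_lt (B := B + ε / 2) ht' (hκc i)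
    (hκc j) (hd0 i) (hd0 j) (hd i) (hd j) (sub_nonneg.2 hθ1) hθ0 (by ring) (hθd.trans hα)
    (hψ.trans_lt ((ENNReal.ofReal_lt_ofReal_iff (by linarith)).2 (by linarith)))
  have hmul : ∀ {r : ℝ} {j : Fin m} {u v : ℝ}, 0 ≤ r → (0 < r → Reach c νY (κ j) u v) →
      r * g j ≤ r * (p * u + q * v) := by
    intro r j u v hr h
    rcases hr.eq_or_lt with h0 | h0
    · rw [← h0, zero_mul, zero_mul]
    · exact mul_le_mul_of_nonneg_left (csInf_le (hGb j) ⟨u, v, h h0, rfl⟩) hr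
  have h1 := hmul (sub_nonneg.2 hθ1) hi
  have h2 := hmul hθ0 hj
  have h3 : p * ((1 - θ) * ui + θ * uj) ≤ p * (B + ε / 2) := mul_le_mul_of_nonneg_left hu hp0
  have h4 : q * ((1 - θ) * vi + θ * vj) ≤ q * t' := mul_le_mul_of_nonneg_left hv hq0
  -- The slacks in both coordinates are strictly positive, so both multipliers must vanish, contrary
  -- to separation.
  have h5 : p * (ε / 2) + q * (t - t') ≤ 0 := by nlinarith
  have hp' : p = 0 := by
    have : 0 ≤ q * (t - t') := mul_nonneg hq0 (by linarith)
    nlinarith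
  have hq' : q = 0 := by
    have : 0 ≤ p * (ε / 2) := mul_nonneg hp0 (by linarith)
    nlinarith
  refine hwne (funext fun i => ?_)
  fin_cases i
  · exact hp'
  · exact hq'

end Reach

end

end ThickIsoperimetry

namespace ThickIsoperimetry

noncomputable section

/-! ### Finite partitions of the space -/

section Partition

open InformationTheory

/-- Multiplicative perturbation of the powers. -/
lemma exists_add_rpow_le {p : ℝ} (hp : 1 ≤ p) {δ : ℝ} (hδ : 0 < δ) :
    ∃ L : ℝ, 0 < L ∧ ∀ s h : ℝ, 0 ≤ s → 0 ≤ h → (s + h) ^ p ≤ (1 + δ) * s ^ p + L * h ^ p := by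
  -- Convexity is applied to `s + h = (1 - t) * (s / (1 - t)) + t * (h / t)`; as `t` tends to zero
  -- the factor of `s ^ p` tends to one.
  obtain ⟨t, ht0, ht1, ht⟩ : ∃ t : ℝ, 0 < t ∧ t < 1 ∧ (1 - t) * (1 / (1 - t)) ^ p ≤ 1 + δ := by
    have h1 : ContinuousAt (fun t : ℝ => (1 - t) * (1 / (1 - t)) ^ p) 0 := by
      refine ContinuousAt.mul (by fun_prop) (ContinuousAt.rpow_const ?_ (Or.inr (by linarith)))
      exact ContinuousAt.div continuousAt_const (by fun_prop) (by norm_num)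
    have h2 : ∀ᶠ t : ℝ in 𝓝[>] 0, (1 - t) * (1 / (1 - t)) ^ p < 1 + δ :=
      (h1.eventually (gt_mem_nhds (by simp [hδ]))).filter_mono nhdsWithin_le_nhds
    have h3 : ∀ᶠ t : ℝ in 𝓝[>] 0, t < 1 :=
      Filter.Eventually.filter_mono nhdsWithin_le_nhds (gt_mem_nhds one_pos)
    have h4 : ∀ᶠ t : ℝ in 𝓝[>] 0, 0 < t := self_mem_nhdsWithin
    obtain ⟨t, h⟩ := (h4.and (h3.and h2)).exists
    exact ⟨t, h.1, h.2.1, h.2.2.le⟩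
  have ht1' : 0 < 1 - t := by linarith
  refine ⟨t * (1 / t) ^ p, by positivity, fun s h hs hh => ?_⟩
  have hc := (convexOn_rpow hp).2 (x := s / (1 - t)) (div_nonneg hs ht1'.le) (y := h / t)
    (div_nonneg hh ht0.le) ht1'.le ht0.le (by ring)
  simp only [smul_eq_mul] at hc
  rw [mul_div_cancel₀ _ ht1'.ne', mul_div_cancel₀ _ ht0.ne'] at hc
  refine hc.trans (add_le_add ?_ (le_of_eq ?_))
  · rw [div_eq_mul_one_div, Real.mul_rpow hs (by positivity)]
    calc (1 - t) * (s ^ p * (1 / (1 - t)) ^ p) = ((1 - t) * (1 / (1 - t)) ^ p) * s ^ p := by ring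
      _ ≤ _ := mul_le_mul_of_nonneg_right ht (Real.rpow_nonneg hs p)
  · rw [div_eq_mul_one_div h, Real.mul_rpow hh (by positivity)]
    ring

/-- A compact set is cut into finitely many measurable pieces near anchor points; the complement
is one more piece. -/
lemma exists_partition {X : Type*} [MetricSpace X] [SecondCountableTopology X] [MeasurableSpace X]
    [BorelSpace X] (x₀ : X) {K : Set X} (hK : IsCompact K) {h : ℝ} (hh : 0 < h) :
    ∃ (N : ℕ) (f : X → Fin (N + 1)) (a : Fin (N + 1) → X), Measurable f ∧
      a (Fin.last N) = x₀ ∧ (∀ x ∈ K, f x ≠ Fin.last N ∧ dist x (a (f x)) ≤ h) ∧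
      ∀ x ∉ K, f x = Fin.last N := by
  classical
  have : Nonempty X := ⟨x₀⟩
  set e := TopologicalSpace.denseSeq X
  obtain ⟨N, hN⟩ : ∃ N : ℕ, ∀ x ∈ K, ∃ k ≤ N, dist x (e k) < h := by
    obtain ⟨t, ht⟩ := hK.elim_finite_subcover (fun k : ℕ => Metric.ball (e k) h)
      (fun _ => Metric.isOpen_ball) (by
        intro x _
        obtain ⟨k, hk⟩ := (TopologicalSpace.denseRange_denseSeq X).exists_dist_lt x hh
        exact Set.mem_iUnion.2 ⟨k, hk⟩)
    refine ⟨t.sup id, fun x hx => ?_⟩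
    obtain ⟨k, hk, hxk⟩ : ∃ k ∈ t, x ∈ Metric.ball (e k) h := by simpa using ht hx
    exact ⟨k, Finset.le_sup (f := id) hk, hxk⟩
  have hind : ∀ x, SimpleFunc.nearestPtInd e N x < N + 1 := fun x =>
    Nat.lt_succ_of_le (SimpleFunc.nearestPtInd_le e N x)
  -- Nearest-point indices run over `0, ..., N`, so the index `N + 1` is free for the complement.
  refine ⟨N + 1, fun x => if x ∈ K then ⟨SimpleFunc.nearestPtInd e N x, (hind x).trans
    (Nat.lt_succ_self _)⟩ else Fin.last (N + 1),
    fun i => if i = Fin.last (N + 1) then x₀ else e i, ?_, by simp, ?_, ?_⟩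
  · refine Measurable.ite hK.measurableSet ?_ measurable_const
    refine measurable_to_countable' fun i => ?_
    have : (fun x => (⟨SimpleFunc.nearestPtInd e N x, (hind x).trans
        (Nat.lt_succ_self _)⟩ : Fin (N + 1 + 1))) ⁻¹' {i} =
        SimpleFunc.nearestPtInd e N ⁻¹' {(i : ℕ)} := by
      ext x; simp [Fin.ext_iff]
    rw [this]
    exact SimpleFunc.measurableSet_fiber _ _
  · intro x hx
    have hne : (⟨SimpleFunc.nearestPtInd e N x, (hind x).trans
        (Nat.lt_succ_self _)⟩ : Fin (N + 1 + 1)) ≠ Fin.last (N + 1) := by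
      intro h
      have h1 := congrArg Fin.val h
      simp only [Fin.val_last] at h1
      exact (hind x).ne h1
    simp only [hx, if_true, hne, if_false, ne_eq, not_false_eq_true, true_and]
    obtain ⟨k, hk, hkx⟩ := hN x hx
    have h1 := SimpleFunc.edist_nearestPt_le e x hk
    rw [edist_dist, edist_dist, ENNReal.ofReal_le_ofReal_iff dist_nonneg] at h1
    rw [dist_comm]
    have h2 : dist (e k) x < h := by rwa [dist_comm]
    exact h1.trans h2.le
  · intro x hx
    simp [hx]

variable {U X : Type*} [Fintype U] [MeasurableSpace X]

/-- The mixture with weights `k` of the conditional laws of `ν` on the cells `A u`. -/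
def cellMix (ν : Measure X) (A : U → Set X) (k : U → ℝ) : Measure X :=
  ν.withDensity fun x => ENNReal.ofReal (∑ u, (A u).indicator (fun _ => k u / ν.real (A u)) x)

section CellMix

variable {ν : Measure X} {A : U → Set X} {k : U → ℝ}

lemma cellMix_density_props (hd : Pairwise (Function.onFun Disjoint A))
    (hk : k ∈ stdSimplex ℝ U) :
    (∀ x, 0 ≤ ∑ u, (A u).indicator (fun _ => k u / ν.real (A u)) x) ∧
    (∀ x, ∑ u, (A u).indicator (fun _ => k u / ν.real (A u)) x ≤ ∑ u, k u / ν.real (A u)) ∧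
    ∀ u, ∀ x ∈ A u, ∑ u, (A u).indicator (fun _ => k u / ν.real (A u)) x = k u / ν.real (A u) := by
  have h0 : ∀ u, 0 ≤ k u / ν.real (A u) := fun u => div_nonneg (hk.1 u) measureReal_nonneg
  refine ⟨fun x => Finset.sum_nonneg fun u _ => Set.indicator_nonneg (fun _ _ => h0 u) _,
    fun x => Finset.sum_le_sum fun u _ => Set.indicator_le_self' (fun _ _ => h0 u) _,
    fun u x hx => ?_⟩
  rw [Finset.sum_eq_single u]
  · rw [Set.indicator_of_mem hx]
  · intro w _ hw
    exact Set.indicator_of_notMem (fun h => Set.disjoint_left.1 (hd hw) h hx) _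
  · simp

lemma measurable_cellMix_density (hA : ∀ u, MeasurableSet (A u)) :
    Measurable fun x => ∑ u, (A u).indicator (fun _ => k u / ν.real (A u)) x :=
  Finset.measurable_sum _ fun u _ => measurable_const.indicator (hA u)

lemma cellMix_apply_cell [IsProbabilityMeasure ν] (hA : ∀ u, MeasurableSet (A u))
    (hd : Pairwise (Function.onFun Disjoint A)) (hk : k ∈ stdSimplex ℝ U)
    (hkA : ∀ u, ν.real (A u) = 0 → k u = 0) (u : U) :
    cellMix ν A k (A u) = ENNReal.ofReal (k u) := by
  rw [cellMix, withDensity_apply _ (hA u)]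
  have h1 : ∫⁻ x in A u, ENNReal.ofReal (∑ u, (A u).indicator (fun _ => k u / ν.real (A u)) x) ∂ν =
      ∫⁻ _ in A u, ENNReal.ofReal (k u / ν.real (A u)) ∂ν := by
    refine setLIntegral_congr_fun (hA u) fun x hx => ?_
    rw [(cellMix_density_props hd hk).2.2 u x hx]
  rw [h1, setLIntegral_const]
  by_cases h : ν.real (A u) = 0
  · rw [hkA u h]; simp
  · have : ν (A u) = ENNReal.ofReal (ν.real (A u)) := by simp
    rw [this, ← ENNReal.ofReal_mul (div_nonneg (hk.1 u) measureReal_nonneg), div_mul_cancel₀ _ h]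

lemma integral_cellMix_density [IsProbabilityMeasure ν] (hA : ∀ u, MeasurableSet (A u))
    (hk : k ∈ stdSimplex ℝ U) (hkA : ∀ u, ν.real (A u) = 0 → k u = 0) :
    ∫ x, ∑ u, (A u).indicator (fun _ => k u / ν.real (A u)) x ∂ν = 1 := by
  rw [integral_finsetSum _ fun u _ => (integrable_const _).indicator (hA u)]
  simp only [integral_indicator_const _ (hA _), smul_eq_mul]
  rw [← hk.2]
  refine Finset.sum_congr rfl fun u _ => ?_
  by_cases h : ν.real (A u) = 0
  · rw [h, hkA u h, zero_mul]
  · rw [mul_div_cancel₀ _ h]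

lemma isProbabilityMeasure_cellMix [IsProbabilityMeasure ν] (hA : ∀ u, MeasurableSet (A u))
    (hd : Pairwise (Function.onFun Disjoint A)) (hk : k ∈ stdSimplex ℝ U)
    (hkA : ∀ u, ν.real (A u) = 0 → k u = 0) :
    IsProbabilityMeasure (cellMix ν A k) := by
  refine ⟨?_⟩
  rw [cellMix, withDensity_apply _ MeasurableSet.univ, Measure.restrict_univ,
    ← ofReal_integral_eq_lintegral_ofReal, integral_cellMix_density hA hk hkA,
    ENNReal.ofReal_one]
  · exact integrable_finsetSum _ fun u _ => (integrable_const _).indicator (hA u)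
  · exact ae_of_all _ (cellMix_density_props hd hk).1

/-- The density is constant on every cell, so the entropy integral collapses to a finite sum; null
cells have weight zero. -/
lemma klDiv_cellMix [IsProbabilityMeasure ν] (hA : ∀ u, MeasurableSet (A u))
    (hd : Pairwise (Function.onFun Disjoint A)) (hk : k ∈ stdSimplex ℝ U)
    (hkA : ∀ u, ν.real (A u) = 0 → k u = 0) :
    klDiv (cellMix ν A k) ν = ENNReal.ofReal (finDiv k fun u => ν.real (A u)) := by
  obtain ⟨h0, h1, h2⟩ := cellMix_density_props (ν := ν) hd hk
  rw [cellMix, klDiv_withDensity (measurable_cellMix_density hA) h0 h1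
    (integral_cellMix_density hA hk hkA)]
  congr 1
  have e : (fun x => (∑ u, (A u).indicator (fun _ => k u / ν.real (A u)) x) *
      Real.log (∑ u, (A u).indicator (fun _ => k u / ν.real (A u)) x)) =
      fun x => ∑ u, (A u).indicator (fun _ => k u / ν.real (A u) *
        Real.log (k u / ν.real (A u))) x := by
    funext x
    by_cases hx : ∃ u, x ∈ A u
    · obtain ⟨u, hu⟩ := hx
      rw [h2 u x hu, Finset.sum_eq_single u]
      · rw [Set.indicator_of_mem hu]
      · intro w _ hw
        exact Set.indicator_of_notMem (fun h => Set.disjoint_left.1 (hd hw) h hu) _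
      · simp
    · push Not at hx
      rw [Finset.sum_eq_zero fun u _ => Set.indicator_of_notMem (hx u) _, zero_mul,
        Finset.sum_eq_zero fun u _ => Set.indicator_of_notMem (hx u) _]
  rw [e, integral_finsetSum _ fun u _ => (integrable_const _).indicator (hA u)]
  simp only [integral_indicator_const _ (hA _), smul_eq_mul]
  refine Finset.sum_congr rfl fun u _ => ?_
  by_cases h : ν.real (A u) = 0
  · rw [hkA u h]; simp
  · field_simp

lemma cellMix_compl_iUnion [IsProbabilityMeasure ν] (hA : ∀ u, MeasurableSet (A u))
    (hd : Pairwise (Function.onFun Disjoint A)) (hk : k ∈ stdSimplex ℝ U)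
    (hkA : ∀ u, ν.real (A u) = 0 → k u = 0) :
    cellMix ν A k (⋃ u, A u)ᶜ = 0 := by
  have := isProbabilityMeasure_cellMix hA hd hk hkA
  rw [prob_compl_eq_zero_iff (MeasurableSet.iUnion hA), measure_iUnion hd hA]
  simp only [cellMix_apply_cell hA hd hk hkA]
  rw [tsum_fintype, ← ENNReal.ofReal_sum_of_nonneg fun u _ => hk.1 u, hk.2, ENNReal.ofReal_one]

end CellMix

end Partition

end

end ThickIsoperimetry

namespace ThickIsoperimetry

noncomputable section

/-! ### From a bound on `psi` to the single-letter bound for a partition -/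

section Upper

open InformationTheory

lemma coe_distCost {X : Type*} [MetricSpace X] (p : ℝ) (x y : X) :
    (distCost X p x y : ℝ) = dist x y ^ p := by
  simp [distCost]

lemma coe_distCost_ennreal {X : Type*} [MetricSpace X] (p : ℝ) (x y : X) :
    (distCost X p x y : ℝ≥0∞) = ENNReal.ofReal (dist x y ^ p) := by
  rw [← coe_distCost, ENNReal.ofReal_coe_nnreal]

/-- Donsker–Varadhan for `r` times the indicator of one letter. It bounds the weight of a letter of
exponentially small `P`-probability by the relative entropy, which is how the far cell of the
partition is handled. -/
lemma mul_le_finDiv_add {U : Type*} [Fintype U] {P k : U → ℝ} (hP : P ∈ stdSimplex ℝ U)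
    (hk : k ∈ supportedSimplex P) (u₀ : U) (r : ℝ) :
    r * k u₀ ≤ finDiv k P + P u₀ * Real.exp r := by
  classical
  have key : ∀ u, ∀ r : ℝ, r * k u + k u - P u * Real.exp r ≤ k u * Real.log (k u / P u) := by
    intro u r
    rcases (hk.1.1 u).eq_or_lt with h | h
    · rw [← h]; simp only [mul_zero, zero_mul]
      have := mul_nonneg (hP.1 u) (Real.exp_pos r).le
      linarith
    · have hPp : 0 < P u := lt_of_le_of_ne (hP.1 u) fun h' => h.ne' (hk.2 u h'.symm)
      have h1 := Real.log_le_sub_one_of_pos (div_pos (mul_pos hPp (Real.exp_pos r)) h)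
      rw [Real.log_div (by positivity) h.ne', Real.log_mul hPp.ne' (Real.exp_pos r).ne',
        Real.log_exp] at h1
      rw [Real.log_div h.ne' hPp.ne']
      have h3 := mul_le_mul_of_nonneg_left h1 h.le
      have h4 : k u * (P u * Real.exp r / k u - 1) = P u * Real.exp r - k u := by field_simp
      nlinarith
  have h1 : ∑ u, ((if u = u₀ then r else 0) * k u + k u -
      P u * Real.exp (if u = u₀ then r else 0)) ≤ finDiv k P :=
    Finset.sum_le_sum fun u _ => key u _
  have h2 : ∑ u, ((if u = u₀ then r else 0) * k u + k u -
      P u * Real.exp (if u = u₀ then r else 0)) =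
      r * k u₀ + 1 - ∑ u, P u * Real.exp (if u = u₀ then r else 0) := by
    rw [Finset.sum_sub_distrib, Finset.sum_add_distrib, hk.1.2]
    simp
  have h3 : ∑ u, P u * Real.exp (if u = u₀ then r else 0) ≤ 1 + P u₀ * Real.exp r := by
    calc ∑ u, P u * Real.exp (if u = u₀ then r else 0)
        ≤ ∑ u, (P u + if u = u₀ then P u * Real.exp r else 0) := by
          refine Finset.sum_le_sum fun u _ => ?_
          split_ifs
          · linarith [hP.1 u]
          · simp
      _ = _ := by rw [Finset.sum_add_distrib, hP.2]; simp
  linarith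

lemma finDiv_self {U : Type*} [Fintype U] (P : U → ℝ) : finDiv P P = 0 := by
  refine Finset.sum_eq_zero fun u _ => ?_
  by_cases h : P u = 0
  · simp [h]
  · rw [div_self h, Real.log_one, mul_zero]

/-- Pays for shrinking the cells to compact subsets: a loss of a factor `exp (-s)` in reference mass
raises each logarithm by at most `s`. -/
lemma finDiv_le_of_exp_mul_le {U : Type*} [Fintype U] {k P Q : U → ℝ} {s : ℝ}
    (hk : k ∈ supportedSimplex P) (hP : ∀ u, 0 ≤ P u) (hQ : ∀ u, P u * Real.exp (-s) ≤ Q u) :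
    finDiv k Q ≤ finDiv k P + s := by
  have : finDiv k Q ≤ ∑ u, (k u * Real.log (k u / P u) + k u * s) := by
    refine Finset.sum_le_sum fun u _ => ?_
    rcases (hk.1.1 u).eq_or_lt with h | h
    · rw [← h]; simp
    · have hPp : 0 < P u := lt_of_le_of_ne (hP u) fun h' => h.ne' (hk.2 u h'.symm)
      have hQp : 0 < Q u := (mul_pos hPp (Real.exp_pos _)).trans_le (hQ u)
      have h1 := Real.log_le_log (mul_pos hPp (Real.exp_pos _)) (hQ u)
      rw [Real.log_mul hPp.ne' (Real.exp_pos _).ne', Real.log_exp] at h1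
      rw [← mul_add, Real.log_div h.ne' hPp.ne', Real.log_div h.ne' hQp.ne']
      exact mul_le_mul_of_nonneg_left (by linarith) h.le
  rw [Finset.sum_add_distrib, ← Finset.sum_mul, hk.1.2, one_mul] at this
  exact this

variable {X : Type*} [MetricSpace X] [SecondCountableTopology X]
    [MeasurableSpace X] [BorelSpace X]

/-- A law concentrated on a ball has a reachable pair. -/
lemma exists_reach_of_bounded {p : ℝ} (hp : 1 ≤ p) (x₀ : X) (R : ℝ) (νY : Measure X)
    [IsProbabilityMeasure νY] (κ : Measure X) [IsProbabilityMeasure κ]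
    (hκ : κ (Metric.closedBall x₀ R)ᶜ = 0) : ∃ u v, Reach (distCost X p) νY κ u v := by
  obtain ⟨n, hn⟩ : ∃ n : ℕ, 0 < νY.real (Metric.closedBall x₀ n) := by
    by_contra! h
    have h0 : ∀ n : ℕ, νY (Metric.closedBall x₀ n) = 0 := fun n =>
      (measureReal_eq_zero_iff).1 (le_antisymm (h n) measureReal_nonneg)
    have h1 := measure_iUnion_null h0
    rw [Metric.iUnion_closedBall_nat] at h1
    simp at h1
  -- The witness is `νY` conditioned on a ball of positive mass. Its density is bounded, and the
  -- product coupling with a bounded law has bounded cost.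
  set A : Unit → Set X := fun _ => Metric.closedBall x₀ n
  have hA : ∀ u, MeasurableSet (A u) := fun _ => Metric.isClosed_closedBall.measurableSet
  have hd : Pairwise (Function.onFun Disjoint A) := fun u v h => absurd (Subsingleton.elim u v) h
  have hk : (fun _ : Unit => (1 : ℝ)) ∈ stdSimplex ℝ Unit := ⟨fun _ => zero_le_one, by simp⟩
  have hkA : ∀ u, νY.real (A u) = 0 → (fun _ : Unit => (1 : ℝ)) u = 0 := fun u h => absurd h hn.ne'
  have hη := isProbabilityMeasure_cellMix hA hd hk hkA
  set η := cellMix νY A (fun _ => 1) with hηdef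
  have hη0 : η (Metric.closedBall x₀ n)ᶜ = 0 := by
    have := cellMix_compl_iUnion hA hd hk hkA
    rwa [Set.iUnion_const] at this
  have hcost : transportCost (distCost X p) κ η ≤ ENNReal.ofReal ((|R| + n) ^ p) := by
    refine (transportCost_le (κ.prod η) (by simp) (by simp)).trans ?_
    have h1 : ∀ᵐ z ∂κ.prod η, (distCost X p z.1 z.2 : ℝ≥0∞) ≤ ENNReal.ofReal ((|R| + n) ^ p) := by
      have h2 : ∀ᵐ z ∂κ.prod η, z.1 ∈ Metric.closedBall x₀ R :=
        Measure.quasiMeasurePreserving_fst.ae (mem_ae_iff.2 hκ)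
      have h3 : ∀ᵐ z ∂κ.prod η, z.2 ∈ Metric.closedBall x₀ n :=
        Measure.quasiMeasurePreserving_snd.ae (mem_ae_iff.2 hη0)
      filter_upwards [h2, h3] with z hz1 hz2
      rw [coe_distCost_ennreal]
      refine ENNReal.ofReal_le_ofReal (Real.rpow_le_rpow dist_nonneg ?_ (by linarith))
      rw [Metric.mem_closedBall] at hz1 hz2
      calc dist z.1 z.2 ≤ dist z.1 x₀ + dist z.2 x₀ := dist_triangle_right _ _ _
        _ ≤ _ := add_le_add (hz1.trans (le_abs_self R)) hz2
    refine (lintegral_mono_ae h1).trans ?_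
    simp
  refine ⟨(klDiv η νY).toReal, (|R| + n) ^ p, ENNReal.toReal_nonneg, by positivity, η, hη, ?_,
    hcost⟩
  rw [hηdef, klDiv_cellMix hA hd hk hkA, ENNReal.ofReal_toReal ENNReal.ofReal_ne_top]

/-- The bound on `psi` gives the single-letter bound for a finite partition of the space. -/
lemma singleLetter_of_psi [CompleteSpace X] {U : Type*} [Fintype U] [MeasurableSpace U]
    [DiscreteMeasurableSpace U]
    {p : ℝ} (hp : 1 ≤ p) {νX νY : Measure X} [IsProbabilityMeasure νX] [IsProbabilityMeasure νY]
    {x₀ : X} {R : ℝ} (hR : νX (Metric.closedBall x₀ R)ᶜ = 0) {f : X → U} (hf : Measurable f)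
    {c : U → X → ℝ} (hcm : ∀ u, Measurable (c u))
    {K : U → ℝ} (hK : ∀ u, 0 ≤ K u) {σ ρ : ℝ} (hσ : 0 < σ) (hσ1 : σ < 1)
    (hcd : ∀ x ∈ Metric.closedBall x₀ R, ∀ y,
      c (f x) y ≤ (1 + σ) ^ 2 * dist x y ^ p + 3 * K (f x))
    (hρ : 0 ≤ ρ) (hKavg : ∀ k ∈ supportedSimplex (fun u => νX.real (f ⁻¹' {u})),
      ∑ u, k u * K u ≤ σ + ρ * (finDiv k (fun u => νX.real (f ⁻¹' {u})) + 1))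
    {α t' t B : ℝ} (hα : 0 < α) (ht' : 0 ≤ t') (htt : t' < t) (hB : 0 ≤ B)
    (hψ : psi (distCost X p) νX νY α t' ≤ ENNReal.ofReal B) :
    SingleLetter (fun u => νX.real (f ⁻¹' {u})) νY c (α + σ * α / 2)
      ((1 + σ) ^ 2 * (t / (1 - σ) + σ) + 3 * (σ + ρ * (α + σ * α / 2 + 1)))
      ((B + σ) / (1 - σ)) := by
  classical
  set P : U → ℝ := fun u => νX.real (f ⁻¹' {u}) with hPdef
  have hfm : ∀ u, MeasurableSet (f ⁻¹' {u}) := fun u => hf (measurableSet_singleton u)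
  have hfd : Pairwise (Function.onFun Disjoint fun u => f ⁻¹' {u}) := by
    intro u v huv
    rw [Function.onFun, Set.disjoint_left]
    intro x hx hx'
    exact huv (hx.symm.trans hx')
  have hfU : (⋃ u, f ⁻¹' {u}) = Set.univ := Set.eq_univ_of_forall fun x =>
    Set.mem_iUnion.2 ⟨f x, rfl⟩
  have hP : P ∈ stdSimplex ℝ U := ⟨fun u => measureReal_nonneg, by
    simp only [hPdef]
    rw [← measureReal_iUnion_fintype hfd hfm, hfU]; simp⟩
  set G := Metric.closedBall x₀ R with hG
  have hGm : MeasurableSet G := Metric.isClosed_closedBall.measurableSet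
  -- Inner regularity: each cell contains a compact set carrying almost all its mass. Mixtures over
  -- these sets are concentrated on a compact set, as `psi` demands.
  have hex : ∀ u, ∃ A : Set X, A ⊆ f ⁻¹' {u} ∩ G ∧ IsCompact A ∧
      P u * Real.exp (-(σ * α / 2)) ≤ νX.real A := by
    intro u
    rcases (hP.1 u).eq_or_lt with h | h
    · exact ⟨∅, Set.empty_subset _, isCompact_empty, by rw [← h]; simp⟩
    · have h1 : νX (f ⁻¹' {u} ∩ G) = ENNReal.ofReal (P u) := by
        rw [measure_inter_conull hR]; simp [hPdef]
      have h2 : ENNReal.ofReal (P u * Real.exp (-(σ * α / 2))) < νX (f ⁻¹' {u} ∩ G) := by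
        rw [h1, ENNReal.ofReal_lt_ofReal_iff h]
        refine mul_lt_of_lt_one_right h ?_
        rw [← Real.exp_zero]
        exact Real.exp_lt_exp.2 (by have := mul_pos hσ hα; linarith)
      obtain ⟨A, hA1, hA2, hA3⟩ := ((hfm u).inter hGm).exists_lt_isCompact_of_ne_top
        (measure_ne_top _ _) h2
      refine ⟨A, hA1, hA2, ?_⟩
      rw [measureReal_def]
      exact (ENNReal.ofReal_le_iff_le_toReal (measure_ne_top _ _)).1 hA3.le
  choose A hAsub hAc hAP using hex
  have hAm : ∀ u, MeasurableSet (A u) := fun u => (hAc u).measurableSet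
  have hAd : Pairwise (Function.onFun Disjoint A) := fun u v huv =>
    (hfd huv).mono ((hAsub u).trans Set.inter_subset_left) ((hAsub v).trans Set.inter_subset_left)
  have hkA : ∀ k ∈ supportedSimplex P, ∀ u, νX.real (A u) = 0 → k u = 0 := by
    intro k hk u hu
    refine hk.2 u (le_antisymm ?_ (hP.1 u))
    have := hAP u
    rw [hu] at this
    by_contra! hpos
    exact absurd this (not_le.2 (mul_pos hpos (Real.exp_pos _)))
  intro m T k hT hT1 hk hTα
  have hσ1' : 0 < 1 - σ := by linarith
  -- The law `P` is added with weight `σ`. Its relative entropy before compact shrinking is zero, so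
  -- it dilutes the average entropy: with the shrinking loss included the total is at most `(1 - σ)
  -- (1 + σ) α + σ² α / 2 ≤ α`.
  set k' : Fin (m + 1) → U → ℝ := Fin.cons P k with hk'
  have hk's : ∀ j, k' j ∈ supportedSimplex P := by
    intro j
    refine Fin.cases ?_ (fun j => ?_) j
    · exact ⟨hP, fun _ h => h⟩
    · exact hk j
  set T' : Fin (m + 1) → ℝ := Fin.cons σ (fun j => (1 - σ) * T j) with hT'
  have hT'0 : ∀ j, 0 < T' j := by
    intro j
    refine Fin.cases ?_ (fun j => ?_) j
    · exact hσ
    · exact mul_pos hσ1' (hT j)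
  have hsum : ∀ g : Fin (m + 1) → ℝ, ∑ j, T' j * g j =
      σ * g 0 + (1 - σ) * ∑ j, T j * g j.succ := by
    intro g
    rw [Fin.sum_univ_succ, Finset.mul_sum]
    simp only [hT', Fin.cons_zero, Fin.cons_succ, mul_assoc]
  have hT'1 : ∑ j, T' j = 1 := by
    have := hsum fun _ => 1
    simp only [mul_one, hT1] at this
    rw [this]; ring
  have hprob : ∀ j, IsProbabilityMeasure (cellMix νX A (k' j)) := fun j =>
    isProbabilityMeasure_cellMix hAm hAd (hk's j).1 (hkA _ (hk's j))
  have hball : ∀ j, cellMix νX A (k' j) Gᶜ = 0 := fun j =>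
    measure_mono_null (Set.compl_subset_compl.2 (Set.iUnion_subset fun u =>
      (hAsub u).trans Set.inter_subset_right))
      (cellMix_compl_iUnion hAm hAd (hk's j).1 (hkA _ (hk's j)))
  have hconc : ∀ j, ConcentratedOnCompact (cellMix νX A (k' j)) := fun j =>
    ⟨⋃ u, A u, isCompact_iUnion hAc, cellMix_compl_iUnion hAm hAd (hk's j).1 (hkA _ (hk's j))⟩
  set d' : Fin (m + 1) → ℝ := fun j => finDiv (k' j) P + σ * α / 2 with hd'
  have hfd0 : ∀ j, 0 ≤ finDiv (k' j) P := fun j =>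
    finDiv_nonneg (hk's j).1.1 (hk's j).1.2 hP.1 hP.2.le (hk's j).2
  have hd'0 : ∀ j, 0 ≤ d' j := fun j => add_nonneg (hfd0 j) (by positivity)
  have hkl : ∀ j, klDiv (cellMix νX A (k' j)) νX ≤ ENNReal.ofReal (d' j) := by
    intro j
    rw [klDiv_cellMix hAm hAd (hk's j).1 (hkA _ (hk's j))]
    exact ENNReal.ofReal_le_ofReal (finDiv_le_of_exp_mul_le (hk's j) hP.1 hAP)
  have hTd : ∑ j, T' j * d' j ≤ α := by
    rw [hsum]
    have h1 : ∑ j, T j * d' j.succ = ∑ j, T j * finDiv (k j) P + σ * α / 2 := by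
      simp only [hd', hk', Fin.cons_succ, mul_add, Finset.sum_add_distrib, ← Finset.sum_mul, hT1,
        one_mul]
    have h2 : d' 0 = σ * α / 2 := by
      simp only [hd', hk', Fin.cons_zero, finDiv_self, zero_add]
    rw [h1, h2]
    have h3 : (1 - σ) * (∑ j, T j * finDiv (k j) P + σ * α / 2) ≤
        (1 - σ) * (α + σ * α / 2 + σ * α / 2) :=
      mul_le_mul_of_nonneg_left (by linarith) hσ1'.le
    nlinarith [mul_pos hσ hα, mul_pos (mul_pos hσ hσ) hα]
  obtain ⟨u, v, huv, hu, hv⟩ := exists_reach_family hT'0 hT'1 hprob hconc hd'0 hkl hTd ht' htt hB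
    hψ hσ (fun j => exists_reach_of_bounded hp x₀ R νY _ (hball j))
  have hcpl : ∀ j : Fin m, ∃ π : Measure (X × X), π.fst = cellMix νX A (k j) ∧
      klDiv π.snd νY ≤ ENNReal.ofReal (u j.succ) ∧ IsProbabilityMeasure π ∧
      ∫⁻ z, (distCost X p z.1 z.2 : ℝ≥0∞) ∂π ≤ ENNReal.ofReal (v j.succ + σ) := by
    intro j
    obtain ⟨h1, h2, η, hη, h3, h4⟩ := huv j.succ
    obtain ⟨π, e1, e2, e3⟩ := exists_coupling_of_transportCost_lt (r := ENNReal.ofReal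
      (v j.succ + σ)) (h4.trans_lt ((ENNReal.ofReal_lt_ofReal_iff (by linarith)).2 (by linarith)))
    refine ⟨π, e1, by rwa [e2], ⟨?_⟩, e3.le⟩
    rw [← Measure.snd_univ, e2, measure_univ]
  choose π hπ1 hπ2 hπ3 hπ4 using hcpl
  -- The compact subset already gives the cell at least the mass `k j w`; both families of masses
  -- sum to one, so equality holds.
  have hcellk : ∀ j w, cellMix νX A (k j) (f ⁻¹' {w}) = ENNReal.ofReal (k j w) := by
    intro j w
    have hpj : IsProbabilityMeasure (cellMix νX A (k j)) := hprob j.succ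
    have h1 : ∀ w, k j w ≤ (cellMix νX A (k j)).real (f ⁻¹' {w}) := by
      intro w
      have h2 : (cellMix νX A (k j)).real (A w) = k j w := by
        rw [measureReal_def, cellMix_apply_cell hAm hAd (hk j).1 (hkA _ (hk j)),
          ENNReal.toReal_ofReal ((hk j).1.1 w)]
      rw [← h2]
      exact measureReal_mono ((hAsub w).trans Set.inter_subset_left)
    have h2 : ∑ w, k j w = ∑ w, (cellMix νX A (k j)).real (f ⁻¹' {w}) := by
      rw [← measureReal_iUnion_fintype hfd hfm, hfU, (hk j).1.2]; simp
    have h3 := (Finset.sum_eq_sum_iff_of_le fun w _ => h1 w).1 h2 w (Finset.mem_univ w)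
    rw [h3, measureReal_def, ENNReal.ofReal_toReal (measure_ne_top _ _)]
  have hmap : Measurable (Prod.map f (id : X → X)) := hf.prodMap measurable_id
  -- The couplings are pushed to pairs of a cell and a point. By `hcd` the discretized cost is the
  -- transport cost up to a factor and the radius terms `K`, whose average is controlled by `hKavg`.
  refine ⟨fun j => (π j).map (Prod.map f id), fun j => (1 + σ) ^ 2 * (v j.succ + σ) +
    3 * ∑ w, k j w * K w, fun j => u j.succ, fun j => ?_, fun j w => ?_, fun j => ?_, fun j => ?_,
    fun j => ?_, fun j => ?_, ?_, ?_⟩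
  · have := hπ3 j
    exact Measure.isProbabilityMeasure_map hmap.aemeasurable
  · rw [measureReal_def, Measure.map_apply hmap (measurable_fst (measurableSet_singleton w))]
    have e : Prod.map f (id : X → X) ⁻¹' (Prod.fst ⁻¹' {w}) = Prod.fst ⁻¹' (f ⁻¹' {w}) := by
      ext z; simp
    rw [e, ← Measure.fst_apply (hfm w), hπ1, hcellk, ENNReal.toReal_ofReal ((hk j).1.1 w)]
  · have h1 := (huv j.succ).2.1
    have h2 : 0 ≤ ∑ w, k j w * K w := Finset.sum_nonneg fun w _ => mul_nonneg ((hk j).1.1 w) (hK w)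
    positivity
  · exact (huv j.succ).1
  · have hpj := hπ3 j
    have hcm' : Measurable fun z : U × X => ENNReal.ofReal (c z.1 z.2) :=
      (measurable_from_prod_countable_right hcm).ennreal_ofReal
    rw [lintegral_map hcm' hmap]
    have hae : ∀ᵐ z ∂π j, z.1 ∈ G := by
      have : π j (Prod.fst ⁻¹' Gᶜ) = 0 := by
        rw [← Measure.fst_apply hGm.compl, hπ1]; exact hball j.succ
      exact mem_ae_iff.2 this
    have h1 : ∫⁻ z, ENNReal.ofReal (c (Prod.map f id z).1 (Prod.map f (id : X → X) z).2) ∂π j ≤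
        ∫⁻ z, (ENNReal.ofReal ((1 + σ) ^ 2) * (distCost X p z.1 z.2 : ℝ≥0∞) +
          ENNReal.ofReal (3 * K (f z.1))) ∂π j := by
      refine lintegral_mono_ae ?_
      filter_upwards [hae] with z hz
      rw [coe_distCost_ennreal, ← ENNReal.ofReal_mul (by positivity),
        ← ENNReal.ofReal_add (by positivity) (by have := hK (f z.1); positivity)]
      exact ENNReal.ofReal_le_ofReal (hcd z.1 hz z.2)
    have hKm : Measurable fun w : U => ENNReal.ofReal (3 * K w) := Measurable.of_discrete
    have hKf : Measurable fun x : X => ENNReal.ofReal (3 * K (f x)) := hKm.comp hf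
    have hKf' : Measurable fun z : X × X => ENNReal.ofReal (3 * K (f z.1)) :=
      hKf.comp measurable_fst
    have h2 : ∫⁻ z, ENNReal.ofReal (3 * K (f z.1)) ∂π j =
        ENNReal.ofReal (3 * ∑ w, k j w * K w) := by
      have e1 : ∫⁻ z, ENNReal.ofReal (3 * K (f z.1)) ∂π j =
          ∫⁻ w, ENNReal.ofReal (3 * K w) ∂((π j).fst.map f) := by
        rw [lintegral_map hKm hf, Measure.fst, lintegral_map hKf measurable_fst]
      rw [e1, hπ1, lintegral_fintype, Finset.mul_sum, ENNReal.ofReal_sum_of_nonneg]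
      · refine Finset.sum_congr rfl fun w _ => ?_
        rw [Measure.map_apply hf (measurableSet_singleton w), hcellk, ← ENNReal.ofReal_mul
          (by have := hK w; positivity)]
        congr 1; ring
      · intro w _
        have := hK w
        have := (hk j).1.1 w
        positivity
    have h3 : ∫⁻ z, (ENNReal.ofReal ((1 + σ) ^ 2) * (distCost X p z.1 z.2 : ℝ≥0∞) +
          ENNReal.ofReal (3 * K (f z.1))) ∂π j =
        ENNReal.ofReal ((1 + σ) ^ 2) * ∫⁻ z, (distCost X p z.1 z.2 : ℝ≥0∞) ∂π j +
          ENNReal.ofReal (3 * ∑ w, k j w * K w) := by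
      rw [lintegral_add_right _ hKf', h2,
        lintegral_const_mul' _ _ ENNReal.ofReal_ne_top]
    refine h1.trans ?_
    rw [h3]
    have hv0 := (huv j.succ).2.1
    have hs0 : 0 ≤ ∑ w, k j w * K w := Finset.sum_nonneg fun w _ =>
      mul_nonneg ((hk j).1.1 w) (hK w)
    rw [ENNReal.ofReal_add (by positivity) (by positivity),
      ENNReal.ofReal_mul (p := (1 + σ) ^ 2) (by positivity)]
    gcongr
    exact hπ4 j
  · have : ((π j).map (Prod.map f id)).snd = (π j).snd := by
      rw [Measure.snd, Measure.map_map measurable_snd hmap]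
      rfl
    rw [this]
    exact hπ2 j
  -- Discarding the auxiliary law drops a nonnegative term and costs the factor `1 / (1 - σ)`.
  · rw [hsum] at hv
    have hv00 : 0 ≤ σ * v 0 := mul_nonneg hσ.le (huv 0).2.1
    have h1 : ∑ j, T j * v j.succ ≤ t / (1 - σ) := by
      rw [le_div_iff₀ hσ1']; linarith
    have h2 : ∑ j, T j * ∑ w, k j w * K w ≤ σ + ρ * (α + σ * α / 2 + 1) := by
      calc ∑ j, T j * ∑ w, k j w * K w ≤ ∑ j, T j * (σ + ρ * (finDiv (k j) P + 1)) :=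
            Finset.sum_le_sum fun j _ => mul_le_mul_of_nonneg_left (hKavg _ (hk j)) (hT j).le
        _ = σ + ρ * (∑ j, T j * finDiv (k j) P + 1) := by
            have : ∀ j, T j * (σ + ρ * (finDiv (k j) P + 1)) =
                (σ + ρ) * T j + ρ * (T j * finDiv (k j) P) := fun j => by ring
            simp only [this, Finset.sum_add_distrib, ← Finset.mul_sum, hT1]
            ring
        _ ≤ _ := by gcongr
    calc ∑ j, T j * ((1 + σ) ^ 2 * (v j.succ + σ) + 3 * ∑ w, k j w * K w)
        = (1 + σ) ^ 2 * (∑ j, T j * v j.succ + σ) + 3 * ∑ j, T j * ∑ w, k j w * K w := by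
          have : ∀ j, T j * ((1 + σ) ^ 2 * (v j.succ + σ) + 3 * ∑ w, k j w * K w) =
              (1 + σ) ^ 2 * (T j * v j.succ) + (1 + σ) ^ 2 * σ * T j +
                3 * (T j * ∑ w, k j w * K w) := fun j => by ring
          simp only [this, Finset.sum_add_distrib, ← Finset.mul_sum, hT1]
          ring
      _ ≤ _ := by gcongr
  · rw [hsum] at hu
    have hu00 : 0 ≤ σ * u 0 := mul_nonneg hσ.le (huv 0).1
    rw [le_div_iff₀ hσ1']
    linarith

end Upper

end

end ThickIsoperimetry

namespace ThickIsoperimetry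

noncomputable section

/-! ### Upper bound on the exponent -/

section UpperBound

open InformationTheory

/-- The probability of a set of sequences is at most that of the union of the cells it meets. -/
lemma pi_le_sum_cells {X U : Type*} [MeasurableSpace X] [Fintype U] [MeasurableSpace U] [DiscreteMeasurableSpace U]
    {ν : Measure X} [IsProbabilityMeasure ν] {f : X → U} (hf : Measurable f) {G : Set X}
    (hG : ν Gᶜ = 0) (n : ℕ) (A : Set (Fin n → X)) :
    Measure.pi (fun _ : Fin n => ν) A ≤ ENNReal.ofReal (∑ u,
      {u : Fin n → U | ∃ x ∈ A, (∀ i, x i ∈ G) ∧ ∀ i, f (x i) = u i}.indicator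
        (fun u => ∏ i, ν.real (f ⁻¹' {u i})) u) := by
  rw [← pi_iUnion_cells (A := fun u => f ⁻¹' {u}) (fun u => hf (measurableSet_singleton u))]
  · have hae : ∀ᵐ x ∂Measure.pi (fun _ : Fin n => ν), ∀ i, x i ∈ G := by
      rw [ae_all_iff]
      intro i
      exact (Measure.quasiMeasurePreserving_eval (fun _ : Fin n => ν) i).ae (mem_ae_iff.2 hG)
    refine measure_mono_ae ?_
    filter_upwards [hae] with x hx hxA
    exact Set.mem_iUnion₂.2 ⟨fun i => f (x i), ⟨x, hxA, hx, fun _ => rfl⟩, fun i _ => rfl⟩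
  · intro u v huv
    rw [Function.onFun, Set.disjoint_left]
    intro x hx hx'
    exact huv (hx.symm.trans hx')

variable {X : Type*} [MetricSpace X] [SecondCountableTopology X] [MeasurableSpace X]
  [BorelSpace X]

/-- The upper bound on the isoperimetric exponent. -/
theorem isoFun_ge [CompleteSpace X] {p : ℝ} (hp : 1 ≤ p) {νX νY : Measure X}
    [IsProbabilityMeasure νX] [IsProbabilityMeasure νY] {x₀ : X} {R : ℝ}
    (hR : νX (Metric.closedBall x₀ R)ᶜ = 0) {α t τ B ε : ℝ} (hα : 0 < α) (ht : 0 ≤ t)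
    (htτ : t < τ) (hB : 0 ≤ B) (hε : 0 < ε)
    (hψ : psi (distCost X p) νX νY α t ≤ ENNReal.ofReal B) :
    ∃ n₀ : ℕ, ∀ n ≥ n₀, ENNReal.ofReal (Real.exp (-(n * (B + ε)))) ≤
      isoFun (distCost X p) νX νY n (Real.exp (-(n * α))) (n * τ) := by
  classical
  obtain ⟨σ, hσ, hσ1, hστ, hσB⟩ : ∃ σ : ℝ, 0 < σ ∧ σ < 1 ∧
      (1 + σ) ^ 2 * ((t + σ) / (1 - σ) + σ) + 3 * (σ + σ) < τ ∧
      (B + σ) / (1 - σ) < B + ε / 2 := by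
    have h1 : ∀ᶠ σ : ℝ in 𝓝[>] 0,
        (1 + σ) ^ 2 * ((t + σ) / (1 - σ) + σ) + 3 * (σ + σ) < τ := by
      have hc : ContinuousAt (fun σ : ℝ =>
          (1 + σ) ^ 2 * ((t + σ) / (1 - σ) + σ) + 3 * (σ + σ)) 0 := by
        have : ContinuousAt (fun σ : ℝ => (t + σ) / (1 - σ)) 0 :=
          ContinuousAt.div (by fun_prop) (by fun_prop) (by norm_num)
        fun_prop
      exact (hc.eventually (gt_mem_nhds (by simpa using htτ))).filter_mono nhdsWithin_le_nhds
    have h2 : ∀ᶠ σ : ℝ in 𝓝[>] 0, (B + σ) / (1 - σ) < B + ε / 2 := by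
      have hc : ContinuousAt (fun σ : ℝ => (B + σ) / (1 - σ)) 0 :=
        ContinuousAt.div (by fun_prop) (by fun_prop) (by norm_num)
      exact (hc.eventually (gt_mem_nhds (by simp [hε]))).filter_mono nhdsWithin_le_nhds
    have h3 : ∀ᶠ σ : ℝ in 𝓝[>] 0, σ < 1 :=
      Filter.Eventually.filter_mono nhdsWithin_le_nhds (gt_mem_nhds one_pos)
    have h4 : ∀ᶠ σ : ℝ in 𝓝[>] 0, 0 < σ := self_mem_nhdsWithin
    obtain ⟨σ, h⟩ := (h4.and (h3.and (h1.and h2))).exists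
    exact ⟨σ, h.1, h.2.1, h.2.2.1, h.2.2.2⟩
  obtain ⟨L, hL, hLp⟩ := exists_add_rpow_le hp hσ
  set R' : ℝ := |R| with hR'
  set α₁ := α + σ * α / 2 with hα₁
  have hαα : α < α₁ := by rw [hα₁]; have := mul_pos hσ hα; linarith
  have hα₁0 : 0 < α₁ := hα.trans hαα
  have hp0 : 0 < p := by linarith
  obtain ⟨h, hh, hLh⟩ : ∃ h : ℝ, 0 < h ∧ L * h ^ p ≤ σ := by
    refine ⟨(σ / L) ^ (1 / p), Real.rpow_pos_of_pos (by positivity) _, ?_⟩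
    rw [← Real.rpow_mul (by positivity), one_div_mul_cancel hp0.ne', Real.rpow_one,
      mul_div_cancel₀ _ hL.ne']
  set s : ℝ := (α₁ + 1) / σ with hs
  have hs0 : 0 < s := by positivity
  set KR : ℝ := L * R' ^ p with hKR
  have hKR0 : 0 ≤ KR := by positivity
  -- The complement of `E` is so unlikely that a law of bounded relative entropy gives it little
  -- mass, even after multiplication by `KR`, the error incurred there.
  obtain ⟨E, hE, hEν⟩ : ∃ E : Set X, IsCompact E ∧ νX.real Eᶜ ≤ Real.exp (-(s * KR)) := by
    have h1 : 1 - ENNReal.ofReal (Real.exp (-(s * KR))) < νX Set.univ := by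
      rw [measure_univ]
      exact ENNReal.sub_lt_self ENNReal.one_ne_top one_ne_zero
        (by simpa using Real.exp_pos (-(s * KR)))
    obtain ⟨E, -, hE, hE'⟩ := MeasurableSet.univ.exists_lt_isCompact_of_ne_top
      (measure_ne_top _ _) h1
    refine ⟨E, hE, ?_⟩
    rw [measureReal_def]
    refine ENNReal.toReal_le_of_le_ofReal (Real.exp_pos _).le ?_
    rw [prob_compl_eq_one_sub hE.measurableSet]
    exact tsub_le_iff_tsub_le.1 hE'.le
  obtain ⟨N, f, a, hf, halast, hfE, hfE'⟩ := exists_partition x₀ hE hh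
  -- Radii of the cells around their anchors: `h` for the small pieces, and the radius of the
  -- supporting ball for the far cell, whose anchor is its center.
  set r : Fin (N + 1) → ℝ := fun u => if u = Fin.last N then R' else h with hr
  have hr0 : ∀ u, 0 ≤ r u := fun u => by
    simp only [hr]; split_ifs <;> positivity
  set K : Fin (N + 1) → ℝ := fun u => L * r u ^ p with hKdef
  have hK0 : ∀ u, 0 ≤ K u := fun u => mul_nonneg hL.le (Real.rpow_nonneg (hr0 u) _)
  set c : Fin (N + 1) → X → ℝ := fun u y => (1 + σ) * dist (a u) y ^ p + K u with hc
  have hc0 : ∀ u y, 0 ≤ c u y := fun u y => add_nonneg (by positivity) (hK0 u)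
  have hcm : ∀ u, Measurable (c u) := fun u =>
    (Measurable.const_mul ((measurable_const.dist measurable_id).pow_const p) _).add_const _
  have hrad : ∀ x ∈ Metric.closedBall x₀ R, dist x (a (f x)) ≤ r (f x) := by
    intro x hx
    by_cases hxE : x ∈ E
    · simp only [hr, (hfE x hxE).1, if_false]
      exact (hfE x hxE).2
    · simp only [hr, hfE' x hxE, if_true, halast]
      exact (Metric.mem_closedBall.1 hx).trans (le_abs_self R)
  have hdc : ∀ x ∈ Metric.closedBall x₀ R, ∀ y, dist x y ^ p ≤ c (f x) y := by
    intro x hx y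
    calc dist x y ^ p ≤ (dist (a (f x)) y + r (f x)) ^ p := by
          refine Real.rpow_le_rpow dist_nonneg ?_ hp0.le
          linarith [dist_triangle x (a (f x)) y, hrad x hx]
      _ ≤ _ := hLp _ _ dist_nonneg (hr0 _)
  have hcd : ∀ x ∈ Metric.closedBall x₀ R, ∀ y,
      c (f x) y ≤ (1 + σ) ^ 2 * dist x y ^ p + 3 * K (f x) := by
    intro x hx y
    have h1 : dist (a (f x)) y ^ p ≤ (1 + σ) * dist x y ^ p + K (f x) := by
      calc dist (a (f x)) y ^ p ≤ (dist x y + r (f x)) ^ p := by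
            refine Real.rpow_le_rpow dist_nonneg ?_ hp0.le
            linarith [dist_triangle_left (a (f x)) y x, hrad x hx]
        _ ≤ _ := hLp _ _ dist_nonneg (hr0 _)
    have h2 := mul_le_mul_of_nonneg_left h1 (show 0 ≤ 1 + σ by linarith)
    have h3 : σ * K (f x) ≤ 1 * K (f x) := mul_le_mul_of_nonneg_right hσ1.le (hK0 _)
    simp only [hc]
    nlinarith
  -- Costs from different anchors are compared through the largest distance between anchors. The
  -- resulting constant may be huge, since it is used only with the parameter `δ` of `pi_image_ge`,
  -- chosen afterwards.
  set Δ : ℝ := ∑ u, ∑ u', dist (a u) (a u') with hΔ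
  have hΔ' : ∀ u u', dist (a u) (a u') ≤ Δ := fun u u' =>
    (Finset.single_le_sum (f := fun u' => dist (a u) (a u')) (fun _ _ => dist_nonneg)
      (Finset.mem_univ u')).trans
    (Finset.single_le_sum (f := fun u => ∑ u', dist (a u) (a u'))
      (fun _ _ => Finset.sum_nonneg fun _ _ => dist_nonneg) (Finset.mem_univ u))
  have hΔ0 : 0 ≤ Δ := Finset.sum_nonneg fun _ _ => Finset.sum_nonneg fun _ _ => dist_nonneg
  have hcc : ∀ u u' y, c u y ≤ ((1 + σ) * (L * Δ ^ p) + ∑ u, K u) + (1 + σ) * c u' y := by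
    intro u u' y
    have h1 : dist (a u) y ^ p ≤ (1 + σ) * dist (a u') y ^ p + L * Δ ^ p := by
      calc dist (a u) y ^ p ≤ (dist (a u') y + Δ) ^ p := by
            refine Real.rpow_le_rpow dist_nonneg ?_ hp0.le
            linarith [dist_triangle (a u) (a u') y, hΔ' u u']
        _ ≤ _ := hLp _ _ dist_nonneg hΔ0
    have h2 := mul_le_mul_of_nonneg_left h1 (show 0 ≤ 1 + σ by linarith)
    have h3 : K u ≤ ∑ u, K u := Finset.single_le_sum (fun u _ => hK0 u) (Finset.mem_univ u)
    have h4 : 0 ≤ (1 + σ) * K u' := mul_nonneg (by linarith) (hK0 _)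
    simp only [hc]
    linarith
  set P : Fin (N + 1) → ℝ := fun u => νX.real (f ⁻¹' {u}) with hP
  have hPs : P ∈ stdSimplex ℝ (Fin (N + 1)) := by
    refine ⟨fun u => measureReal_nonneg, ?_⟩
    simp only [hP]
    rw [← measureReal_iUnion_fintype]
    · rw [show (⋃ u, f ⁻¹' {u}) = Set.univ from Set.eq_univ_of_forall fun x =>
        Set.mem_iUnion.2 ⟨f x, rfl⟩]
      simp
    · intro u v huv
      rw [Function.onFun, Set.disjoint_left]
      intro x hx hx'
      exact huv (hx.symm.trans hx')
    · exact fun u => hf (measurableSet_singleton u)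
  have hPlast : P (Fin.last N) ≤ Real.exp (-(s * KR)) := by
    refine le_trans (measureReal_mono ?_) hEν
    intro x hx hxE
    exact (hfE x hxE).1 hx
  have hKavg : ∀ k ∈ supportedSimplex P, ∑ u, k u * K u ≤ σ + (1 / s) * (finDiv k P + 1) := by
    intro k hk
    have h1 : ∀ u, k u * K u ≤ k u * σ + (if u = Fin.last N then k u * KR else 0) := by
      intro u
      by_cases hu : u = Fin.last N
      · have : 0 ≤ k u * σ := mul_nonneg (hk.1.1 u) hσ.le
        simp only [hKdef, hr, hu, if_true]
        rw [hu] at this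
        linarith
      · simp only [hKdef, hr, hu, if_false, add_zero]
        exact mul_le_mul_of_nonneg_left hLh (hk.1.1 u)
    have h2 := mul_le_finDiv_add hPs hk (Fin.last N) (s * KR)
    have h3 : P (Fin.last N) * Real.exp (s * KR) ≤ 1 := by
      calc P (Fin.last N) * Real.exp (s * KR) ≤ Real.exp (-(s * KR)) * Real.exp (s * KR) :=
            mul_le_mul_of_nonneg_right hPlast (Real.exp_pos _).le
        _ = 1 := by rw [← Real.exp_add]; simp
    calc ∑ u, k u * K u ≤ ∑ u, (k u * σ + (if u = Fin.last N then k u * KR else 0)) :=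
          Finset.sum_le_sum fun u _ => h1 u
      _ = σ + k (Fin.last N) * KR := by
          rw [Finset.sum_add_distrib, ← Finset.sum_mul, hk.1.2]; simp
      _ ≤ _ := by
          refine add_le_add_right ?_ σ
          rw [one_div, ← div_eq_inv_mul, le_div_iff₀ hs0]
          linarith
  have hSL := singleLetter_of_psi hp hR hf hcm hK0 hσ hσ1 hcd (ρ := 1 / s) (by positivity) hKavg
    hα ht (show t < t + σ by linarith) hB hψ
  -- The value of `s` was chosen to make this error equal to `σ`.
  have hρ : 1 / s * (α + σ * α / 2 + 1) = σ := by
    rw [hs, ← hα₁]; field_simp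
  rw [hρ] at hSL
  obtain ⟨n₀, hn₀⟩ := pi_image_ge hPs hcm hc0
    (add_nonneg (by positivity) (Finset.sum_nonneg fun u _ => hK0 u)) (by linarith) hcc hα.le hαα
    hστ (show 0 < ε / 2 by linarith) hSL
  refine ⟨n₀, fun n hn => ?_⟩
  refine le_iInf fun A => le_iInf fun hA => le_iInf fun hAα => ?_
  -- Words of cells met by `A` inside the ball: they carry at least the mass of `A`. As `c`
  -- dominates the true cost on each cell, their image lies in the enlargement.
  set S : Set (Fin n → Fin (N + 1)) :=
    {u | ∃ x ∈ A, (∀ i, x i ∈ Metric.closedBall x₀ R) ∧ ∀ i, f (x i) = u i} with hS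
  have h1 : Real.exp (-(n * α)) ≤ ∑ u, S.indicator (fun u => ∏ i, P (u i)) u := by
    have h2 := hAα.trans (pi_le_sum_cells hf hR n A)
    rwa [ENNReal.ofReal_le_ofReal_iff (Finset.sum_nonneg fun u _ =>
      Set.indicator_nonneg (fun u _ => Finset.prod_nonneg fun i _ => measureReal_nonneg) _)] at h2
  refine le_trans ?_ ((hn₀ n hn S h1).trans (measure_mono ?_))
  · refine ENNReal.ofReal_le_ofReal (Real.exp_le_exp.2 (neg_le_neg ?_))
    exact mul_le_mul_of_nonneg_left (by linarith) (Nat.cast_nonneg n)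
  · rintro y ⟨u, ⟨x, hxA, hxG, hxu⟩, hy⟩
    refine ⟨x, hxA, ?_⟩
    rw [addCost, NNReal.coe_sum]
    refine le_trans (Finset.sum_le_sum fun i _ => ?_) hy
    rw [coe_distCost, ← hxu i]
    exact hdc (x i) (hxG i) (y i)

end UpperBound

end

end ThickIsoperimetry

namespace ThickIsoperimetry

noncomputable section

/-! ### Dual potentials for entropy plus transport cost -/

section Potential

variable {U Y : Type*} [Fintype U]

/-- A smooth substitute for `max_u exp (φ u - b u)`. -/
def softMax (β : ℝ) (b : U → Y → ℝ) (φ : U → ℝ) (y : Y) : ℝ :=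
  (∑ u, Real.exp (β * (φ u - b u y))) ^ (1 / β)

variable {β : ℝ} {b : U → Y → ℝ} {φ : U → ℝ}

lemma measurable_softMax [MeasurableSpace Y] (hb : ∀ u, Measurable (b u)) : Measurable (softMax β b φ) :=
  (Finset.measurable_sum _ fun u _ =>
    Real.measurable_exp.comp (((hb u).const_sub _).const_mul _)).pow_const _

lemma exp_rpow_one_div (hβ : 0 < β) (x : ℝ) : Real.exp (β * x) ^ (1 / β) = Real.exp x := by
  rw [← Real.exp_mul]; congr 1; field_simp

lemma exp_le_softMax (hβ : 0 < β) (u : U) (y : Y) :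
    Real.exp (φ u - b u y) ≤ softMax β b φ y := by
  rw [← exp_rpow_one_div hβ]
  exact Real.rpow_le_rpow (Real.exp_pos _).le
    (Finset.single_le_sum (f := fun u => Real.exp (β * (φ u - b u y)))
      (fun _ _ => (Real.exp_pos _).le) (Finset.mem_univ u)) (by positivity)

lemma softMax_pos [Nonempty U] (hβ : 0 < β) (y : Y) : 0 < softMax β b φ y :=
  (Real.exp_pos _).trans_le (exp_le_softMax hβ (Classical.arbitrary U) y)

lemma softMax_le (hβ : 0 < β) (hb0 : ∀ u y, 0 ≤ b u y) (hφ : ∀ u, φ u ≤ 0) (y : Y) :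
    softMax β b φ y ≤ (Fintype.card U : ℝ) ^ (1 / β) := by
  refine Real.rpow_le_rpow (Finset.sum_nonneg fun _ _ => (Real.exp_pos _).le) ?_ (by positivity)
  calc ∑ u, Real.exp (β * (φ u - b u y)) ≤ ∑ _u : U, (1 : ℝ) := by
        refine Finset.sum_le_sum fun u _ => Real.exp_le_one_iff.2 ?_
        exact mul_nonpos_of_nonneg_of_nonpos hβ.le (by linarith [hb0 u y, hφ u])
    _ = _ := by simp

/-- Homogeneity makes the dual functional invariant under adding constants to `φ`, so the
maximization may be restricted to nonpositive potentials. -/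
lemma softMax_add_const (hβ : 0 < β) (c : ℝ) (y : Y) :
    softMax β b (fun u => φ u + c) y = Real.exp c * softMax β b φ y := by
  unfold softMax
  have : ∀ u, Real.exp (β * (φ u + c - b u y)) =
      Real.exp (β * c) * Real.exp (β * (φ u - b u y)) := fun u => by
    rw [← Real.exp_add]; congr 1; ring
  simp only [this, ← Finset.mul_sum]
  rw [Real.mul_rpow (Real.exp_pos _).le (Finset.sum_nonneg fun _ _ => (Real.exp_pos _).le),
    exp_rpow_one_div hβ]

variable [MeasurableSpace Y] {ν : Measure Y} [IsProbabilityMeasure ν]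

lemma integrable_softMax [Nonempty U] (hβ : 0 < β) (hb : ∀ u, Measurable (b u)) (hb0 : ∀ u y, 0 ≤ b u y)
    (φ : U → ℝ) : Integrable (softMax β b φ) ν := by
  obtain ⟨M, hM⟩ : ∃ M, ∀ u, φ u ≤ M := ⟨∑ u, |φ u|, fun u => (le_abs_self _).trans
    (Finset.single_le_sum (f := fun u => |φ u|) (fun _ _ => abs_nonneg _) (Finset.mem_univ u))⟩
  have e : softMax β b φ = fun y => Real.exp M * softMax β b (fun u => φ u - M) y := by
    funext y
    rw [← softMax_add_const hβ]
    simp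
  rw [e]
  refine Integrable.const_mul (Integrable.of_bound (measurable_softMax hb).aestronglyMeasurable
    ((Fintype.card U : ℝ) ^ (1 / β)) (ae_of_all _ fun y => ?_)) _
  rw [Real.norm_of_nonneg (softMax_pos hβ y).le]
  exact softMax_le hβ hb0 (fun u => by linarith [hM u]) y

lemma integral_pos_of_pos {f : Y → ℝ} (hf : Integrable f ν) (h : ∀ y, 0 < f y) :
    0 < ∫ y, f y ∂ν := by
  rw [integral_pos_iff_support_of_nonneg (fun y => (h y).le) hf]
  rw [show Function.support f = Set.univ from Set.eq_univ_of_forall fun y => (h y).ne']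
  simp

lemma integrable_exp_neg {g : Y → ℝ} (hg : Measurable g) (h0 : ∀ y, 0 ≤ g y) :
    Integrable (fun y => Real.exp (-g y)) ν :=
  Integrable.of_bound (Real.measurable_exp.comp hg.neg).aestronglyMeasurable 1
    (ae_of_all _ fun y => by
      rw [Real.norm_of_nonneg (Real.exp_pos _).le]
      exact Real.exp_le_one_iff.2 (by linarith [h0 y]))

/-- The dual functional attains its maximum. -/
lemma exists_maximizer [Nonempty U] (hβ : 0 < β) (hb : ∀ u, Measurable (b u))
    (hb0 : ∀ u y, 0 ≤ b u y) {a : U → ℝ} (ha : ∀ u, 0 < a u) (ha1 : ∑ u, a u = 1) :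
    ∃ φ : U → ℝ, (∀ u, φ u ≤ 0) ∧ ∀ φ' : U → ℝ,
      ∑ u, a u * φ' u - Real.log (∫ y, softMax β b φ' y ∂ν) ≤
        ∑ u, a u * φ u - Real.log (∫ y, softMax β b φ y ∂ν) := by
  classical
  set Z : (U → ℝ) → ℝ := fun φ => ∫ y, softMax β b φ y ∂ν with hZ
  have hZpos : ∀ φ, 0 < Z φ := fun φ =>
    integral_pos_of_pos (integrable_softMax hβ hb hb0 φ) (softMax_pos hβ)
  set F : (U → ℝ) → ℝ := fun φ => ∑ u, a u * φ u - Real.log (Z φ) with hF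
  have hshift : ∀ φ c, F (fun u => φ u + c) = F φ := by
    intro φ c
    simp only [hF, hZ, softMax_add_const hβ, integral_const_mul, mul_add, Finset.sum_add_distrib,
      ← Finset.sum_mul, ha1, one_mul]
    rw [Real.log_mul (Real.exp_pos c).ne' (hZpos φ).ne', Real.log_exp]
    ring
  set z : U → ℝ := fun u => ∫ y, Real.exp (-b u y) ∂ν with hz
  have hzpos : ∀ u, 0 < z u := fun u =>
    integral_pos_of_pos (integrable_exp_neg (hb u) (hb0 u)) fun y => Real.exp_pos _
  set C : ℝ := ∑ u, |Real.log (z u)| with hC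
  have hlow : ∀ φ u, φ u = 0 → -Real.log (Z φ) ≤ C := by
    intro φ u hu
    have h1 : z u ≤ Z φ := by
      refine integral_mono (integrable_exp_neg (hb u) (hb0 u)) (integrable_softMax hβ hb hb0 φ)
        fun y => ?_
      have := exp_le_softMax (b := b) (φ := φ) hβ u y
      rwa [hu, zero_sub] at this
    have h2 : -Real.log (z u) ≤ C := (neg_le_abs _).trans
      (Finset.single_le_sum (f := fun u => |Real.log (z u)|) (fun _ _ => abs_nonneg _)
        (Finset.mem_univ u))
    have h3 := Real.log_le_log (hzpos u) h1
    linarith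
  -- If the largest coordinate is `0` and another is below `-M`, the functional is at most `C - a u
  -- * M ≤ F 0`. The maximum is therefore attained on the box `[-M, 0]`.
  set M : ℝ := ∑ u, |C - F 0| / a u with hM
  have hM' : ∀ u, C - F 0 ≤ a u * M := by
    intro u
    have h1 : |C - F 0| / a u ≤ M := Finset.single_le_sum (f := fun u => |C - F 0| / a u)
      (fun u _ => div_nonneg (abs_nonneg _) (ha u).le) (Finset.mem_univ u)
    rw [div_le_iff₀ (ha u)] at h1
    linarith [le_abs_self (C - F 0)]
  have hM0 : 0 ≤ M := Finset.sum_nonneg fun u _ => div_nonneg (abs_nonneg _) (ha u).le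
  set Bx : Set (U → ℝ) := Set.Icc (fun _ => -M) (fun _ => 0) with hBx
  have hcont : ContinuousOn F Bx := by
    have h1 : ContinuousOn Z Bx := by
      refine continuousOn_of_dominated (bound := fun _ => (Fintype.card U : ℝ) ^ (1 / β))
        (fun φ _ => (measurable_softMax hb).aestronglyMeasurable)
        (fun φ hφ => ae_of_all _ fun y => ?_) (integrable_const _) (ae_of_all _ fun y => ?_)
      · rw [Real.norm_of_nonneg (softMax_pos hβ y).le]
        exact softMax_le hβ hb0 (fun u => hφ.2 u) y
      · refine Continuous.continuousOn ?_
        unfold softMax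
        refine Continuous.rpow_const (by fun_prop) fun φ => Or.inr (by positivity)
    exact ContinuousOn.sub (by fun_prop) (h1.log fun φ _ => (hZpos φ).ne')
  have h0 : (0 : U → ℝ) ∈ Bx := ⟨fun u => by simp [hM0], fun u => le_rfl⟩
  obtain ⟨φ, hφ, hmax⟩ := isCompact_Icc.exists_isMaxOn ⟨0, h0⟩ hcont
  refine ⟨φ, fun u => hφ.2 u, fun φ' => ?_⟩
  change F φ' ≤ F φ
  obtain ⟨u₀, hu₀⟩ := Finite.exists_max φ'
  rw [← hshift φ' (-φ' u₀)]
  set ψ : U → ℝ := fun u => φ' u + -φ' u₀ with hψ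
  have hψ0 : ∀ u, ψ u ≤ 0 := fun u => by simp only [hψ]; linarith [hu₀ u]
  by_cases hin : ψ ∈ Bx
  · exact hmax hin
  · obtain ⟨u, hu⟩ : ∃ u, ψ u < -M := by
      by_contra! h
      exact hin ⟨fun u => h u, fun u => hψ0 u⟩
    have h1 : ∑ u, a u * ψ u ≤ a u * ψ u := by
      rw [← Finset.add_sum_erase _ _ (Finset.mem_univ u)]
      have : ∑ v ∈ Finset.univ.erase u, a v * ψ v ≤ 0 := Finset.sum_nonpos fun v _ =>
        mul_nonpos_of_nonneg_of_nonpos (ha v).le (hψ0 v)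
      linarith
    have h2 := hlow ψ u₀ (by simp [hψ])
    have h3 : a u * ψ u ≤ a u * (-M) := mul_le_mul_of_nonneg_left hu.le (ha u).le
    have h4 : F ψ ≤ F 0 := by
      change ∑ u, a u * ψ u - Real.log (Z ψ) ≤ F 0
      have := hM' u
      linarith
    exact h4.trans (hmax h0)

/-- The densities at a maximizer of the dual functional have the prescribed masses. -/
lemma integral_density_eq [Nonempty U] (hβ : 0 < β) (hb : ∀ u, Measurable (b u))
    (hb0 : ∀ u y, 0 ≤ b u y) {a : U → ℝ} (hφ0 : ∀ u, φ u ≤ 0)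
    (hφ : ∀ φ' : U → ℝ, ∑ u, a u * φ' u - Real.log (∫ y, softMax β b φ' y ∂ν) ≤
        ∑ u, a u * φ u - Real.log (∫ y, softMax β b φ y ∂ν)) (u : U) :
    ∫ y, Real.exp (β * (φ u - b u y)) *
      (∑ v, Real.exp (β * (φ v - b v y))) ^ (1 / β - 1) ∂ν =
      a u * ∫ y, softMax β b φ y ∂ν := by
  classical
  set B : Y → ℝ := fun y => Real.exp (β * (φ u - b u y)) with hB
  set A : Y → ℝ := fun y => ∑ v ∈ Finset.univ.erase u, Real.exp (β * (φ v - b v y)) with hA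
  have hBpos : ∀ y, 0 < B y := fun y => Real.exp_pos _
  have hA0 : ∀ y, 0 ≤ A y := fun y => Finset.sum_nonneg fun _ _ => (Real.exp_pos _).le
  have hBm : Measurable B := Real.measurable_exp.comp (((hb u).const_sub _).const_mul _)
  have hAm : Measurable A := Finset.measurable_sum _ fun v _ =>
    Real.measurable_exp.comp (((hb v).const_sub _).const_mul _)
  have hAB : ∀ y, ∑ v, Real.exp (β * (φ v - b v y)) = A y + B y := fun y => by
    rw [add_comm]; exact (Finset.add_sum_erase _ _ (Finset.mem_univ u)).symm
  have hABle : ∀ y, A y + B y ≤ Fintype.card U := fun y => by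
    rw [← hAB]
    calc ∑ u, Real.exp (β * (φ u - b u y)) ≤ ∑ _u : U, (1 : ℝ) := by
          refine Finset.sum_le_sum fun u _ => Real.exp_le_one_iff.2 ?_
          exact mul_nonpos_of_nonneg_of_nonpos hβ.le (by linarith [hb0 u y, hφ0 u])
      _ = _ := by simp
  -- One coordinate of the potential is varied. At a maximizer the derivative of the dual functional
  -- vanishes, and this first-order condition is the mass identity.
  set G : ℝ → Y → ℝ := fun t y => (A y + B y * Real.exp (β * t)) ^ (1 / β) with hG
  have hGsoft : ∀ t y, softMax β b (Function.update φ u (φ u + t)) y = G t y := by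
    intro t y
    simp only [softMax, hG]
    congr 1
    rw [← Finset.add_sum_erase _ _ (Finset.mem_univ u), add_comm]
    congr 1
    · refine Finset.sum_congr rfl fun v hv => ?_
      rw [Function.update_of_ne (Finset.ne_of_mem_erase hv)]
    · rw [Function.update_self, ← Real.exp_add]
      congr 1; ring
  set G' : ℝ → Y → ℝ := fun t y =>
    B y * Real.exp (β * t) * (A y + B y * Real.exp (β * t)) ^ (1 / β - 1) with hG'
  have hpos : ∀ t y, 0 < A y + B y * Real.exp (β * t) := fun t y =>
    add_pos_of_nonneg_of_pos (hA0 y) (mul_pos (hBpos y) (Real.exp_pos _))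
  have hder : ∀ t y, HasDerivAt (fun t => G t y) (G' t y) t := by
    intro t y
    have h1 : HasDerivAt (fun t : ℝ => A y + B y * Real.exp (β * t))
        (B y * (Real.exp (β * t) * β)) t := by
      have h2 : HasDerivAt (fun t : ℝ => β * t) β t := by
        simpa using (hasDerivAt_id t).const_mul β
      exact (h2.exp.const_mul (B y)).const_add (A y)
    have h3 := h1.rpow_const (p := 1 / β) (Or.inl (hpos t y).ne')
    convert h3 using 1
    simp only [hG']
    field_simp
  set C : ℝ := ((Fintype.card U : ℝ) * Real.exp β) ^ (1 / β) with hC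
  have hbound : ∀ t ∈ Metric.ball (0 : ℝ) 1, ∀ y, ‖G' t y‖ ≤ C := by
    intro t ht y
    have ht1 : t ≤ 1 := by
      rw [mem_ball_zero_iff, Real.norm_eq_abs] at ht
      exact (le_abs_self t).trans ht.le
    have hx : 0 < B y * Real.exp (β * t) := mul_pos (hBpos y) (Real.exp_pos _)
    have hs := hpos t y
    rw [Real.norm_of_nonneg (mul_nonneg hx.le (Real.rpow_nonneg hs.le _))]
    calc B y * Real.exp (β * t) * (A y + B y * Real.exp (β * t)) ^ (1 / β - 1)
        ≤ (A y + B y * Real.exp (β * t)) * (A y + B y * Real.exp (β * t)) ^ (1 / β - 1) :=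
          mul_le_mul_of_nonneg_right (by linarith [hA0 y]) (Real.rpow_nonneg hs.le _)
      _ = (A y + B y * Real.exp (β * t)) ^ (1 / β) := by
          rw [Real.rpow_sub_one hs.ne', mul_div_cancel₀ _ hs.ne']
      _ ≤ C := by
          refine Real.rpow_le_rpow hs.le ?_ (by positivity)
          have h1 : Real.exp (β * t) ≤ Real.exp β :=
            Real.exp_le_exp.2 (mul_le_of_le_one_right hβ.le ht1)
          calc A y + B y * Real.exp (β * t) ≤ A y * Real.exp β + B y * Real.exp β := by
                refine add_le_add (le_mul_of_one_le_right (hA0 y) (Real.one_le_exp hβ.le))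
                  (mul_le_mul_of_nonneg_left h1 (hBpos y).le)
            _ = (A y + B y) * Real.exp β := by ring
            _ ≤ _ := mul_le_mul_of_nonneg_right (hABle y) (Real.exp_pos _).le
  have hGm : ∀ t, AEStronglyMeasurable (G t) ν := fun t =>
    ((hAm.add (hBm.mul_const _)).pow_const _).aestronglyMeasurable
  have hG'm : AEStronglyMeasurable (G' 0) ν :=
    ((hBm.mul_const _).mul ((hAm.add (hBm.mul_const _)).pow_const _)).aestronglyMeasurable
  have hG0 : G 0 = softMax β b φ := by
    funext y; rw [← hGsoft]; simp
  have h_int := (hasDerivAt_integral_of_dominated_loc_of_deriv_le (μ := ν) (F := G) (F' := G')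
    (bound := fun _ => C) (Metric.ball_mem_nhds (0 : ℝ) one_pos) (Eventually.of_forall hGm)
    (by rw [hG0]; exact integrable_softMax hβ hb hb0 φ) hG'm
    (ae_of_all _ fun y t ht => hbound t ht y) (integrable_const _)
    (ae_of_all _ fun y t _ => hder t y)).2
  have hZpos : 0 < ∫ y, softMax β b φ y ∂ν :=
    integral_pos_of_pos (integrable_softMax hβ hb hb0 φ) (softMax_pos hβ)
  have hfun : HasDerivAt (fun t : ℝ => a u * t - Real.log (∫ y, G t y ∂ν))
      (a u - (∫ y, G' 0 y ∂ν) / ∫ y, G 0 y ∂ν) 0 := by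
    have h1 : HasDerivAt (fun t : ℝ => a u * t) (a u) 0 := by
      simpa using (hasDerivAt_id (0 : ℝ)).const_mul (a u)
    exact h1.sub (h_int.log (by rw [hG0]; exact hZpos.ne'))
  have hmax : IsLocalMax (fun t : ℝ => a u * t - Real.log (∫ y, G t y ∂ν)) 0 := by
    refine Eventually.of_forall fun t => ?_
    have h1 := hφ (Function.update φ u (φ u + t))
    have h2 : ∑ v, a v * Function.update φ u (φ u + t) v = ∑ v, a v * φ v + a u * t := by
      rw [← Finset.add_sum_erase _ _ (Finset.mem_univ u),
        ← Finset.add_sum_erase _ (fun v => a v * φ v) (Finset.mem_univ u), Function.update_self]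
      rw [Finset.sum_congr rfl fun v hv => by
        rw [Function.update_of_ne (Finset.ne_of_mem_erase hv)]]
      ring
    simp only [hGsoft, h2] at h1
    simp only [hG0, mul_zero]
    linarith
  have h0 := hmax.hasDerivAt_eq_zero hfun
  rw [hG0, sub_eq_zero, eq_div_iff hZpos.ne'] at h0
  rw [h0]
  refine integral_congr_ae (ae_of_all _ fun y => ?_)
  simp only [hG', hAB, mul_zero, Real.exp_zero, mul_one]
  rfl

lemma mul_exp_neg_le_one (x : ℝ) : x * Real.exp (-x) ≤ 1 := by
  rw [Real.exp_neg, ← div_eq_mul_inv, div_le_one (Real.exp_pos x)]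
  linarith [Real.add_one_le_exp x]

/-- Finite duality: a lower bound on entropy plus cost over couplings with prescribed first
marginal is witnessed by a potential. -/
lemma exists_potential [Nonempty U] (hb : ∀ u, Measurable (b u)) (hb0 : ∀ u y, 0 ≤ b u y)
    {a : U → ℝ} (ha : ∀ u, 0 < a u) (ha1 : ∑ u, a u = 1) {m ε : ℝ} (hε : 0 < ε)
    (H : ∀ (r : U → Y → ℝ) (C : ℝ), (∀ u, Measurable (r u)) → (∀ u y, 0 ≤ r u y) →
      (∀ u y, r u y ≤ C) → (∀ u y, b u y * r u y ≤ C) → (∀ u, ∫ y, r u y ∂ν = a u) →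
      m ≤ ∫ y, (∑ u, r u y) * Real.log (∑ u, r u y) ∂ν + ∑ u, ∫ y, b u y * r u y ∂ν) :
    ∃ (φ : U → ℝ) (g : Y → ℝ), Measurable g ∧ Integrable g ν ∧
      (∀ u y, Real.exp (φ u - b u y) ≤ g y) ∧
      m - ε ≤ ∑ u, a u * φ u - Real.log (∫ y, g y ∂ν) := by
  classical
  set n : ℝ := (Fintype.card U : ℝ) with hn
  have hn1 : (1 : ℝ) ≤ n := by
    rw [hn]; exact_mod_cast Fintype.card_pos
  -- Replacing the maximum by the soft maximum costs `n / β ≤ ε`; `β ≥ 1` makes the exponent `1 / β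
  -- - 1` nonpositive.
  set β : ℝ := 1 + n / ε with hβdef
  have hβ1 : 1 ≤ β := by rw [hβdef]; have : 0 ≤ n / ε := by positivity
                         linarith
  have hβ : 0 < β := by linarith
  have hnβ : n / β ≤ ε := by
    rw [div_le_iff₀ hβ, hβdef]
    have : ε * (n / ε) = n := mul_div_cancel₀ _ hε.ne'
    nlinarith
  obtain ⟨φ, hφ0, hφ⟩ := exists_maximizer (ν := ν) hβ hb hb0 ha ha1
  refine ⟨φ, softMax β b φ, measurable_softMax hb, integrable_softMax hβ hb hb0 φ,
    fun u y => exp_le_softMax hβ u y, ?_⟩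
  have h_int := integral_density_eq (ν := ν) hβ hb hb0 hφ0 hφ
  set Z : ℝ := ∫ y, softMax β b φ y ∂ν with hZ
  have hZpos : 0 < Z := integral_pos_of_pos (integrable_softMax hβ hb hb0 φ) (softMax_pos hβ)
  set S : Y → ℝ := fun y => ∑ v, Real.exp (β * (φ v - b v y)) with hS
  have hSpos : ∀ y, 0 < S y := fun y => Finset.sum_pos (fun _ _ => Real.exp_pos _)
    Finset.univ_nonempty
  have hSm : Measurable S := Finset.measurable_sum _ fun v _ =>
    Real.measurable_exp.comp (((hb v).const_sub _).const_mul _)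
  -- The maximizer supplies primal competitors: densities with marginals `a` by the first-order
  -- condition. Comparing their value with the dual value closes the duality gap up to `ε`.
  set r : U → Y → ℝ := fun u y => Real.exp (β * (φ u - b u y)) * S y ^ (1 / β - 1) / Z with hr
  have hrm : ∀ u, Measurable (r u) := fun u =>
    ((Real.measurable_exp.comp (((hb u).const_sub _).const_mul _)).mul
      (hSm.pow_const _)).div_const _
  have hrpos : ∀ u y, 0 < r u y := fun u y =>
    div_pos (mul_pos (Real.exp_pos _) (Real.rpow_pos_of_pos (hSpos y) _)) hZpos
  -- Keeping one summand of `S`, raised to a nonpositive power, bounds both the densities and their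
  -- products with the unbounded costs `b`.
  have hrexp : ∀ u y, r u y ≤ Real.exp (-b u y) / Z := by
    intro u y
    refine div_le_div_of_nonneg_right ?_ hZpos.le
    have h1 : S y ^ (1 / β - 1) ≤ Real.exp (β * (φ u - b u y)) ^ (1 / β - 1) := by
      refine Real.rpow_le_rpow_of_nonpos (Real.exp_pos _)
        (Finset.single_le_sum (f := fun u => Real.exp (β * (φ u - b u y)))
          (fun _ _ => (Real.exp_pos _).le) (Finset.mem_univ u)) ?_
      rw [sub_nonpos, div_le_one hβ]; exact hβ1
    calc Real.exp (β * (φ u - b u y)) * S y ^ (1 / β - 1)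
        ≤ Real.exp (β * (φ u - b u y)) * Real.exp (β * (φ u - b u y)) ^ (1 / β - 1) :=
          mul_le_mul_of_nonneg_left h1 (Real.exp_pos _).le
      _ = Real.exp (φ u - b u y) := by
          rw [Real.rpow_sub_one (Real.exp_pos _).ne', mul_div_cancel₀ _ (Real.exp_pos _).ne',
            exp_rpow_one_div hβ]
      _ ≤ _ := Real.exp_le_exp.2 (by linarith [hφ0 u])
  have hr1 : ∀ u y, r u y ≤ 1 / Z := fun u y => (hrexp u y).trans
    (div_le_div_of_nonneg_right (Real.exp_le_one_iff.2 (by linarith [hb0 u y])) hZpos.le)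
  have hbr : ∀ u y, b u y * r u y ≤ 1 / Z := fun u y => by
    refine (mul_le_mul_of_nonneg_left (hrexp u y) (hb0 u y)).trans ?_
    rw [← mul_div_assoc]
    exact div_le_div_of_nonneg_right (mul_exp_neg_le_one _) hZpos.le
  have hra : ∀ u, ∫ y, r u y ∂ν = a u := by
    intro u
    simp only [hr]
    rw [integral_div, h_int u, mul_div_assoc, div_self hZpos.ne', mul_one]
  have hm := H r (1 / Z) hrm (fun u y => (hrpos u y).le) hr1 hbr hra
  have hri : ∀ u, Integrable (r u) ν := fun u =>
    Integrable.of_bound (hrm u).aestronglyMeasurable (1 / Z) (ae_of_all _ fun y => by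
      rw [Real.norm_of_nonneg (hrpos u y).le]; exact hr1 u y)
  have hbri : ∀ u, Integrable (fun y => b u y * r u y) ν := fun u =>
    Integrable.of_bound ((hb u).mul (hrm u)).aestronglyMeasurable (1 / Z) (ae_of_all _ fun y => by
      rw [Real.norm_of_nonneg (mul_nonneg (hb0 u y) (hrpos u y).le)]; exact hbr u y)
  have hRsum : ∀ y, ∑ u, r u y = S y ^ (1 / β) / Z := by
    intro y
    simp only [hr]
    rw [← Finset.sum_div, ← Finset.sum_mul, Real.rpow_sub_one (hSpos y).ne',
      mul_div_cancel₀ _ (hSpos y).ne']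
  have hRpos : ∀ y, 0 < ∑ u, r u y := fun y => Finset.sum_pos (fun u _ => hrpos u y)
    Finset.univ_nonempty
  have hpt : ∀ y, (∑ u, r u y) * Real.log (∑ u, r u y) + ∑ u, b u y * r u y ≤
      ∑ u, (φ u - Real.log Z) * r u y + (n / β) * ∑ u, r u y := by
    intro y
    have hlog : Real.log (∑ u, r u y) = 1 / β * Real.log (S y) - Real.log Z := by
      rw [hRsum, Real.log_div (Real.rpow_pos_of_pos (hSpos y) _).ne' hZpos.ne',
        Real.log_rpow (hSpos y)]
    -- Approximate complementary slackness: `r u` is `B / S` times the total density, so `log (S /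
    -- B) ≤ S / B` bounds the loss in each coordinate by `1 / β` times that density.
    have key : ∀ u, r u y * (1 / β * Real.log (S y) + b u y - φ u) ≤
        (1 / β) * ∑ u, r u y := by
      intro u
      set B := Real.exp (β * (φ u - b u y)) with hB
      have hBpos : 0 < B := Real.exp_pos _
      have h1 : φ u - b u y = 1 / β * Real.log B := by
        rw [hB, Real.log_exp]; field_simp
      have h2 : Real.log (S y) - Real.log B ≤ S y / B := by
        rw [← Real.log_div (hSpos y).ne' hBpos.ne']
        exact (Real.log_le_sub_one_of_pos (div_pos (hSpos y) hBpos)).trans (by linarith)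
      have h3 : r u y * (S y / B) = ∑ u, r u y := by
        rw [hRsum]
        simp only [hr]
        rw [← hB, Real.rpow_sub_one (hSpos y).ne']
        have := (hSpos y).ne'
        field_simp
      calc r u y * (1 / β * Real.log (S y) + b u y - φ u)
          = (1 / β) * (r u y * (Real.log (S y) - Real.log B)) := by
            rw [show 1 / β * Real.log (S y) + b u y - φ u =
              1 / β * Real.log (S y) - (φ u - b u y) by ring, h1]; ring
        _ ≤ (1 / β) * (r u y * (S y / B)) := by
            refine mul_le_mul_of_nonneg_left ?_ (by positivity)
            exact mul_le_mul_of_nonneg_left h2 (hrpos u y).le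
        _ = _ := by rw [h3]
    have hsum := Finset.sum_le_sum fun u (_ : u ∈ Finset.univ) => key u
    rw [Finset.sum_const, Finset.card_univ, nsmul_eq_mul, ← hn] at hsum
    rw [hlog, Finset.sum_mul, ← Finset.sum_add_distrib]
    have e : ∑ u, (r u y * (1 / β * Real.log (S y) - Real.log Z) + b u y * r u y) =
        ∑ u, r u y * (1 / β * Real.log (S y) + b u y - φ u) +
          ∑ u, (φ u - Real.log Z) * r u y := by
      rw [← Finset.sum_add_distrib]
      exact Finset.sum_congr rfl fun u _ => by ring
    rw [e]
    have : n * (1 / β * ∑ u, r u y) = n / β * ∑ u, r u y := by ring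
    linarith
  have hRi : Integrable (fun y => (∑ u, r u y) * Real.log (∑ u, r u y)) ν := by
    obtain ⟨C, hC⟩ : ∃ C, ∀ x ∈ Set.Icc (0 : ℝ) (∑ _u : U, 1 / Z), ‖x * Real.log x‖ ≤ C :=
      isCompact_Icc.exists_bound_of_continuousOn Real.continuous_mul_log.continuousOn
    have hm : Measurable fun y => ∑ u, r u y := Finset.measurable_sum _ fun u _ => hrm u
    exact Integrable.of_bound (hm.mul (Real.measurable_log.comp hm)).aestronglyMeasurable C
      (ae_of_all _ fun y => hC _ ⟨(hRpos y).le, Finset.sum_le_sum fun u _ => hr1 u y⟩)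
  have hle : ∫ y, (∑ u, r u y) * Real.log (∑ u, r u y) ∂ν + ∑ u, ∫ y, b u y * r u y ∂ν ≤
      ∑ u, (φ u - Real.log Z) * a u + n / β * ∑ u, a u := by
    rw [← integral_finsetSum _ fun u _ => hbri u,
      ← integral_add hRi (integrable_finsetSum _ fun u _ => hbri u)]
    refine (integral_mono (hRi.add (integrable_finsetSum _ fun u _ => hbri u))
      ((integrable_finsetSum _ fun u _ => (hri u).const_mul _).add
        ((integrable_finsetSum _ fun u _ => hri u).const_mul _)) hpt).trans (le_of_eq ?_)
    rw [integral_add' (integrable_finsetSum _ fun u _ => (hri u).const_mul _)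
        ((integrable_finsetSum _ fun u _ => hri u).const_mul _),
      integral_finsetSum _ fun u _ => (hri u).const_mul _, integral_const_mul,
      integral_finsetSum _ fun u _ => hri u]
    simp only [integral_const_mul, hra]
  have e : ∑ u, (φ u - Real.log Z) * a u = ∑ u, a u * φ u - Real.log Z := by
    simp only [sub_mul, Finset.sum_sub_distrib, ← Finset.mul_sum, ha1, mul_one]
    congr 1
    exact Finset.sum_congr rfl fun u _ => mul_comm _ _
  rw [e, ha1, mul_one] at hle
  linarith

end Potential

end

end ThickIsoperimetry

namespace ThickIsoperimetry

noncomputable section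

/-! ### Random coding and the Chernoff bound -/

section LowerCoding

lemma sum_prod_eq_one {Z : Type*} [Fintype Z] {Q : Z → ℝ} (hQ : Q ∈ stdSimplex ℝ Z) (n : ℕ) :
    ∑ z : Fin n → Z, ∏ i, Q (z i) = 1 := by
  have h := pathExp_const_eq_sum Q n (fun _ => 1)
  simp only [mul_one] at h
  rw [← h, pathExp_const (isTransition_const hQ.1 hQ.2)]

/-- The weak law of large numbers on a finite alphabet. -/
lemma exists_forall_sum_indicator_le {Z : Type*} [Fintype Z] {Q : Z → ℝ}
    (hQ : Q ∈ stdSimplex ℝ Z) (F : Z → ℝ) {ε δ : ℝ} (hε : 0 < ε) (hδ : 0 < δ) :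
    ∃ n₀ : ℕ, ∀ n ≥ n₀, ∑ z : Fin n → Z, {z : Fin n → Z | n * (∑ z, Q z * F z + ε) <
      ∑ i, F (z i)}.indicator (fun z => ∏ i, Q (z i)) z ≤ δ := by
  classical
  set μ := ∑ z, Q z * F z with hμ
  set M : ℝ := ∑ z, |F z - μ| with hM
  have hMz : ∀ z, |F z - μ| ≤ M := fun z => Finset.single_le_sum (f := fun z => |F z - μ|)
    (fun _ _ => abs_nonneg _) (Finset.mem_univ z)
  obtain ⟨N, hN⟩ := exists_nat_gt (M ^ 2 / (ε ^ 2 * δ))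
  refine ⟨N + 1, fun n hn => ?_⟩
  have hn0 : 0 < n := by omega
  have hn' : (0 : ℝ) < n := by exact_mod_cast hn0
  have h1 := pathProb_pathSum_ge (isTransition_const hQ.1 hQ.2) hn0 (X := fun _ z => F z - μ)
    (fun l => by simp only [mul_sub, Finset.sum_sub_distrib, ← Finset.sum_mul, hQ.2]
                 rw [hμ]; ring) (fun l z => hMz z) hε
  rw [pathProb, pathExp_const_eq_sum] at h1
  have h2 : ∀ z : Fin n → Z, {z : Fin n → Z | n * (μ + ε) < ∑ i, F (z i)}.indicator
      (fun z => ∏ i, Q (z i)) z = (∏ i, Q (z i)) *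
        {l | n * ε < pathSum (fun _ z => F z - μ) l}.indicator 1 (List.ofFn z) := by
    intro z
    have e : (List.ofFn z ∈ {l | n * ε < pathSum (fun _ z => F z - μ) l}) ↔
        z ∈ {z : Fin n → Z | n * (μ + ε) < ∑ i, F (z i)} := by
      rw [Set.mem_ofPred_eq, Set.mem_ofPred_eq]
      rw [pathSum_ofFn_const]
      simp only [Finset.sum_sub_distrib, Finset.sum_const, Finset.card_univ, Fintype.card_fin,
        nsmul_eq_mul]
      constructor <;> intro h <;> linarith
    by_cases h : z ∈ {z : Fin n → Z | n * (μ + ε) < ∑ i, F (z i)}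
    · rw [Set.indicator_of_mem h, Set.indicator_of_mem (e.2 h)]; simp
    · rw [Set.indicator_of_notMem h, Set.indicator_of_notMem fun h' => h (e.1 h')]; simp
  rw [Finset.sum_congr rfl fun z _ => h2 z]
  refine h1.trans ?_
  rw [div_le_iff₀ (by positivity)]
  have h3 : (N : ℝ) ≤ n := by exact_mod_cast (by omega : N ≤ n)
  rw [div_lt_iff₀ (by positivity)] at hN
  nlinarith [mul_pos (pow_pos hε 2) hδ]

/-- Chernoff's bound for a product of functions of the coordinates. -/
lemma pi_prod_ge_le {Y : Type*} [MeasurableSpace Y] {ν : Measure Y} [IsProbabilityMeasure ν]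
    {n : ℕ} {g : Fin n → Y → ℝ} (hg : ∀ i, Integrable (g i) ν) (hg0 : ∀ i y, 0 ≤ g i y) {r : ℝ} :
    Measure.pi (fun _ : Fin n => ν) {y | Real.exp r ≤ ∏ i, g i (y i)} ≤
      ENNReal.ofReal (Real.exp (-r) * ∏ i, ∫ y, g i y ∂ν) := by
  have h1 := mul_meas_ge_le_integral_of_nonneg (μ := Measure.pi fun _ : Fin n => ν)
    (f := fun y => ∏ i, g i (y i)) (ae_of_all _ fun y => Finset.prod_nonneg fun i _ => hg0 i (y i))
    (Integrable.fintype_prod hg) (Real.exp r)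
  rw [integral_fintype_prod_eq_prod] at h1
  rw [← ENNReal.ofReal_toReal (measure_ne_top (Measure.pi fun _ : Fin n => ν) _)]
  refine ENNReal.ofReal_le_ofReal ?_
  rw [Real.exp_neg, ← div_eq_inv_mul, le_div_iff₀ (Real.exp_pos r), mul_comm]
  exact h1

variable {W U X Y : Type*} [Fintype W] [Fintype U] [MeasurableSpace U] [DiscreteMeasurableSpace U]
  [MeasurableSpace X] [MeasurableSpace Y]

/-- A random codebook: potentials and types give small enlargements of large sets. -/
theorem isoFun_le_of_potentials {c : X → Y → ℝ≥0} {νX : Measure X} {νY : Measure Y}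
    [IsProbabilityMeasure νX] [IsProbabilityMeasure νY] {f : X → U} (hf : Measurable f)
    {T : W → ℝ} (hT : T ∈ stdSimplex ℝ W) {k : W → U → ℝ}
    (hk : ∀ w, k w ∈ supportedSimplex fun u => νX.real (f ⁻¹' {u})) {φ : W → U → ℝ}
    {g : W → Y → ℝ} (hg : ∀ w, Integrable (g w) νY) (hg0 : ∀ w y, 0 ≤ g w y)
    (hgpos : ∀ w, 0 < ∫ y, g w y ∂νY) {s : ℝ} (hs : 0 ≤ s)
    (H : ∀ w x y, 0 < k w (f x) → Real.exp (φ w (f x) - s * c x y) ≤ g w y) {α τ e : ℝ}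
    (hα : ∑ w, T w * finDiv (k w) (fun u => νX.real (f ⁻¹' {u})) < α)
    (he : e < ∑ w, T w * (∑ u, k w u * φ w u - Real.log (∫ y, g w y ∂νY)) - s * τ) :
    ∃ n₀ : ℕ, ∀ n ≥ n₀, isoFun c νX νY n (Real.exp (-(n * α))) (n * τ) ≤
      ENNReal.ofReal (Real.exp (-(n * e))) := by
  classical
  set P : U → ℝ := fun u => νX.real (f ⁻¹' {u}) with hP
  set Λ : W → ℝ := fun w => Real.log (∫ y, g w y ∂νY) with hΛ
  set Q : W × U → ℝ := fun z => T z.1 * k z.1 z.2 with hQdef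
  have hk1 : ∀ w, ∑ u, k w u = 1 := fun w => (hk w).1.2
  have hQ : Q ∈ stdSimplex ℝ (W × U) := by
    refine ⟨fun z => mul_nonneg (hT.1 _) ((hk _).1.1 _), ?_⟩
    rw [Fintype.sum_prod_type]
    simp only [hQdef, ← Finset.mul_sum, hk1, mul_one, hT.2]
  set D : ℝ := ∑ w, T w * finDiv (k w) P with hD
  set Φ : ℝ := ∑ w, T w * ∑ u, k w u * φ w u with hΦ
  set L : ℝ := ∑ w, T w * Λ w with hL
  have he' : e < Φ - L - s * τ := by
    have : ∑ w, T w * (∑ u, k w u * φ w u - Λ w) = Φ - L := by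
      simp only [mul_sub, Finset.sum_sub_distrib, hΦ, hL]
    linarith
  obtain ⟨ε, hε, hεα, hεe⟩ : ∃ ε : ℝ, 0 < ε ∧ 2 * ε ≤ α - D ∧ 2 * ε ≤ Φ - L - s * τ - e :=
    ⟨min ((α - D) / 2) ((Φ - L - s * τ - e) / 2), lt_min (by linarith) (by linarith),
      by linarith [min_le_left ((α - D) / 2) ((Φ - L - s * τ - e) / 2)],
      by linarith [min_le_right ((α - D) / 2) ((Φ - L - s * τ - e) / 2)]⟩
  have hδ : (0 : ℝ) < 1 / 8 := by norm_num
  obtain ⟨n₁, hn₁⟩ := exists_forall_sum_indicator_le hQ (fun z => -φ z.1 z.2) hε hδ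
  obtain ⟨n₂, hn₂⟩ := exists_forall_sum_indicator_le hQ
    (fun z => Real.log (k z.1 z.2 / P z.2)) hε hδ
  obtain ⟨n₃, hn₃⟩ := exists_forall_sum_indicator_le hQ (fun z => Λ z.1) hε hδ
  obtain ⟨n₄, hn₄⟩ := exists_nat_gt (Real.log 2 / ε)
  have hE : ∀ F : W × U → ℝ, ∑ z, Q z * F z = ∑ w, T w * ∑ u, k w u * F (w, u) := by
    intro F
    rw [Fintype.sum_prod_type]
    simp only [hQdef, Finset.mul_sum, mul_assoc]
  have e1 : ∑ z, Q z * -φ z.1 z.2 = -Φ := by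
    rw [hE, hΦ]; simp
  have e2 : ∑ z, Q z * Real.log (k z.1 z.2 / P z.2) = D := by rw [hE]; rfl
  have e3 : ∑ z, Q z * Λ z.1 = L := by
    rw [hE]; simp only [← Finset.sum_mul, hk1, one_mul, hL]
  rw [e1] at hn₁
  rw [e2] at hn₂
  rw [e3] at hn₃
  refine ⟨n₁ + n₂ + n₃ + n₄, fun n hn => ?_⟩
  have h1 := hn₁ n (by omega)
  have h2 := hn₂ n (by omega)
  have h3 := hn₃ n (by omega)
  -- The three atypical events: a low total potential, a high log-likelihood ratio against `P`, and
  -- a high total log-normalizer. Each has probability at most `1 / 8`.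
  set B₁ : Set (Fin n → W × U) := {z | n * (-Φ + ε) < ∑ i, -φ (z i).1 (z i).2} with hB₁
  set B₂ : Set (Fin n → W × U) :=
    {z | n * (D + ε) < ∑ i, Real.log (k (z i).1 (z i).2 / P (z i).2)} with hB₂
  set B₃ : Set (Fin n → W × U) := {z | n * (L + ε) < ∑ i, Λ (z i).1} with hB₃
  set G : Set (Fin n → W × U) := {z | z ∉ B₁ ∧ z ∉ B₂ ∧ z ∉ B₃} with hG
  have hQ0 : ∀ z : Fin n → W × U, 0 ≤ ∏ i, Q (z i) := fun z => Finset.prod_nonneg fun i _ =>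
    hQ.1 (z i)
  have hGprob : 5 / 8 ≤ ∑ z, G.indicator (fun z => ∏ i, Q (z i)) z := by
    have h4 : ∀ z, ∏ i, Q (z i) ≤ G.indicator (fun z => ∏ i, Q (z i)) z +
        (B₁.indicator (fun z => ∏ i, Q (z i)) z + B₂.indicator (fun z => ∏ i, Q (z i)) z +
          B₃.indicator (fun z => ∏ i, Q (z i)) z) := by
      intro z
      have hn : ∀ S : Set (Fin n → W × U), 0 ≤ S.indicator (fun z => ∏ i, Q (z i)) z := fun S =>
        Set.indicator_nonneg (fun z _ => hQ0 z) z
      have a0 := hn G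
      have a1 := hn B₁
      have a2 := hn B₂
      have a3 := hn B₃
      by_cases b1 : z ∈ B₁
      · rw [Set.indicator_of_mem b1]; linarith
      by_cases b2 : z ∈ B₂
      · rw [Set.indicator_of_mem b2]; linarith
      by_cases b3 : z ∈ B₃
      · rw [Set.indicator_of_mem b3]; linarith
      rw [Set.indicator_of_mem (show z ∈ G from ⟨b1, b2, b3⟩)]
      linarith
    have h5 := Finset.sum_le_sum fun z (_ : z ∈ Finset.univ) => h4 z
    rw [sum_prod_eq_one hQ] at h5
    simp only [Finset.sum_add_distrib] at h5
    linarith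
  -- The good set has probability at least `5 / 8`, so for some fixed word of labels the conditional
  -- probability is at least `1 / 2`.
  obtain ⟨w, hw⟩ : ∃ w : Fin n → W, 1 / 2 ≤ ∑ u : Fin n → U,
      {u : Fin n → U | (fun i => (w i, u i)) ∈ G}.indicator (fun u => ∏ i, k (w i) (u i)) u := by
    by_contra! hcon
    have h6 : ∑ z, G.indicator (fun z => ∏ i, Q (z i)) z = ∑ w : Fin n → W, (∏ i, T (w i)) *
        ∑ u : Fin n → U, {u : Fin n → U | (fun i => (w i, u i)) ∈ G}.indicator
          (fun u => ∏ i, k (w i) (u i)) u := by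
      rw [← (Equiv.arrowProdEquivProdArrow (Fin n) (fun _ => W) (fun _ => U)).symm.sum_comp,
        Fintype.sum_prod_type]
      refine Finset.sum_congr rfl fun w _ => ?_
      rw [Finset.mul_sum]
      refine Finset.sum_congr rfl fun u _ => ?_
      have e : (Equiv.arrowProdEquivProdArrow (Fin n) (fun _ => W) (fun _ => U)).symm (w, u) =
          fun i => (w i, u i) := rfl
      rw [e]
      by_cases hz : (fun i => (w i, u i)) ∈ G
      · rw [Set.indicator_of_mem hz, Set.indicator_of_mem
          (show u ∈ {u : Fin n → U | (fun i => (w i, u i)) ∈ G} from hz)]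
        simp only [hQdef, Finset.prod_mul_distrib]
      · rw [Set.indicator_of_notMem hz, Set.indicator_of_notMem
          (show u ∉ {u : Fin n → U | (fun i => (w i, u i)) ∈ G} from hz), mul_zero]
    have h7 : ∑ z, G.indicator (fun z => ∏ i, Q (z i)) z ≤
        ∑ w : Fin n → W, (∏ i, T (w i)) * (1 / 2) := by
      rw [h6]
      exact Finset.sum_le_sum fun w _ => mul_le_mul_of_nonneg_left (hcon w).le
        (Finset.prod_nonneg fun i _ => hT.1 _)
    rw [← Finset.sum_mul, sum_prod_eq_one hT] at h7
    linarith
  -- Positivity of every letter is required because the pointwise bound `H` holds only on charged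
  -- cells; it removes no mass.
  set S : Set (Fin n → U) := {u | (fun i => (w i, u i)) ∈ G ∧ ∀ i, 0 < k (w i) (u i)} with hS
  have hPpos : ∀ w u, 0 < k w u → 0 < P u := fun w u h =>
    lt_of_le_of_ne measureReal_nonneg fun h0 => h.ne' ((hk w).2 u h0.symm)
  have hn' : (0 : ℝ) ≤ n := Nat.cast_nonneg n
  -- On typical words the likelihood ratio is at most `exp (n (D + ε))`, so mass `1 / 2` under `k`
  -- becomes mass at least `exp (-n (D + ε)) / 2` under `P`. The choice of `n₄` absorbs the factor
  -- two in a further `ε`.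
  have hSP : Real.exp (-(n * α)) ≤ ∑ u, S.indicator (fun u => ∏ i, P (u i)) u := by
    have h8 : ∀ u, Real.exp (-(n * (D + ε))) *
        {u : Fin n → U | (fun i => (w i, u i)) ∈ G}.indicator (fun u => ∏ i, k (w i) (u i)) u ≤
          S.indicator (fun u => ∏ i, P (u i)) u := by
      intro u
      have hnn : 0 ≤ S.indicator (fun u => ∏ i, P (u i)) u :=
        Set.indicator_nonneg (fun u _ => Finset.prod_nonneg fun i _ => measureReal_nonneg) u
      by_cases hz : (fun i => (w i, u i)) ∈ G
      · rw [Set.indicator_of_mem (show u ∈ {u : Fin n → U | (fun i => (w i, u i)) ∈ G} from hz)]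
        by_cases hpos : ∀ i, 0 < k (w i) (u i)
        · rw [Set.indicator_of_mem (show u ∈ S from ⟨hz, hpos⟩)]
          have h9 : ∑ i, Real.log (k (w i) (u i) / P (u i)) ≤ n * (D + ε) := not_lt.1 hz.2.1
          have h10 : ∏ i, k (w i) (u i) = Real.exp (∑ i, Real.log (k (w i) (u i) / P (u i))) *
              ∏ i, P (u i) := by
            rw [Real.exp_sum, ← Finset.prod_mul_distrib]
            refine Finset.prod_congr rfl fun i _ => ?_
            have := hPpos _ _ (hpos i)
            rw [Real.exp_log (div_pos (hpos i) this), div_mul_cancel₀ _ this.ne']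
          rw [h10, ← mul_assoc, ← Real.exp_add]
          refine mul_le_of_le_one_left (Finset.prod_nonneg fun i _ => measureReal_nonneg) ?_
          exact Real.exp_le_one_iff.2 (by linarith)
        · push Not at hpos
          obtain ⟨i, hi⟩ := hpos
          have h0 : k (w i) (u i) = 0 := le_antisymm hi ((hk _).1.1 _)
          rw [Finset.prod_eq_zero (Finset.mem_univ i) h0, mul_zero]
          exact hnn
      · rw [Set.indicator_of_notMem
          (show u ∉ {u : Fin n → U | (fun i => (w i, u i)) ∈ G} from hz), mul_zero]
        exact hnn
    have h9 := Finset.sum_le_sum fun u (_ : u ∈ Finset.univ) => h8 u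
    rw [← Finset.mul_sum] at h9
    refine le_trans ?_ h9
    calc Real.exp (-(n * α)) ≤ Real.exp (-(n * (D + ε))) * Real.exp (-Real.log 2) := by
          rw [← Real.exp_add]
          refine Real.exp_le_exp.2 ?_
          have h10 : (n₄ : ℝ) ≤ n := by exact_mod_cast (by omega : n₄ ≤ n)
          have h11 : Real.log 2 < n * ε := by
            rw [div_lt_iff₀ hε] at hn₄
            nlinarith
          nlinarith
      _ = Real.exp (-(n * (D + ε))) * (1 / 2) := by
          rw [Real.exp_neg (Real.log 2), Real.exp_log two_pos]; norm_num
      _ ≤ _ := mul_le_mul_of_nonneg_left hw (Real.exp_pos _).le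
  set A : Set (Fin n → X) := ⋃ u ∈ S, Set.univ.pi fun i => f ⁻¹' {u i} with hA
  have hfm : ∀ u, MeasurableSet (f ⁻¹' {u}) := fun u => hf (measurableSet_singleton u)
  have hAm : MeasurableSet A := MeasurableSet.biUnion (Set.to_countable S) fun u _ =>
    MeasurableSet.univ_pi fun i => hfm (u i)
  have hAα : ENNReal.ofReal (Real.exp (-(n * α))) ≤ Measure.pi (fun _ : Fin n => νX) A := by
    rw [hA, pi_iUnion_cells (A := fun u => f ⁻¹' {u}) hfm]
    · exact ENNReal.ofReal_le_ofReal hSP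
    · intro u v huv
      rw [Function.onFun, Set.disjoint_left]
      intro x hx hx'
      exact huv (hx.symm.trans hx')
  refine le_trans (b := Measure.pi (fun _ : Fin n => νY) (enlargement c n A (n * τ)))
    (iInf_le_of_le A (iInf_le_of_le hAm (iInf_le_of_le hAα le_rfl))) ?_
  -- The log-normalizers depend on the label word alone, so one good word `u₀` suffices to bound
  -- their sum.
  have hGne : ∃ u : Fin n → U, (fun i => (w i, u i)) ∈ G := by
    by_contra! hcon
    rw [Finset.sum_eq_zero fun u _ => Set.indicator_of_notMem
      (show u ∉ {u : Fin n → U | (fun i => (w i, u i)) ∈ G} from hcon u) _] at hw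
    linarith
  obtain ⟨u₀, hu₀⟩ := hGne
  have hLw : ∑ i, Λ (w i) ≤ n * (L + ε) := not_lt.1 hu₀.2.2
  -- Multiplying `H` over the coordinates places the enlargement in an upper level set of the
  -- product of the `g (w i)`, to which Chernoff's bound applies.
  refine (measure_mono (t := {y | Real.exp (n * (Φ - ε) - s * (n * τ)) ≤
    ∏ i, g (w i) (y i)}) ?_).trans ((pi_prod_ge_le (fun i => hg (w i)) fun i => hg0 (w i)).trans ?_)
  · rintro y ⟨x, hxA, hxy⟩
    obtain ⟨u, hu, hxu⟩ := Set.mem_iUnion₂.1 hxA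
    have hxu' : ∀ i, f (x i) = u i := fun i => hxu i (Set.mem_univ i)
    have h9 : n * (Φ - ε) ≤ ∑ i, φ (w i) (u i) := by
      have h10 : ∑ i, -φ (w i) (u i) ≤ n * (-Φ + ε) := not_lt.1 hu.1.1
      rw [Finset.sum_neg_distrib] at h10
      linarith
    have h10 : ∏ i, Real.exp (φ (w i) (u i) - s * c (x i) (y i)) ≤ ∏ i, g (w i) (y i) := by
      refine Finset.prod_le_prod (fun i _ => (Real.exp_pos _).le) fun i _ => ?_
      rw [← hxu' i]
      exact H (w i) (x i) (y i) (by rw [hxu' i]; exact hu.2 i)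
    refine le_trans ?_ h10
    rw [← Real.exp_sum]
    refine Real.exp_le_exp.2 ?_
    rw [Finset.sum_sub_distrib, ← Finset.mul_sum]
    have h11 : ∑ i, (c (x i) (y i) : ℝ) ≤ n * τ := by
      rw [addCost, NNReal.coe_sum] at hxy
      exact hxy
    have := mul_le_mul_of_nonneg_left h11 hs
    linarith
  · refine ENNReal.ofReal_le_ofReal ?_
    have h9 : ∏ i, ∫ y, g (w i) y ∂νY = Real.exp (∑ i, Λ (w i)) := by
      rw [Real.exp_sum]
      exact Finset.prod_congr rfl fun i _ => (Real.exp_log (hgpos (w i))).symm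
    rw [h9, ← Real.exp_add]
    refine Real.exp_le_exp.2 ?_
    nlinarith

end LowerCoding

end

end ThickIsoperimetry

namespace ThickIsoperimetry

noncomputable section

/-! ### Couplings built from densities on the cells -/

section CellCoupling

open InformationTheory

variable {U X Y : Type*} [MeasurableSpace U] [DiscreteMeasurableSpace U] [MeasurableSpace X]
  [MeasurableSpace Y]

section

variable [Finite U]

/-- The transition probability with density `r u / a u` with respect to `ν`. -/
def densityKernel (ν : Measure Y) (a : U → ℝ) (r : U → Y → ℝ) : Kernel U Y := by
  classical
  -- At cells of mass zero the normalization is undefined; the value `ν` keeps the kernel Markov.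
  exact ⟨fun u => if a u = 0 then ν else ν.withDensity fun y => ENNReal.ofReal (r u y / a u),
    Measurable.of_discrete⟩

end

variable {κ : Measure X} [IsProbabilityMeasure κ] {ν : Measure Y} [IsProbabilityMeasure ν]
  {f : X → U} {a : U → ℝ} {r : U → Y → ℝ}

lemma integrable_of_nonneg_of_le {g : Y → ℝ} (hg : Measurable g) (h0 : ∀ y, 0 ≤ g y) {C : ℝ}
    (hC : ∀ y, g y ≤ C) : Integrable g ν :=
  Integrable.of_bound hg.aestronglyMeasurable C (ae_of_all _ fun y => by
    rw [Real.norm_of_nonneg (h0 y)]; exact hC y)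

lemma isMarkovKernel_densityKernel [Finite U] (hr : ∀ u, Measurable (r u)) (h0 : ∀ u y, 0 ≤ r u y) {C : ℝ}
    (hC : ∀ u y, r u y ≤ C) (ha : ∀ u, ∫ y, r u y ∂ν = a u) :
    IsMarkovKernel (densityKernel ν a r) := by
  refine ⟨fun u => ⟨?_⟩⟩
  have h := ha u
  have ha0 : 0 ≤ a u := h ▸ integral_nonneg (h0 u)
  change (if a u = 0 then ν else _) Set.univ = 1
  split_ifs with hu
  · simp
  · rw [withDensity_apply _ MeasurableSet.univ, setLIntegral_univ,
      ← ofReal_integral_eq_lintegral_ofReal, integral_div, h, div_self hu, ENNReal.ofReal_one]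
    · exact (integrable_of_nonneg_of_le (hr u) (h0 u) (hC u)).div_const _
    · exact ae_of_all _ fun y => div_nonneg (h0 u y) ha0

variable [Fintype U]

/-- The mass of a cell cancels the normalization of the kernel. On a null cell the left side
vanishes, and so does the right because `r u` is null. -/
lemma lintegral_densityKernel (hf : Measurable f) (hr : ∀ u, Measurable (r u))
    (h0 : ∀ u y, 0 ≤ r u y) {C : ℝ} (hC : ∀ u y, r u y ≤ C)
    (ha : ∀ u, ∫ y, r u y ∂ν = κ.real (f ⁻¹' {u})) {F : U → Y → ℝ≥0∞}
    (hF : ∀ u, Measurable (F u)) :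
    ∫⁻ x, ∫⁻ y, F (f x) y ∂(densityKernel ν (fun u => κ.real (f ⁻¹' {u})) r (f x)) ∂κ =
      ∑ u, ∫⁻ y, F u y * ENNReal.ofReal (r u y) ∂ν := by
  have hm : Measurable fun u =>
      ∫⁻ y, F u y ∂(densityKernel ν (fun u => κ.real (f ⁻¹' {u})) r u) := Measurable.of_discrete
  have h1 := lintegral_map (μ := κ) hm hf
  rw [← h1, lintegral_fintype]
  refine Finset.sum_congr rfl fun u _ => ?_
  rw [Measure.map_apply hf (measurableSet_singleton u)]
  change (∫⁻ y, F u y ∂(if κ.real (f ⁻¹' {u}) = 0 then ν else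
    ν.withDensity fun y => ENNReal.ofReal (r u y / κ.real (f ⁻¹' {u})))) * _ = _
  split_ifs with hu
  · have h2 : κ (f ⁻¹' {u}) = 0 := by
      rw [measureReal_def, ENNReal.toReal_eq_zero_iff] at hu
      exact hu.resolve_right (measure_ne_top _ _)
    have h3 : r u =ᵐ[ν] 0 := by
      rw [← integral_eq_zero_iff_of_nonneg (h0 u)
        (integrable_of_nonneg_of_le (hr u) (h0 u) (hC u)), ha u, hu]
    rw [h2, mul_zero, lintegral_congr_ae (g := fun _ => 0), lintegral_zero]
    filter_upwards [h3] with y hy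
    simp [hy]
  · have hpos : 0 < κ.real (f ⁻¹' {u}) := lt_of_le_of_ne measureReal_nonneg (Ne.symm hu)
    rw [lintegral_withDensity_eq_lintegral_mul _ ((hr u).div_const _).ennreal_ofReal (hF u),
      ← lintegral_mul_const' _ _ (measure_ne_top _ _)]
    refine lintegral_congr fun y => ?_
    have h2 : κ (f ⁻¹' {u}) = ENNReal.ofReal (κ.real (f ⁻¹' {u})) := by simp
    rw [Pi.mul_apply, h2, mul_comm (ENNReal.ofReal (r u y / _)), mul_assoc, ← ENNReal.ofReal_mul
      (div_nonneg (h0 u y) hpos.le), div_mul_cancel₀ _ hu]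

/-- Densities whose masses are the probabilities of the cells define a coupling. -/
lemma reach_of_densities (hf : Measurable f) (hr : ∀ u, Measurable (r u))
    (h0 : ∀ u y, 0 ≤ r u y) {C : ℝ} (hC : ∀ u y, r u y ≤ C)
    (ha : ∀ u, ∫ y, r u y ∂ν = κ.real (f ⁻¹' {u})) {c : X → Y → ℝ≥0}
    (hc : Measurable fun z : X × Y => (c z.1 z.2 : ℝ≥0∞)) {V : U → Y → ℝ}
    (hV : ∀ u, Measurable (V u)) (hV0 : ∀ u y, 0 ≤ V u y)
    (hVC : ∀ u, Integrable (fun y => V u y * r u y) ν)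
    (hcV : ∀ᵐ x ∂κ, ∀ y, (c x y : ℝ) ≤ V (f x) y) :
    Reach c ν κ (∫ y, (∑ u, r u y) * Real.log (∑ u, r u y) ∂ν) (∑ u, ∫ y, V u y * r u y ∂ν) := by
  set R : Y → ℝ := fun y => ∑ u, r u y with hR
  have hRm : Measurable R := Finset.measurable_sum _ fun u _ => hr u
  have hR0 : ∀ y, 0 ≤ R y := fun y => Finset.sum_nonneg fun u _ => h0 u y
  have hRC : ∀ y, R y ≤ ∑ _u : U, C := fun y => Finset.sum_le_sum fun u _ => hC u y
  have hRi : Integrable R ν := integrable_of_nonneg_of_le hRm hR0 hRC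
  have hR1 : ∫ y, R y ∂ν = 1 := by
    simp only [hR]
    rw [integral_finsetSum _ fun u _ => integrable_of_nonneg_of_le (hr u) (h0 u) (hC u)]
    simp only [ha]
    rw [← measureReal_iUnion_fintype]
    · rw [show (⋃ u, f ⁻¹' {u}) = Set.univ from Set.eq_univ_of_forall fun x =>
        Set.mem_iUnion.2 ⟨f x, rfl⟩]
      simp
    · intro u v huv
      rw [Function.onFun, Set.disjoint_left]
      intro x hx hx'
      exact huv (hx.symm.trans hx')
    · exact fun u => hf (measurableSet_singleton u)
  set q := densityKernel ν (fun u => κ.real (f ⁻¹' {u})) r with hq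
  have hqM : IsMarkovKernel q := isMarkovKernel_densityKernel hr h0 hC ha
  -- The second coordinate is drawn with a law depending only on the cell of the first. Its marginal
  -- density is the sum of the `r u`, and the cost is at most that of the cellwise bound `V`.
  set π : Measure (X × Y) := κ ⊗ₘ (q.comap f hf) with hπ
  have hfst : π.fst = κ := Measure.fst_compProd _ _
  have hsnd : π.snd = ν.withDensity fun y => ENNReal.ofReal (R y) := by
    ext s hs
    rw [Measure.snd_apply hs, hπ, Measure.compProd_apply (measurable_snd hs)]
    have h1 := lintegral_densityKernel (F := fun _ => s.indicator 1) hf hr h0 hC ha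
      fun _ => measurable_one.indicator hs
    simp only [lintegral_indicator_one hs] at h1
    have h2 : ∀ x, (q.comap f hf x) (Prod.mk x ⁻¹' (Prod.snd ⁻¹' s)) = q (f x) s := fun x => rfl
    simp only [h2]
    rw [h1, withDensity_apply _ hs, ← lintegral_indicator hs, ← lintegral_finsetSum]
    · refine lintegral_congr fun y => ?_
      by_cases hy : y ∈ s
      · simp only [Set.indicator_of_mem hy, Pi.one_apply, one_mul]
        rw [ENNReal.ofReal_sum_of_nonneg fun u _ => h0 u y]
      · simp [Set.indicator_of_notMem hy]
    · exact fun u _ => (measurable_one.indicator hs).mul (hr u).ennreal_ofReal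
  have hcost : ∫⁻ z, (c z.1 z.2 : ℝ≥0∞) ∂π ≤ ENNReal.ofReal (∑ u, ∫ y, V u y * r u y ∂ν) := by
    rw [hπ, Measure.lintegral_compProd hc]
    have h1 := lintegral_densityKernel (F := fun u y => ENNReal.ofReal (V u y)) hf hr h0 hC ha
      fun u => (hV u).ennreal_ofReal
    calc ∫⁻ x, ∫⁻ y, (c x y : ℝ≥0∞) ∂(q.comap f hf x) ∂κ
        ≤ ∫⁻ x, ∫⁻ y, ENNReal.ofReal (V (f x) y) ∂(q (f x)) ∂κ := by
          refine lintegral_mono_ae ?_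
          filter_upwards [hcV] with x hx
          refine lintegral_mono fun y => ?_
          rw [← ENNReal.ofReal_coe_nnreal]
          exact ENNReal.ofReal_le_ofReal (hx y)
      _ = ∑ u, ∫⁻ y, ENNReal.ofReal (V u y) * ENNReal.ofReal (r u y) ∂ν := h1
      _ = ENNReal.ofReal (∑ u, ∫ y, V u y * r u y ∂ν) := by
          rw [ENNReal.ofReal_sum_of_nonneg fun u _ => integral_nonneg fun y =>
            mul_nonneg (hV0 u y) (h0 u y)]
          refine Finset.sum_congr rfl fun u _ => ?_
          rw [ofReal_integral_eq_lintegral_ofReal (hVC u)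
            (ae_of_all _ fun y => mul_nonneg (hV0 u y) (h0 u y))]
          exact lintegral_congr fun y => (ENNReal.ofReal_mul (hV0 u y)).symm
      _ ≤ _ := le_rfl
  refine ⟨?_, Finset.sum_nonneg fun u _ => integral_nonneg fun y => mul_nonneg (hV0 u y) (h0 u y),
    ν.withDensity fun y => ENNReal.ofReal (R y), ?_, ?_, ?_⟩
  · obtain ⟨M, hM⟩ : ∃ M, ∀ x ∈ Set.Icc (0 : ℝ) (∑ _u : U, C), ‖x * Real.log x‖ ≤ M :=
      isCompact_Icc.exists_bound_of_continuousOn Real.continuous_mul_log.continuousOn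
    have hi : Integrable (fun y => R y * Real.log (R y)) ν :=
      Integrable.of_bound (hRm.mul (Real.measurable_log.comp hRm)).aestronglyMeasurable M
        (ae_of_all _ fun y => hM _ ⟨hR0 y, hRC y⟩)
    have h2 : ∫ y, (R y - 1) ∂ν ≤ ∫ y, R y * Real.log (R y) ∂ν := by
      refine integral_mono (hRi.sub (integrable_const _)) hi fun y => ?_
      rcases (hR0 y).eq_or_lt with h | h
      · simp [← h]
      · have h3 := Real.one_sub_inv_le_log_of_pos h
        have h4 := mul_le_mul_of_nonneg_left h3 h.le
        rw [mul_sub, mul_inv_cancel₀ h.ne', mul_one] at h4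
        exact h4
    rw [integral_sub hRi (integrable_const _), hR1] at h2
    simpa using h2
  · rw [← hsnd]
    infer_instance
  · exact (klDiv_withDensity hRm hR0 hRC hR1).le
  · exact (transportCost_le π hfst hsnd).trans hcost

end CellCoupling

/-! ### Potentials for a discretized law -/

section CellPotential

variable {U X : Type*} [Fintype U] [MeasurableSpace U] [DiscreteMeasurableSpace U]
  [MetricSpace X] [SecondCountableTopology X] [MeasurableSpace X] [BorelSpace X]

lemma measurable_distCost (p : ℝ) : Measurable fun z : X × X => (distCost X p z.1 z.2 : ℝ≥0∞) := by
  simp only [coe_distCost_ennreal]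
  exact ((measurable_fst.dist measurable_snd).pow_const p).ennreal_ofReal

/-- A potential for the discretized problem. -/
lemma exists_cell_potential {κ ν : Measure X} [IsProbabilityMeasure κ] [IsProbabilityMeasure ν]
    {f : X → U} (hf : Measurable f) {p : ℝ} {a : U → X} {σ δ : ℝ} (hσ : 0 ≤ σ) (hδ : 0 ≤ δ)
    (hκ : ∀ᵐ x ∂κ, ∀ y, dist x y ^ p ≤ (1 + σ) * dist (a (f x)) y ^ p + δ) {l m ε : ℝ}
    (hl : 0 < l) (hε : 0 < ε) (hm : ∀ u v, Reach (distCost X p) ν κ u v → m ≤ u + l * v) :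
    ∃ (φ : U → ℝ) (g : X → ℝ), Integrable g ν ∧ (∀ y, 0 < g y) ∧
      (∀ u y, 0 < κ.real (f ⁻¹' {u}) →
        Real.exp (φ u - l * ((1 + σ) * dist (a u) y ^ p)) ≤ g y) ∧
      m - l * δ - ε ≤ ∑ u, κ.real (f ⁻¹' {u}) * φ u - Real.log (∫ y, g y ∂ν) := by
  classical
  set k : U → ℝ := fun u => κ.real (f ⁻¹' {u}) with hk
  have hk0 : ∀ u, 0 ≤ k u := fun u => measureReal_nonneg
  have hk1 : ∑ u, k u = 1 := by
    simp only [hk]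
    rw [← measureReal_iUnion_fintype]
    · rw [show (⋃ u, f ⁻¹' {u}) = Set.univ from Set.eq_univ_of_forall fun x =>
        Set.mem_iUnion.2 ⟨f x, rfl⟩]
      simp
    · intro u v huv
      rw [Function.onFun, Set.disjoint_left]
      intro x hx hx'
      exact huv (hx.symm.trans hx')
    · exact fun u => hf (measurableSet_singleton u)
  -- Duality needs positive masses, so the problem is restricted to the charged cells.
  have hsub : ∀ F : U → ℝ, (∀ u, ¬ 0 < k u → F u = 0) →
      ∑ u : {u // 0 < k u}, F u = ∑ u, F u := by
    intro F hF
    rw [← Fintype.sum_subtype_add_sum_subtype (fun u => 0 < k u) F]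
    rw [Finset.sum_eq_zero fun (u : {u // ¬ 0 < k u}) _ => hF u u.2, add_zero]
  have hne : Nonempty {u // 0 < k u} := by
    by_contra h
    rw [not_nonempty_iff] at h
    have h1 : ∑ u, k u = 0 := Finset.sum_eq_zero fun u _ =>
      le_antisymm (not_lt.1 fun hu => h.false ⟨u, hu⟩) (hk0 u)
    rw [hk1] at h1
    exact one_ne_zero h1
  have hbm : ∀ u : U, Measurable fun y => l * ((1 + σ) * dist (a u) y ^ p) := fun u =>
    (((measurable_const.dist measurable_id).pow_const p).const_mul _).const_mul _
  have hd0 : ∀ (u : U) y, 0 ≤ (1 + σ) * dist (a u) y ^ p := fun u y => by positivity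
  obtain ⟨φ, g, -, hgi, hφg, hφm⟩ := exists_potential (ν := ν)
    (b := fun (u : {u // 0 < k u}) y => l * ((1 + σ) * dist (a u) y ^ p)) (fun u => hbm u)
    (fun u y => mul_nonneg hl.le (hd0 u y)) (a := fun u => k u) (fun u => u.2)
    (by rw [hsub k fun u hu => le_antisymm (not_lt.1 hu) (hk0 u), hk1]) (m := m - l * δ) hε (by
      intro r C hr hr0 hrC hbrC hra
      set r' : U → X → ℝ := fun u y => if h : 0 < k u then r ⟨u, h⟩ y else 0 with hr'
      have hC0 : 0 ≤ C := by
        obtain ⟨u⟩ := hne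
        exact (hr0 u (a u)).trans (hrC u (a u))
      have hr'p : ∀ u (h : 0 < k u), r' u = r ⟨u, h⟩ := fun u h => by
        funext y; simp only [hr', h, dif_pos]
      have hr'n : ∀ u, ¬ 0 < k u → r' u = 0 := fun u h => by
        funext y; simp only [hr', h, dif_neg, not_false_eq_true, Pi.zero_apply]
      have hr'm : ∀ u, Measurable (r' u) := fun u => by
        by_cases h : 0 < k u
        · rw [hr'p u h]; exact hr _
        · rw [hr'n u h]; exact measurable_const
      have hr'0 : ∀ u y, 0 ≤ r' u y := fun u y => by
        by_cases h : 0 < k u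
        · rw [hr'p u h]; exact hr0 _ _
        · rw [hr'n u h]; exact le_rfl
      have hr'C : ∀ u y, r' u y ≤ C := fun u y => by
        by_cases h : 0 < k u
        · rw [hr'p u h]; exact hrC _ _
        · rw [hr'n u h]; exact hC0
      have hr'a : ∀ u, ∫ y, r' u y ∂ν = k u := fun u => by
        by_cases h : 0 < k u
        · rw [hr'p u h]; exact hra _
        · rw [hr'n u h]; simpa using (le_antisymm (not_lt.1 h) (hk0 u)).symm
      have hbr' : ∀ u, Integrable (fun y => (1 + σ) * dist (a u) y ^ p * r' u y) ν := fun u => by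
        refine integrable_of_nonneg_of_le (C := C / l) ((((measurable_const.dist
          measurable_id).pow_const p).const_mul _).mul (hr'm u))
          (fun y => mul_nonneg (hd0 u y) (hr'0 u y)) fun y => ?_
        rw [le_div_iff₀ hl]
        by_cases h : 0 < k u
        · rw [hr'p u h]
          have := hbrC ⟨u, h⟩ y
          linarith
        · rw [hr'n u h]; simpa using hC0
      have hr'i : ∀ u, Integrable (r' u) ν := fun u =>
        integrable_of_nonneg_of_le (hr'm u) (hr'0 u) (hr'C u)
      have e0 : ∀ u, (fun y => ((1 + σ) * dist (a u) y ^ p + δ) * r' u y) =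
          fun y => (1 + σ) * dist (a u) y ^ p * r' u y + δ * r' u y := fun u => by
        funext y; ring
      -- Any admissible densities, extended by zero to the uncharged cells, produce a reachable
      -- pair. The assumed bound on reachable pairs thus becomes the primal bound of
      -- `exists_potential`, lowered by `l * δ`.
      have hreach := reach_of_densities (κ := κ) (V := fun u y => (1 + σ) * dist (a u) y ^ p + δ) hf
        hr'm hr'0 hr'C hr'a (measurable_distCost p)
        (fun u => (((measurable_const.dist measurable_id).pow_const p).const_mul _).add_const _)
        (fun u y => add_nonneg (hd0 u y) hδ)
        (fun u => by rw [e0]; exact (hbr' u).add ((hr'i u).const_mul δ))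
        (by filter_upwards [hκ] with x hx y
            rw [coe_distCost]; exact hx y)
      have h1 := hm _ _ hreach
      have h2 : ∑ u, ∫ y, ((1 + σ) * dist (a u) y ^ p + δ) * r' u y ∂ν =
          ∑ u, ∫ y, (1 + σ) * dist (a u) y ^ p * r' u y ∂ν + δ := by
        have : ∀ u, ∫ y, ((1 + σ) * dist (a u) y ^ p + δ) * r' u y ∂ν =
            ∫ y, (1 + σ) * dist (a u) y ^ p * r' u y ∂ν + δ * k u := fun u => by
          rw [e0, integral_add (hbr' u) ((hr'i u).const_mul δ), integral_const_mul, hr'a]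
        simp only [this, Finset.sum_add_distrib, ← Finset.mul_sum, hk1, mul_one]
      have h3 : ∀ y, ∑ u, r' u y = ∑ u, r u y := fun y => by
        rw [← hsub (fun u => r' u y) fun u hu => by rw [hr'n u hu]; rfl]
        exact Finset.sum_congr rfl fun u _ => by rw [hr'p u u.2]
      have h4 : l * ∑ u, ∫ y, (1 + σ) * dist (a u) y ^ p * r' u y ∂ν =
          ∑ u : {u // 0 < k u}, ∫ y, l * ((1 + σ) * dist (a u) y ^ p) * r u y ∂ν := by
        rw [← hsub (fun u => ∫ y, (1 + σ) * dist (a u) y ^ p * r' u y ∂ν) fun u hu => by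
          rw [hr'n u hu]; simp, Finset.mul_sum]
        refine Finset.sum_congr rfl fun u _ => ?_
        rw [hr'p u u.2, ← integral_const_mul]
        exact integral_congr_ae (ae_of_all _ fun y => by ring)
      simp only [h2, h3, mul_add, h4] at h1
      linarith)
  refine ⟨fun u => if h : 0 < k u then φ ⟨u, h⟩ else 0, g, hgi, fun y =>
    (Real.exp_pos _).trans_le (hφg (Classical.arbitrary _) y), fun u y hu => ?_, ?_⟩
  · have hu' : 0 < k u := hu
    simp only [hu', dif_pos]
    exact hφg ⟨u, hu⟩ y
  · rw [← hsub (fun u => k u * if h : 0 < k u then φ ⟨u, h⟩ else 0) fun u hu => by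
      rw [dif_neg hu, mul_zero]]
    convert hφm using 4 with u
    rw [dif_pos u.2]

end CellPotential

end

end ThickIsoperimetry

namespace ThickIsoperimetry

noncomputable section

/-! ### Reachable pairs of compactly supported laws -/

section LowerBound

open InformationTheory

variable {X : Type*} [MetricSpace X] [SecondCountableTopology X] [MeasurableSpace X]
  [BorelSpace X]

lemma exists_reach_of_concentratedOnCompact {p : ℝ} (hp : 1 ≤ p) (x₀ : X) (νY : Measure X)
    [IsProbabilityMeasure νY] (κ : Measure X) [IsProbabilityMeasure κ]
    (hκ : ConcentratedOnCompact κ) : ∃ u v, Reach (distCost X p) νY κ u v := by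
  obtain ⟨K, hK, hK0⟩ := hκ
  obtain ⟨R, hR⟩ := hK.isBounded.subset_closedBall x₀
  exact exists_reach_of_bounded hp x₀ R νY κ
    (measure_mono_null (Set.compl_subset_compl.2 hR) hK0)

/-- Reachability at a positive weight is enough for the weighted values. -/
lemma exists_reach_weighted {p : ℝ} (hp : 1 ≤ p) (x₀ : X) {νY : Measure X}
    [IsProbabilityMeasure νY] {κ : Measure X} [IsProbabilityMeasure κ]
    (hκ : ConcentratedOnCompact κ) {r u v : ℝ} (hr : 0 ≤ r)
    (h : 0 < r → Reach (distCost X p) νY κ u v) :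
    ∃ u' v', Reach (distCost X p) νY κ u' v' ∧ r * u' = r * u ∧ r * v' = r * v := by
  rcases hr.eq_or_lt with h0 | h0
  · obtain ⟨u', v', h'⟩ := exists_reach_of_concentratedOnCompact hp x₀ νY κ hκ
    exact ⟨u', v', h', by rw [← h0]; ring, by rw [← h0]; ring⟩
  · exact ⟨u, v, h h0, rfl, rfl⟩

end LowerBound

/-! ### Lagrange multipliers and passage to cells -/

section Discretization

open InformationTheory

variable {X : Type*} [MeasurableSpace X]

/-- A Lagrange multiplier for the transport constraint. -/
lemma exists_multiplier {c : X → X → ℝ≥0} {ν : Measure X} [IsProbabilityMeasure ν]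
    {κ₀ κ₁ : Measure X} {a b m τ : ℝ}
    (hm : ∀ u₀ v₀ u₁ v₁ : ℝ, Reach c ν κ₀ u₀ v₀ → Reach c ν κ₁ u₁ v₁ →
      a * v₀ + b * v₁ ≤ τ → m < a * u₀ + b * u₁)
    {u₀ v₀ u₁ v₁ : ℝ} (h₀ : Reach c ν κ₀ u₀ v₀) (h₁ : Reach c ν κ₁ u₁ v₁)
    (hv : a * v₀ + b * v₁ < τ) :
    ∃ l : ℝ, 0 ≤ l ∧ ∀ u₀ v₀ u₁ v₁ : ℝ, Reach c ν κ₀ u₀ v₀ → Reach c ν κ₁ u₁ v₁ →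
      m + l * τ ≤ a * (u₀ + l * v₀) + b * (u₁ + l * v₁) := by
  set S : Set (Fin 2 → ℝ) := {s | ∃ u₀ v₀ u₁ v₁ : ℝ, Reach c ν κ₀ u₀ v₀ ∧ Reach c ν κ₁ u₁ v₁ ∧
    s = ![a * u₀ + b * u₁, a * v₀ + b * v₁]} with hS
  obtain ⟨w, hw0, hwne, hw⟩ := exists_nonneg_weights (S := S) (z := ![m, τ])
    ⟨_, u₀, v₀, u₁, v₁, h₀, h₁, rfl⟩ (by
      rintro _ ⟨u₀, v₀, u₁, v₁, h₀, h₁, rfl⟩ _ ⟨u₀', v₀', u₁', v₁', h₀', h₁', rfl⟩ r s hr hs hrs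
      refine ⟨_, ⟨_, _, _, _, h₀.mix h₀' hr.le hs.le hrs, h₁.mix h₁' hr.le hs.le hrs, rfl⟩, ?_⟩
      intro i
      fin_cases i
      · simp; linarith
      · simp; linarith) (by
      rintro ⟨_, ⟨u₀, v₀, u₁, v₁, h₀, h₁, rfl⟩, hlt⟩
      have e0 := hlt 0
      have e1 := hlt 1
      simp at e0 e1
      exact absurd (hm _ _ _ _ h₀ h₁ e1.le) (not_lt.2 e0.le))
  have hw' : ∀ u₀ v₀ u₁ v₁ : ℝ, Reach c ν κ₀ u₀ v₀ → Reach c ν κ₁ u₁ v₁ →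
      w 0 * m + w 1 * τ ≤ w 0 * (a * u₀ + b * u₁) + w 1 * (a * v₀ + b * v₁) := by
    intro u₀ v₀ u₁ v₁ h₀ h₁
    have := hw _ ⟨u₀, v₀, u₁, v₁, h₀, h₁, rfl⟩
    simpa [Fin.sum_univ_two] using this
  -- Slater's condition: the strictly feasible pair excludes a separating functional that sees only
  -- the cost.
  have hw00 : w 0 ≠ 0 := by
    intro h
    have h1 := hw' _ _ _ _ h₀ h₁
    rw [h] at h1
    have h2 : w 1 ≠ 0 := fun h' => hwne (funext fun i => by fin_cases i <;> simp [h, h'])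
    have h3 : 0 < w 1 := lt_of_le_of_ne (hw0 1) h2.symm
    have := mul_lt_mul_of_pos_left hv h3
    linarith
  have hpos : 0 < w 0 := lt_of_le_of_ne (hw0 0) hw00.symm
  refine ⟨w 1 / w 0, div_nonneg (hw0 1) hpos.le, fun u₀ v₀ u₁ v₁ h₀ h₁ => ?_⟩
  have h1 := hw' _ _ _ _ h₀ h₁
  have h2 : w 0 * (w 1 / w 0) = w 1 := mul_div_cancel₀ _ hw00
  refine le_of_mul_le_mul_left ?_ hpos
  calc w 0 * (m + w 1 / w 0 * τ) = w 0 * m + (w 0 * (w 1 / w 0)) * τ := by ring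
    _ ≤ w 0 * (a * u₀ + b * u₁) + (w 0 * (w 1 / w 0)) * (a * v₀ + b * v₁) := by rw [h2]; exact h1
    _ = _ := by ring

/-- Data processing: merging points into cells cannot increase relative entropy. The cells cover the
space, so `finDiv_cells_le` has no residual term. -/
lemma finDiv_preimage_le {U : Type*} [Fintype U] [MeasurableSpace U] [DiscreteMeasurableSpace U]
    {κ ν : Measure X} [IsProbabilityMeasure κ] [IsProbabilityMeasure ν] {d : ℝ} (hd0 : 0 ≤ d)
    (hd : klDiv κ ν ≤ ENNReal.ofReal d) {f : X → U} (hf : Measurable f) :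
    finDiv (fun u => κ.real (f ⁻¹' {u})) (fun u => ν.real (f ⁻¹' {u})) ≤ d := by
  have h := finDiv_cells_le hd0 hd (A := fun u => f ⁻¹' {u})
    (fun u => hf (measurableSet_singleton u)) (by
      intro u v huv
      rw [Function.onFun, Set.disjoint_left]
      intro x hx hx'
      exact huv (hx.symm.trans hx')) (E := Set.univ)
    (Set.eq_univ_of_forall fun x => Set.mem_iUnion.2 ⟨f x, rfl⟩).symm (by simp)
  simpa using h

lemma preimage_mem_stdSimplex {U : Type*} [Fintype U] [MeasurableSpace U]
    [DiscreteMeasurableSpace U] (κ : Measure X) [IsProbabilityMeasure κ] {f : X → U}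
    (hf : Measurable f) : (fun u => κ.real (f ⁻¹' {u})) ∈ stdSimplex ℝ U := by
  refine ⟨fun u => measureReal_nonneg, ?_⟩
  rw [← measureReal_iUnion_fintype]
  · rw [show (⋃ u, f ⁻¹' {u}) = Set.univ from Set.eq_univ_of_forall fun x =>
      Set.mem_iUnion.2 ⟨f x, rfl⟩]
    simp
  · intro u v huv
    rw [Function.onFun, Set.disjoint_left]
    intro x hx hx'
    exact huv (hx.symm.trans hx')
  · exact fun u => hf (measurableSet_singleton u)

lemma preimage_mem_supportedSimplex {U : Type*} [Fintype U] [MeasurableSpace U]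
    [DiscreteMeasurableSpace U] {κ ν : Measure X} [IsProbabilityMeasure κ]
    [IsProbabilityMeasure ν] (h : κ ≪ ν) {f : X → U} (hf : Measurable f) :
    (fun u => κ.real (f ⁻¹' {u})) ∈ supportedSimplex fun u => ν.real (f ⁻¹' {u}) := by
  refine ⟨preimage_mem_stdSimplex κ hf, fun u hu => ?_⟩
  rw [measureReal_eq_zero_iff] at hu ⊢
  exact h hu

end Discretization

/-! ### Lower bound on the exponent -/

section LowerBound

open InformationTheory

variable {X : Type*} [MetricSpace X] [SecondCountableTopology X] [MeasurableSpace X]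
  [BorelSpace X]

/-- The lower bound on the isoperimetric exponent. -/
theorem isoFun_le {p : ℝ} (hp : 1 ≤ p) (x₀ : X) {νX νY : Measure X}
    [IsProbabilityMeasure νX] [IsProbabilityMeasure νY] {α t τ m ε : ℝ} (hα : 0 < α) (ht : 0 ≤ t)
    (htτ : t < τ) (hm : 0 ≤ m) (hε : 0 < ε) (hψt : psi (distCost X p) νX νY α t < ⊤)
    (hψ : ENNReal.ofReal m < psi (distCost X p) νX νY α τ) :
    ∃ n₀ : ℕ, ∀ n ≥ n₀, isoFun (distCost X p) νX νY n (Real.exp (-(n * α))) (n * τ) ≤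
      ENNReal.ofReal (Real.exp (-(n * (m - ε)))) := by
  obtain ⟨κ₀, κ₁, a, b, d₀, d₁, hκ₀, hκ₁, hc₀, hc₁, ha, hb, hab, hd₀0, hd₁0, hd₀, hd₁, hd, hfam⟩ :=
    exists_family_of_lt_psi hα.le hm hψ
  -- Finiteness at the smaller constraint `t < τ` yields the strictly feasible pair needed for the
  -- multiplier.
  have hBt : psi (distCost X p) νX νY α t <
      ENNReal.ofReal ((psi (distCost X p) νX νY α t).toReal + 1) := by
    rw [ENNReal.ofReal_add ENNReal.toReal_nonneg zero_le_one, ENNReal.ofReal_toReal hψt.ne]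
    exact ENNReal.lt_add_right hψt.ne (by simp)
  obtain ⟨u₀', v₀', u₁', v₁', h₀', h₁', -, hv'⟩ := exists_reach_of_psi_lt ht hc₀ hc₁ hd₀0 hd₁0 hd₀
    hd₁ ha hb hab hd hBt
  obtain ⟨u₀, v₀, h₀, -, hv₀⟩ := exists_reach_weighted hp x₀ hc₀ ha h₀'
  obtain ⟨u₁, v₁, h₁, -, hv₁⟩ := exists_reach_weighted hp x₀ hc₁ hb h₁'
  obtain ⟨l, hl, hlm⟩ := exists_multiplier hfam h₀ h₁ (by rw [hv₀, hv₁]; linarith)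
  obtain ⟨η, hη, hη1, hηm⟩ : ∃ η : ℝ, 0 < η ∧ η < 1 ∧ m - ε <
      (1 - η) * (m + l * τ - 2 * η - (l + η) * η - (l + η) * (1 + η) * η) -
        (l + η) * (1 + η) ^ 2 * τ := by
    have h1 : ∀ᶠ η : ℝ in 𝓝[>] 0, m - ε <
        (1 - η) * (m + l * τ - 2 * η - (l + η) * η - (l + η) * (1 + η) * η) -
          (l + η) * (1 + η) ^ 2 * τ := by
      have hc : Continuous fun η : ℝ =>
          (1 - η) * (m + l * τ - 2 * η - (l + η) * η - (l + η) * (1 + η) * η) -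
            (l + η) * (1 + η) ^ 2 * τ := by fun_prop
      exact (hc.continuousAt.eventually (lt_mem_nhds (by simp [hε]))).filter_mono
        nhdsWithin_le_nhds
    have h3 : ∀ᶠ σ : ℝ in 𝓝[>] 0, σ < 1 :=
      Filter.Eventually.filter_mono nhdsWithin_le_nhds (gt_mem_nhds one_pos)
    have h4 : ∀ᶠ σ : ℝ in 𝓝[>] 0, 0 < σ := self_mem_nhdsWithin
    obtain ⟨σ, h⟩ := (h4.and (h3.and h1)).exists
    exact ⟨σ, h.1, h.2.1, h.2.2⟩
  have hη1' : 0 < 1 - η := by linarith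
  -- The multiplier may be zero, but the potentials require a positive one; enlarging it is harmless
  -- since costs are nonnegative.
  set l' := l + η with hl'
  have hl'0 : 0 < l' := by linarith
  -- The Lagrangian bound for the pair of laws is split into a separate optimal value for each, so
  -- that each gets its own potential.
  have hinf : ∀ {κ : Measure X}, IsProbabilityMeasure κ → ConcentratedOnCompact κ →
      ∃ M u v, Reach (distCost X p) νY κ u v ∧ u + l' * v ≤ M + η ∧
        ∀ u v, Reach (distCost X p) νY κ u v → M ≤ u + l' * v := by
    intro κ hκ hc
    set G : Set ℝ := {x | ∃ u v, Reach (distCost X p) νY κ u v ∧ x = u + l' * v} with hG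
    have hGne : G.Nonempty := by
      obtain ⟨u, v, h⟩ := exists_reach_of_concentratedOnCompact hp x₀ νY κ hc
      exact ⟨_, u, v, h, rfl⟩
    have hGb : BddBelow G := ⟨0, by
      rintro _ ⟨u, v, h, rfl⟩
      exact add_nonneg h.1 (mul_nonneg hl'0.le h.2.1)⟩
    obtain ⟨_, ⟨u, v, h, rfl⟩, hlt⟩ := exists_lt_of_csInf_lt hGne (show sInf G < sInf G + η by
      linarith)
    exact ⟨sInf G, u, v, h, hlt.le, fun u v h => csInf_le hGb ⟨u, v, h, rfl⟩⟩
  obtain ⟨M₀, w₀, z₀, hw₀, hM₀, hM₀'⟩ := hinf hκ₀ hc₀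
  obtain ⟨M₁, w₁, z₁, hw₁, hM₁, hM₁'⟩ := hinf hκ₁ hc₁
  have hMM : m + l * τ - η ≤ a * M₀ + b * M₁ := by
    have h1 := hlm _ _ _ _ hw₀ hw₁
    have h2 : l * z₀ ≤ l' * z₀ := mul_le_mul_of_nonneg_right (by linarith) hw₀.2.1
    have h3 : l * z₁ ≤ l' * z₁ := mul_le_mul_of_nonneg_right (by linarith) hw₁.2.1
    have h4 : a * (w₀ + l * z₀) ≤ a * (M₀ + η) := mul_le_mul_of_nonneg_left (by linarith) ha
    have h5 : b * (w₁ + l * z₁) ≤ b * (M₁ + η) := mul_le_mul_of_nonneg_left (by linarith) hb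
    have h6 : a * (M₀ + η) + b * (M₁ + η) = a * M₀ + b * M₁ + (a + b) * η := by ring
    rw [hab] at h6
    linarith
  obtain ⟨L, hL, hLp⟩ := exists_add_rpow_le hp hη
  have hp0 : 0 < p := by linarith
  obtain ⟨h, hh, hLh⟩ : ∃ h : ℝ, 0 < h ∧ L * h ^ p ≤ η := by
    refine ⟨(η / L) ^ (1 / p), Real.rpow_pos_of_pos (by positivity) _, ?_⟩
    rw [← Real.rpow_mul (by positivity), one_div_mul_cancel hp0.ne', Real.rpow_one,
      mul_div_cancel₀ _ hL.ne']
  obtain ⟨K₀, hK₀, hK₀'⟩ := hc₀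
  obtain ⟨K₁, hK₁, hK₁'⟩ := hc₁
  obtain ⟨N, f, x, hf, -, hfK, hfK'⟩ := exists_partition x₀ (hK₀.union hK₁) hh
  have hκK₀ : κ₀ (K₀ ∪ K₁)ᶜ = 0 := measure_mono_null
    (Set.compl_subset_compl.2 Set.subset_union_left) hK₀'
  have hκK₁ : κ₁ (K₀ ∪ K₁)ᶜ = 0 := measure_mono_null
    (Set.compl_subset_compl.2 Set.subset_union_right) hK₁'
  have hclose : ∀ z z' y : X, dist z z' ≤ h → dist z y ^ p ≤ (1 + η) * dist z' y ^ p + η := by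
    intro z z' y hz
    calc dist z y ^ p ≤ (dist z' y + h) ^ p := by
          refine Real.rpow_le_rpow dist_nonneg ?_ hp0.le
          linarith [dist_triangle z z' y]
      _ ≤ (1 + η) * dist z' y ^ p + L * h ^ p := hLp _ _ dist_nonneg hh.le
      _ ≤ _ := by linarith
  have hpot : ∀ {κ : Measure X} {M : ℝ}, IsProbabilityMeasure κ → κ (K₀ ∪ K₁)ᶜ = 0 →
      (∀ u v, Reach (distCost X p) νY κ u v → M ≤ u + l' * v) →
      ∃ (φ : Fin (N + 1) → ℝ) (g : X → ℝ), Integrable g νY ∧ (∀ y, 0 < g y) ∧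
        (∀ z y, 0 < κ.real (f ⁻¹' {f z}) → Real.exp (φ (f z) - l' * (1 + η) * η -
          l' * (1 + η) ^ 2 * distCost X p z y) ≤ g y) ∧
        M - l' * η - η ≤ ∑ u, κ.real (f ⁻¹' {u}) * φ u - Real.log (∫ y, g y ∂νY) := by
    intro κ M hκ hκK hM
    obtain ⟨φ, g, hg, hg0, hφg, hφM⟩ := exists_cell_potential (ν := νY) (a := x) hf hη.le hη.le
      (by filter_upwards [mem_ae_iff.2 hκK] with z hz y
          exact hclose _ _ y (hfK z hz).2) hl'0 hη hM
    refine ⟨φ, g, hg, hg0, fun z y hz => ?_, hφM⟩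
    -- A charged cell is not the complement cell, so its points are close to the anchor.
    have hzK : z ∈ K₀ ∪ K₁ := by
      by_contra hzK
      rw [hfK' z hzK] at hz
      refine hz.ne' ?_
      rw [measureReal_eq_zero_iff]
      exact measure_mono_null (fun z' hz' hzK' => (hfK z' hzK').1 hz') hκK
    refine le_trans (Real.exp_le_exp.2 ?_) (hφg (f z) y hz)
    have h1 := hclose (x (f z)) z y (by rw [dist_comm]; exact (hfK z hzK).2)
    have h2 := mul_le_mul_of_nonneg_left h1 (show 0 ≤ l' * (1 + η) by positivity)
    rw [coe_distCost]
    nlinarith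
  obtain ⟨φ₀, g₀, hg₀, hg₀0, hφ₀, hφM₀⟩ := hpot hκ₀ hκK₀ hM₀'
  obtain ⟨φ₁, g₁, hg₁, hg₁0, hφ₁, hφM₁⟩ := hpot hκ₁ hκK₁ hM₁'
  set P : Fin (N + 1) → ℝ := fun u => νX.real (f ⁻¹' {u}) with hP
  set k₀ : Fin (N + 1) → ℝ := fun u => κ₀.real (f ⁻¹' {u}) with hk₀
  set k₁ : Fin (N + 1) → ℝ := fun u => κ₁.real (f ⁻¹' {u}) with hk₁
  have hac : ∀ {κ : Measure X} {d : ℝ}, klDiv κ νX ≤ ENNReal.ofReal d → κ ≪ νX := fun hd =>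
    (klDiv_ne_top_iff.1 (hd.trans_lt ENNReal.ofReal_lt_top).ne).1
  have hs₀ : k₀ ∈ supportedSimplex P := preimage_mem_supportedSimplex (hac hd₀) hf
  have hs₁ : k₁ ∈ supportedSimplex P := preimage_mem_supportedSimplex (hac hd₁) hf
  have hf₀ : finDiv k₀ P ≤ d₀ := finDiv_preimage_le hd₀0 hd₀ hf
  have hf₁ : finDiv k₁ P ≤ d₁ := finDiv_preimage_le hd₁0 hd₁ hf
  set ω := l' * (1 + η) * η with hω
  -- A third label with law `P`, weight `η` and trivial potential brings the average entropy
  -- strictly below `α`. The shift `ω` pays for replacing points by anchors.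
  refine isoFun_le_of_potentials (W := Fin 3) hf (T := ![η, (1 - η) * a, (1 - η) * b])
    (k := ![P, k₀, k₁]) (φ := ![fun _ => 0, fun u => φ₀ u - ω, fun u => φ₁ u - ω])
    (g := ![fun _ => 1, g₀, g₁]) (s := l' * (1 + η) ^ 2) ?_ ?_ ?_ ?_ ?_ (by positivity) ?_ ?_ ?_
  · refine ⟨fun i => ?_, ?_⟩
    · fin_cases i
      · exact hη.le
      · exact mul_nonneg hη1'.le ha
      · exact mul_nonneg hη1'.le hb
    · rw [Fin.sum_univ_three]
      simp only [Matrix.cons_val_zero, Matrix.cons_val_one, Matrix.cons_val]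
      linear_combination (1 - η) * hab
  · intro i
    fin_cases i
    · exact ⟨preimage_mem_stdSimplex νX hf, fun u hu => hu⟩
    · exact hs₀
    · exact hs₁
  · intro i
    fin_cases i
    · exact integrable_const _
    · exact hg₀
    · exact hg₁
  · intro i y
    fin_cases i
    · exact zero_le_one
    · exact (hg₀0 y).le
    · exact (hg₁0 y).le
  · intro i
    fin_cases i
    · simp
    · exact integral_pos_of_pos hg₀ hg₀0
    · exact integral_pos_of_pos hg₁ hg₁0
  · intro i z y hz
    fin_cases i
    · refine Real.exp_le_one_iff.2 ?_
      have : 0 ≤ l' * (1 + η) ^ 2 * distCost X p z y := by positivity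
      simpa using this
    · exact hφ₀ z y hz
    · exact hφ₁ z y hz
  · rw [Fin.sum_univ_three]
    simp only [Matrix.cons_val_zero, Matrix.cons_val_one, Matrix.cons_val]
    change η * finDiv P P + (1 - η) * a * finDiv k₀ P + (1 - η) * b * finDiv k₁ P < α
    rw [finDiv_self]
    have h1 := mul_le_mul_of_nonneg_left hf₀ ha
    have h2 := mul_le_mul_of_nonneg_left hf₁ hb
    have h3 : (1 - η) * (a * finDiv k₀ P + b * finDiv k₁ P) ≤ (1 - η) * α :=
      mul_le_mul_of_nonneg_left (by linarith) hη1'.le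
    nlinarith [mul_pos hη hα]
  · rw [Fin.sum_univ_three]
    simp only [Matrix.cons_val_zero, Matrix.cons_val_one, Matrix.cons_val]
    have e : ∀ {k φ : Fin (N + 1) → ℝ}, k ∈ supportedSimplex P →
        ∑ u, k u * (φ u - ω) = ∑ u, k u * φ u - ω := by
      intro k φ hk
      simp only [mul_sub, Finset.sum_sub_distrib, ← Finset.sum_mul, hk.1.2, one_mul]
    rw [e hs₀, e hs₁]
    have h1 := mul_le_mul_of_nonneg_left hφM₀ ha
    have h2 := mul_le_mul_of_nonneg_left hφM₁ hb
    set A₀ := ∑ u, k₀ u * φ₀ u - Real.log (∫ y, g₀ y ∂νY) with hA₀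
    set A₁ := ∑ u, k₁ u * φ₁ u - Real.log (∫ y, g₁ y ∂νY) with hA₁
    have h3 : m + l * τ - 2 * η - l' * η - ω ≤ a * (A₀ - ω) + b * (A₁ - ω) := by
      have e1 : a * (A₀ - ω) + b * (A₁ - ω) = a * A₀ + b * A₁ - (a + b) * ω := by ring
      have e2 : a * (M₀ - l' * η - η) + b * (M₁ - l' * η - η) =
          a * M₀ + b * M₁ - (a + b) * (l' * η + η) := by ring
      rw [hab] at e1 e2
      linarith
    have h4 := mul_le_mul_of_nonneg_left h3 hη1'.le
    have e3 : (1 - η) * a * (∑ u, k₀ u * φ₀ u - ω - Real.log (∫ y, g₀ y ∂νY)) +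
        (1 - η) * b * (∑ u, k₁ u * φ₁ u - ω - Real.log (∫ y, g₁ y ∂νY)) =
        (1 - η) * (a * (A₀ - ω) + b * (A₁ - ω)) := by rw [hA₀, hA₁]; ring
    have e4 : Real.log (∫ _y : X, (1 : ℝ) ∂νY) = 0 := by simp
    rw [e4]
    simp only [mul_zero, Finset.sum_const_zero, sub_zero, zero_add]
    linarith

end LowerBound

end

end ThickIsoperimetry

namespace ThickIsoperimetry

noncomputable section

/-! ### From the isoperimetric function to its exponent -/

section Exponent

variable {X Y : Type*} [MeasurableSpace X] [MeasurableSpace Y] {c : X → Y → ℝ≥0} {νX : Measure X}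
  {νY : Measure Y} {n : ℕ} {α τ b : ℝ}

lemma coe_mul_log_exp (hn : 0 < n) (b : ℝ) :
    ((1 / n : ℝ) : EReal) * ENNReal.log (ENNReal.ofReal (Real.exp (-(n * b)))) =
      ((-b : ℝ) : EReal) := by
  have hn' : (n : ℝ) ≠ 0 := by positivity
  rw [ENNReal.log_ofReal_of_pos (Real.exp_pos _), Real.log_exp, ← EReal.coe_mul]
  congr 1
  field_simp

lemma isoExponent_le (hn : 0 < n) (h : ENNReal.ofReal (Real.exp (-(n * b))) ≤
    isoFun c νX νY n (Real.exp (-(n * α))) (n * τ)) : isoExponent c νX νY n α τ ≤ b := by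
  unfold isoExponent
  rw [EReal.neg_le, ← EReal.coe_neg, ← coe_mul_log_exp hn b]
  exact mul_le_mul_of_nonneg_left (ENNReal.log_le_log h)
    (by exact_mod_cast (by positivity : (0 : ℝ) ≤ 1 / n))

lemma le_isoExponent (hn : 0 < n) (h : isoFun c νX νY n (Real.exp (-(n * α))) (n * τ) ≤
    ENNReal.ofReal (Real.exp (-(n * b)))) : (b : EReal) ≤ isoExponent c νX νY n α τ := by
  unfold isoExponent
  rw [EReal.le_neg, ← EReal.coe_neg, ← coe_mul_log_exp hn b]
  exact mul_le_mul_of_nonneg_left (ENNReal.log_le_log h)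
    (by exact_mod_cast (by positivity : (0 : ℝ) ≤ 1 / n))

lemma isoFun_le_one [IsProbabilityMeasure νX] [IsProbabilityMeasure νY] (hα : 0 ≤ α) :
    isoFun c νX νY n (Real.exp (-(n * α))) (n * τ) ≤ 1 := by
  refine le_trans (iInf_le_of_le Set.univ (iInf_le_of_le MeasurableSet.univ
    (iInf_le_of_le ?_ le_rfl))) prob_le_one
  rw [measure_univ, ENNReal.ofReal_le_one, Real.exp_le_one_iff]
  have : 0 ≤ n * α := by positivity
  linarith

/-- Exponential bounds on the isoperimetric function give the limit of the exponent. -/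
lemma tendsto_isoExponent [IsProbabilityMeasure νX] [IsProbabilityMeasure νY] (hα : 0 ≤ α)
    {ψ : ℝ≥0∞}
    (hup : ∀ b : ℝ, ψ < ENNReal.ofReal b → ∀ᶠ n : ℕ in atTop,
      ENNReal.ofReal (Real.exp (-(n * b))) ≤ isoFun c νX νY n (Real.exp (-(n * α))) (n * τ))
    (hlow : ∀ m : ℝ, 0 ≤ m → ENNReal.ofReal m < ψ → ∀ᶠ n : ℕ in atTop,
      isoFun c νX νY n (Real.exp (-(n * α))) (n * τ) ≤ ENNReal.ofReal (Real.exp (-(n * m)))) :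
    Tendsto (fun n : ℕ => isoExponent c νX νY n α τ) atTop (𝓝 (ψ : EReal)) := by
  have hofReal : ∀ {x : ℝ}, 0 ≤ x → (x : EReal) = (ENNReal.ofReal x : EReal) := fun hx => by
    rw [EReal.coe_ennreal_ofReal, max_eq_left hx]
  refine tendsto_order.2 ⟨fun a ha => ?_, fun a ha => ?_⟩
  · obtain ⟨m, ham, hm⟩ := EReal.lt_iff_exists_real_btwn.1 ha
    -- Exponents are nonnegative since the whole space is admissible, so negative levels need no
    -- argument.
    rcases lt_or_ge m 0 with hm0 | hm0
    · filter_upwards [eventually_gt_atTop 0] with n hn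
      have h1 : ((0 : ℝ) : EReal) ≤ isoExponent c νX νY n α τ :=
        le_isoExponent hn (by simpa using isoFun_le_one hα)
      exact (ham.trans (by exact_mod_cast hm0)).trans_le h1
    · rw [hofReal hm0, EReal.coe_ennreal_lt_coe_ennreal_iff] at hm
      filter_upwards [eventually_gt_atTop 0, hlow m hm0 hm] with n hn h
      exact ham.trans_le (le_isoExponent hn h)
  · obtain ⟨b, hb, hba⟩ := EReal.lt_iff_exists_real_btwn.1 ha
    have hb0 : 0 ≤ b := by
      have : ((0 : ℝ) : EReal) < b := (EReal.coe_ennreal_nonneg ψ).trans_lt hb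
      exact_mod_cast this.le
    rw [hofReal hb0, EReal.coe_ennreal_lt_coe_ennreal_iff] at hb
    filter_upwards [eventually_gt_atTop 0, hup b hb] with n hn h
    exact (isoExponent_le hn h).trans_lt hba

end Exponent

/-! ### Convexity of `psi` and the limit inside its domain -/

section Interior

variable {X : Type*} [MetricSpace X] [SecondCountableTopology X] [MeasurableSpace X]
  [BorelSpace X]

/-- Convexity of `psi` in the transport constraint. -/
lemma psi_convex {p : ℝ} (hp : 1 ≤ p) (x₀ : X) {νX νY : Measure X} [IsProbabilityMeasure νY]
    {α t t' B B' r s : ℝ} (hα : 0 ≤ α) (ht : 0 ≤ t) (ht' : 0 ≤ t') (hr : 0 ≤ r) (hs : 0 ≤ s)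
    (hrs : r + s = 1) (h : psi (distCost X p) νX νY α t < ENNReal.ofReal B)
    (h' : psi (distCost X p) νX νY α t' < ENNReal.ofReal B') :
    psi (distCost X p) νX νY α (r * t + s * t') ≤ ENNReal.ofReal (r * B + s * B') := by
  by_contra! hlt
  have hB : 0 < B := ENNReal.ofReal_pos.1 (bot_le.trans_lt h)
  have hB' : 0 < B' := ENNReal.ofReal_pos.1 (bot_le.trans_lt h')
  obtain ⟨κ₀, κ₁, a, b, d₀, d₁, hκ₀, hκ₁, hc₀, hc₁, ha, hb, hab, hd₀0, hd₁0, hd₀, hd₁, hd, hfam⟩ :=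
    -- One family violating the claim is fixed. Its reachable pairs for the constraints `t` and `t'`
    -- mix to a pair for the intermediate constraint, which contradicts the violation.
    exists_family_of_lt_psi hα (by positivity) hlt
  have key : ∀ {t B : ℝ}, 0 ≤ t → psi (distCost X p) νX νY α t < ENNReal.ofReal B →
      ∃ u₀ v₀ u₁ v₁, Reach (distCost X p) νY κ₀ u₀ v₀ ∧ Reach (distCost X p) νY κ₁ u₁ v₁ ∧
        a * u₀ + b * u₁ ≤ B ∧ a * v₀ + b * v₁ ≤ t := by
    intro t B ht h
    obtain ⟨u₀', v₀', u₁', v₁', h₀', h₁', hu', hv'⟩ := exists_reach_of_psi_lt ht hc₀ hc₁ hd₀0 hd₁0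
      hd₀ hd₁ ha hb hab hd h
    obtain ⟨u₀, v₀, h₀, e₀, f₀⟩ := exists_reach_weighted hp x₀ hc₀ ha h₀'
    obtain ⟨u₁, v₁, h₁, e₁, f₁⟩ := exists_reach_weighted hp x₀ hc₁ hb h₁'
    exact ⟨u₀, v₀, u₁, v₁, h₀, h₁, by rw [e₀, e₁]; exact hu', by rw [f₀, f₁]; exact hv'⟩
  obtain ⟨u₀, v₀, u₁, v₁, h₀, h₁, hu, hv⟩ := key ht h
  obtain ⟨u₀', v₀', u₁', v₁', h₀', h₁', hu', hv'⟩ := key ht' h'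
  have h1 := hfam _ _ _ _ (h₀.mix h₀' hr hs hrs) (h₁.mix h₁' hr hs hrs) (by
    have := mul_le_mul_of_nonneg_left hv hr
    have := mul_le_mul_of_nonneg_left hv' hs
    linarith)
  have := mul_le_mul_of_nonneg_left hu hr
  have := mul_le_mul_of_nonneg_left hu' hs
  linarith

/-- Left continuity of `psi` in the transport constraint, inside its domain. -/
lemma exists_psi_le_of_lt {p : ℝ} (hp : 1 ≤ p) (x₀ : X) {νX νY : Measure X}
    [IsProbabilityMeasure νY] {α t τ B : ℝ} (hα : 0 ≤ α) (ht : 0 ≤ t) (htτ : t < τ)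
    (hψt : psi (distCost X p) νX νY α t < ⊤)
    (hψ : psi (distCost X p) νX νY α τ < ENNReal.ofReal B) :
    ∃ t' B', 0 ≤ t' ∧ t' < τ ∧ 0 ≤ B' ∧ B' < B ∧
      psi (distCost X p) νX νY α t' ≤ ENNReal.ofReal B' := by
  have hB : 0 < B := ENNReal.ofReal_pos.1 (bot_le.trans_lt hψ)
  obtain ⟨B₁, hB₁0, hB₁, hB₁B⟩ := ENNReal.lt_iff_exists_real_btwn.1 hψ
  have hB₁B' : B₁ < B := (ENNReal.ofReal_lt_ofReal_iff hB).1 hB₁B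
  obtain ⟨C, hC⟩ : ∃ C : ℝ, psi (distCost X p) νX νY α t < ENNReal.ofReal C := by
    obtain ⟨C, -, hC, -⟩ := ENNReal.lt_iff_exists_real_btwn.1 hψt
    exact ⟨C, hC⟩
  have hC0 : 0 < C := ENNReal.ofReal_pos.1 (bot_le.trans_lt hC)
  -- A small step from `τ` towards `t` raises the convex bound `(1 - s) * B₁ + s * C` only slightly
  -- above `B₁`.
  have hev : ∀ᶠ s : ℝ in 𝓝[>] 0, (1 - s) * B₁ + s * C < B := by
    have hc : Continuous fun s : ℝ => (1 - s) * B₁ + s * C := by fun_prop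
    exact (hc.continuousAt.eventually (gt_mem_nhds (by simpa using hB₁B'))).filter_mono
      nhdsWithin_le_nhds
  have h3 : ∀ᶠ s : ℝ in 𝓝[>] 0, s < 1 :=
    Filter.Eventually.filter_mono nhdsWithin_le_nhds (gt_mem_nhds one_pos)
  have h4 : ∀ᶠ s : ℝ in 𝓝[>] 0, 0 < s := self_mem_nhdsWithin
  obtain ⟨s, hs0, hs1, hs⟩ := (h4.and (h3.and hev)).exists
  have hτ : 0 < τ := ht.trans_lt htτ
  have hs1' : 0 < 1 - s := by linarith
  refine ⟨(1 - s) * τ + s * t, (1 - s) * B₁ + s * C, by positivity, ?_, by positivity, hs,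
    psi_convex hp x₀ hα hτ.le ht hs1'.le hs0.le (by ring) hB₁ hC⟩
  nlinarith

/-- The limit inside the domain of `psi`, for a bounded law `νX`. -/
lemma tendsto_isoExponent_of_psi_lt_top [CompleteSpace X] {p : ℝ} (hp : 1 ≤ p) {νX νY : Measure X}
    [IsProbabilityMeasure νX] [IsProbabilityMeasure νY] {x₀ : X} {R : ℝ}
    (hR : νX (Metric.closedBall x₀ R)ᶜ = 0) {α t τ : ℝ} (hα : 0 < α) (ht : 0 ≤ t) (htτ : t < τ)
    (hψt : psi (distCost X p) νX νY α t < ⊤) :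
    Tendsto (fun n : ℕ => isoExponent (distCost X p) νX νY n α τ) atTop
      (𝓝 (psi (distCost X p) νX νY α τ : EReal)) := by
  refine tendsto_isoExponent hα.le (fun b hb => ?_) fun m hm0 hm => ?_
  -- The coding argument needs transport room, so it is run with a constraint strictly below `τ`;
  -- left continuity makes this free.
  · obtain ⟨t', B', ht', ht'τ, hB', hB'b, hψ'⟩ := exists_psi_le_of_lt hp x₀ hα.le ht htτ hψt hb
    obtain ⟨n₀, hn₀⟩ := isoFun_ge hp hR hα ht' ht'τ hB' (sub_pos.2 hB'b) hψ'
    rw [add_sub_cancel] at hn₀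
    exact eventually_atTop.2 ⟨n₀, hn₀⟩
  · obtain ⟨m', hm'0, hmm', hm'⟩ := ENNReal.lt_iff_exists_real_btwn.1 hm
    have hlt : m < m' := by
      by_contra! h
      exact absurd hmm' (not_lt.2 (ENNReal.ofReal_le_ofReal h))
    obtain ⟨n₀, hn₀⟩ := isoFun_le hp x₀ hα ht htτ hm'0 (sub_pos.2 hlt) hψt hm'
    rw [sub_sub_cancel] at hn₀
    exact eventually_atTop.2 ⟨n₀, hn₀⟩

/-- A law with finite exponential rate is bounded. -/
lemma exists_closedBall_of_expRate_lt_top {p : ℝ} (hp : 1 ≤ p) {ν : Measure X}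
    [IsProbabilityMeasure ν] {x₀ : X} (h : expRate ν p x₀ < ⊤) :
    ∃ R, ν (Metric.closedBall x₀ R)ᶜ = 0 := by
  obtain ⟨C, hC, -⟩ := EReal.lt_iff_exists_real_btwn.1 h
  have hp0 : 0 < p := by linarith
  have hev := eventually_lt_of_limsup_lt hC
  -- Where `dist x x₀ ^ p` exceeds `C'` the integrand is at least `exp (l * C')`, while the integral
  -- is at most `exp (l * C)`. That region thus has mass at most `exp (-l)` for all large `l`.
  set C' : ℝ := |C| + 1 with hC'
  have hC'0 : 0 < C' := by positivity
  refine ⟨C' ^ (1 / p), ?_⟩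
  have hbound : ∀ᶠ l : ℝ in atTop, ν (Metric.closedBall x₀ (C' ^ (1 / p)))ᶜ ≤
      ENNReal.ofReal (Real.exp (-l)) := by
    filter_upwards [hev, eventually_gt_atTop 0] with l hl hl0
    set I := ∫⁻ x, ENNReal.ofReal (Real.exp (l * dist x x₀ ^ p)) ∂ν with hI
    have h1 : I ≤ ENNReal.ofReal (Real.exp (l * C)) := by
      rw [← ENNReal.log_le_log_iff, ENNReal.log_ofReal_of_pos (Real.exp_pos _), Real.log_exp]
      have h2 : ((l : ℝ) : EReal) * (((1 / l : ℝ) : EReal) * ENNReal.log I) ≤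
          ((l : ℝ) : EReal) * (C : EReal) :=
        mul_le_mul_of_nonneg_left hl.le (by exact_mod_cast hl0.le)
      rwa [← mul_assoc, ← EReal.coe_mul, mul_one_div_cancel hl0.ne', EReal.coe_one, one_mul,
        ← EReal.coe_mul] at h2
    have h2 : ENNReal.ofReal (Real.exp (l * C')) * ν (Metric.closedBall x₀ (C' ^ (1 / p)))ᶜ ≤
        I := by
      have hm : Measurable fun x : X => ENNReal.ofReal (Real.exp (l * dist x x₀ ^ p)) :=
        (Real.measurable_exp.comp
          (((measurable_id.dist measurable_const).pow_const p).const_mul l)).ennreal_ofReal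
      refine le_trans ?_ (mul_meas_ge_le_lintegral hm (ENNReal.ofReal (Real.exp (l * C'))))
      gcongr
      intro x hx
      rw [Set.mem_compl_iff, Metric.mem_closedBall, not_le] at hx
      refine ENNReal.ofReal_le_ofReal (Real.exp_le_exp.2 (mul_le_mul_of_nonneg_left ?_ hl0.le))
      calc C' = (C' ^ (1 / p)) ^ p := by
            rw [← Real.rpow_mul hC'0.le, one_div_mul_cancel hp0.ne', Real.rpow_one]
        _ ≤ dist x x₀ ^ p := Real.rpow_le_rpow (by positivity) hx.le hp0.le
    have h3 := h2.trans h1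
    have h4 : ENNReal.ofReal (Real.exp (l * C)) ≤
        ENNReal.ofReal (Real.exp (l * C')) * ENNReal.ofReal (Real.exp (-l)) := by
      rw [← ENNReal.ofReal_mul (Real.exp_pos _).le, ← Real.exp_add]
      refine ENNReal.ofReal_le_ofReal (Real.exp_le_exp.2 ?_)
      have := mul_le_mul_of_nonneg_left (le_abs_self C) hl0.le
      rw [hC']; linarith
    exact (ENNReal.mul_le_mul_iff_right (by simpa using Real.exp_pos _)
      ENNReal.ofReal_ne_top).1 (h3.trans h4)
  have hlim : Tendsto (fun l : ℝ => ENNReal.ofReal (Real.exp (-l))) atTop (𝓝 0) := by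
    have := (ENNReal.continuous_ofReal.tendsto 0).comp
      (Real.tendsto_exp_neg_atTop_nhds_zero)
    simpa [Function.comp_def] using this
  exact le_antisymm (ge_of_tendsto hlim hbound) bot_le

end Interior

end

end ThickIsoperimetry

namespace ThickIsoperimetry

noncomputable section

/-! ### Equal laws and the edges of the quadrant -/

section EqualLaws

open InformationTheory

lemma distCost_eq_zero {X : Type*} [MetricSpace X] {p : ℝ} (hp : 1 ≤ p) {x y : X} : distCost X p x y = 0 ↔ x = y := by
  unfold distCost
  rw [NNReal.rpow_eq_zero_iff, nndist_eq_zero]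
  exact ⟨fun h => h.1, fun h => ⟨h, by linarith⟩⟩

variable {X : Type*} [MetricSpace X] [SecondCountableTopology X] [MeasurableSpace X]
  [BorelSpace X]

lemma transportCost_self {p : ℝ} (hp : 1 ≤ p) (κ : Measure X) :
    transportCost (distCost X p) κ κ = 0 := by
  have hm : Measurable fun x : X => (x, x) := measurable_id.prodMk measurable_id
  refine le_antisymm ((transportCost_le (κ.map fun x => (x, x)) ?_ ?_).trans (le_of_eq ?_)) bot_le
  · rw [Measure.fst, Measure.map_map measurable_fst hm]
    exact Measure.map_id
  · rw [Measure.snd, Measure.map_map measurable_snd hm]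
    exact Measure.map_id
  · rw [lintegral_map (measurable_distCost p) hm]
    simp [(distCost_eq_zero hp).2]

/-- Laws at transport cost zero are equal. -/
lemma eq_of_transportCost_eq_zero {p : ℝ} (hp : 1 ≤ p) {κ η : Measure X} [IsProbabilityMeasure κ]
    [IsProbabilityMeasure η] (h : transportCost (distCost X p) κ η = 0) : κ = η := by
  -- A coupling of tiny cost rarely moves a point by `δ` or more, by Markov's inequality. Shrinking
  -- the thickening then compares closed sets, and inner regularity compares all measurable sets.
  have hthick : ∀ F : Set X, IsClosed F → ∀ δ : ℝ, 0 < δ → κ F ≤ η (Metric.thickening δ F) := by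
    intro F hF δ hδ
    refine ENNReal.le_of_forall_pos_le_add fun ε hε _ => ?_
    have hδp : ENNReal.ofReal (δ ^ p) ≠ 0 := by
      simpa using Real.rpow_pos_of_pos hδ p
    obtain ⟨π, h1, h2, h3⟩ := exists_coupling_of_transportCost_lt (r := ε * ENNReal.ofReal (δ ^ p))
      (by rw [h]; exact ENNReal.mul_pos (by exact_mod_cast hε.ne') hδp)
    have h4 : π {z | ENNReal.ofReal (δ ^ p) ≤ (distCost X p z.1 z.2 : ℝ≥0∞)} ≤ ε := by
      have h5 := (mul_meas_ge_le_lintegral (μ := π) (measurable_distCost p)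
        (ENNReal.ofReal (δ ^ p))).trans h3.le
      rw [mul_comm (ε : ℝ≥0∞)] at h5
      exact (ENNReal.mul_le_mul_iff_right hδp ENNReal.ofReal_ne_top).1 h5
    rw [← h1, ← h2, Measure.fst_apply hF.measurableSet,
      Measure.snd_apply Metric.isOpen_thickening.measurableSet]
    refine (measure_mono ?_).trans ((measure_union_le _ _).trans (add_le_add_right h4 _))
    intro z hz
    by_cases hd : dist z.2 z.1 < δ
    · exact Or.inl (Metric.mem_thickening_iff.2 ⟨z.1, hz, hd⟩)
    · refine Or.inr ?_
      rw [Set.mem_ofPred_eq, coe_distCost_ennreal, dist_comm]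
      exact ENNReal.ofReal_le_ofReal (Real.rpow_le_rpow hδ.le (not_lt.1 hd) (by linarith))
  have hclosed : ∀ F : Set X, IsClosed F → κ F ≤ η F := by
    intro F hF
    have hlim := tendsto_measure_thickening_of_isClosed (μ := η) ⟨1, one_pos, measure_ne_top _ _⟩ hF
    exact ge_of_tendsto hlim (by
      filter_upwards [self_mem_nhdsWithin] with δ hδ using hthick F hF δ hδ)
  have hle : κ ≤ η := by
    refine Measure.le_iff.2 fun s hs => ?_
    rw [hs.measure_eq_iSup_isClosed_of_ne_top (measure_ne_top _ _)]
    exact iSup₂_le fun F hFs => iSup_le fun hF => (hclosed F hF).trans (measure_mono hFs)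
  exact Measure.eq_of_le_of_measure_univ_eq hle (by simp)

/-- The identity transport `η = κ` is free and has the entropy of `κ`. Consequently the domain of
`psi` is the whole quadrant when the laws agree. -/
lemma psi_self_le {p : ℝ} (hp : 1 ≤ p) (ν : Measure X) (α τ : ℝ) :
    psi (distCost X p) ν ν α τ ≤ ENNReal.ofReal α := by
  unfold psi
  refine iSup_le fun πW => iSup_le fun _ => iSup_le fun κ => iSup_le fun hκ => iSup_le fun _ =>
    iSup_le fun hα => ?_
  refine iInf_le_of_le κ (iInf_le_of_le hκ (iInf_le_of_le ?_ hα))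
  simp [condTransportCost, transportCost_self hp]

lemma subset_enlargement {X : Type*} [MetricSpace X] {p : ℝ} (hp : 1 ≤ p) {n : ℕ} (A : Set (Fin n → X)) {t : ℝ} (ht : 0 ≤ t) :
    A ⊆ enlargement (distCost X p) n A t := fun x hx =>
  ⟨x, hx, by simpa [addCost, (distCost_eq_zero hp).2] using ht⟩

lemma enlargement_zero {X : Type*} [MetricSpace X] {p : ℝ} (hp : 1 ≤ p) {n : ℕ} (A : Set (Fin n → X)) :
    enlargement (distCost X p) n A 0 = A := by
  refine Set.Subset.antisymm ?_ (subset_enlargement hp A le_rfl)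
  rintro y ⟨x, hx, hxy⟩
  have h1 : addCost (distCost X p) n x y = 0 := le_antisymm (by exact_mod_cast hxy) bot_le
  rw [addCost, Finset.sum_eq_zero_iff] at h1
  have : x = y := funext fun i => (distCost_eq_zero hp).1 (h1 i (Finset.mem_univ i))
  rwa [← this]

/-- If all non-null sets have probability at least `b`, then the non-null sets of sequences of
length `n` have probability at least `b ^ n`. -/
lemma pow_le_pi_of_forall {Y : Type*} [MeasurableSpace Y] {ν : Measure Y} [IsProbabilityMeasure ν]
    {b : ℝ≥0∞} (hb : ∀ E, MeasurableSet E → ν E ≠ 0 → b ≤ ν E) (n : ℕ) (A : Set (Fin n → Y))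
    (hA : MeasurableSet A) (hA0 : Measure.pi (fun _ : Fin n => ν) A ≠ 0) :
    b ^ n ≤ Measure.pi (fun _ : Fin n => ν) A := by
  induction n with
  | zero =>
    rw [pow_zero]
    have hne : A.Nonempty := nonempty_of_measure_ne_zero hA0
    rw [Subsingleton.eq_univ_of_nonempty hne, measure_univ]
  | succ n ih =>
    set e := MeasurableEquiv.piFinSuccAbove (fun _ : Fin (n + 1) => Y) 0 with he
    have hmp := (measurePreserving_piFinSuccAbove (fun _ : Fin (n + 1) => ν) 0).symm
    have hm : MeasurableSet (e.symm ⁻¹' A) := e.symm.measurable hA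
    have h1 : Measure.pi (fun _ : Fin (n + 1) => ν) A =
        (ν.prod (Measure.pi fun _ : Fin n => ν)) (e.symm ⁻¹' A) :=
      (hmp.measure_preimage hA.nullMeasurableSet).symm
    rw [h1, Measure.prod_apply hm] at hA0 ⊢
    set g : Y → ℝ≥0∞ := fun x => Measure.pi (fun _ : Fin n => ν) (Prod.mk x ⁻¹' (e.symm ⁻¹' A))
      with hg
    have hgm : Measurable g := measurable_measure_prodMk_left hm
    -- A non-null set has non-null sections over a non-null set of first coordinates; each such
    -- section is bounded below by induction and the set of them by hypothesis.
    set E : Set Y := {x | g x ≠ 0} with hE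
    have hEm : MeasurableSet E := (hgm (measurableSet_singleton 0)).compl
    have hE0 : ν E ≠ 0 := fun h0 => hA0 ((lintegral_eq_zero_iff hgm).2
      (measure_mono_null (fun x hx => hx) h0))
    calc b ^ (n + 1) = b ^ n * b := pow_succ b n
      _ ≤ b ^ n * ν E := by gcongr; exact hb E hEm hE0
      _ = ∫⁻ _ in E, b ^ n ∂ν := by rw [setLIntegral_const]
      _ ≤ ∫⁻ x in E, g x ∂ν := setLIntegral_mono hgm fun x hx =>
          ih _ (measurable_prodMk_left hm) hx
      _ ≤ ∫⁻ x, g x ∂ν := setLIntegral_le_lintegral _ _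

/-- A law dominated by a multiple of `ν` has bounded relative entropy. -/
lemma klDiv_le_log_of_forall {Y : Type*} [MeasurableSpace Y] {κ ν : Measure Y}
    [IsProbabilityMeasure κ] [IsProbabilityMeasure ν] (hfin : klDiv κ ν ≠ ⊤) {m : ℝ}
    (hm : ∀ E, MeasurableSet E → ν E ≠ 0 → ENNReal.ofReal (Real.exp (-m)) ≤ ν E) :
    (klDiv κ ν).toReal ≤ m := by
  obtain ⟨hac, h_int⟩ := klDiv_ne_top_iff.1 hfin
  rw [toReal_klDiv_of_measure_eq hac (by simp)]
  -- A set charged by `κ` is not `ν`-null, hence has `ν`-mass at least `exp (-m)`, whereas `κ` gives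
  -- it at most one. The density is therefore at most `exp m`.
  have hle : κ ≤ ENNReal.ofReal (Real.exp m) • ν := by
    refine Measure.le_iff.2 fun s hs => ?_
    by_cases h0 : ν s = 0
    · rw [hac h0]; exact bot_le
    · calc κ s ≤ 1 := prob_le_one
        _ = ENNReal.ofReal (Real.exp m) * ENNReal.ofReal (Real.exp (-m)) := by
            rw [← ENNReal.ofReal_mul (Real.exp_pos _).le, ← Real.exp_add]; simp
        _ ≤ ENNReal.ofReal (Real.exp m) * ν s := by gcongr; exact hm s hs h0
  have hrn : κ.rnDeriv ν ≤ᵐ[ν] fun _ => ENNReal.ofReal (Real.exp m) := by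
    refine ae_le_of_forall_setLIntegral_le_of_sigmaFinite (Measure.measurable_rnDeriv _ _)
      fun s hs _ => ?_
    rw [setLIntegral_const]
    exact (Measure.setLIntegral_rnDeriv_le s).trans (hle s)
  have hllr : ∀ᵐ y ∂κ, llr κ ν y ≤ m := by
    filter_upwards [hac.ae_le hrn, Measure.rnDeriv_pos hac] with y hy hy0
    rw [llr]
    have h1 : 0 < (κ.rnDeriv ν y).toReal := ENNReal.toReal_pos hy0.ne'
      (hy.trans_lt ENNReal.ofReal_lt_top).ne
    rw [← Real.log_exp m]
    exact Real.log_le_log h1 (ENNReal.toReal_le_of_le_ofReal (Real.exp_pos _).le hy)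
  calc ∫ y, llr κ ν y ∂κ ≤ ∫ _, m ∂κ := integral_mono_ae h_int (integrable_const _) hllr
    _ = m := by simp

/-- Compact conditional laws. -/
lemma exists_compact_conditional {X : Type*} [MetricSpace X] [MeasurableSpace X] [BorelSpace X]
    {ν : Measure X} [IsProbabilityMeasure ν] {K : Set X}
    (hK : IsCompact K) (h0 : ν K ≠ 0) :
    ∃ κ : Measure X, IsProbabilityMeasure κ ∧ ConcentratedOnCompact κ ∧
      klDiv κ ν = ENNReal.ofReal (-Real.log (ν.real K)) := by
  have hA : ∀ _ : Unit, MeasurableSet K := fun _ => hK.measurableSet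
  have hd : Pairwise (Function.onFun Disjoint fun _ : Unit => K) := fun u v huv =>
    absurd (Subsingleton.elim u v) huv
  have hk : (fun _ => 1 : Unit → ℝ) ∈ stdSimplex ℝ Unit := ⟨fun _ => zero_le_one, by simp⟩
  have hkA : ∀ _ : Unit, ν.real K = 0 → (1 : ℝ) = 0 := fun _ h =>
    absurd ((measureReal_eq_zero_iff (measure_ne_top _ _)).1 h) h0
  refine ⟨cellMix ν (fun _ : Unit => K) fun _ => 1, isProbabilityMeasure_cellMix hA hd hk hkA,
    ⟨K, hK, ?_⟩, ?_⟩
  · have := cellMix_compl_iUnion hA hd hk hkA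
    rwa [Set.iUnion_const] at this
  · rw [klDiv_cellMix hA hd hk hkA]
    simp [finDiv]

/-- A strict bound on `psi ν ν α 0` below `α` bounds the probabilities of non-null sets. -/
lemma exp_neg_le_of_psi_lt [CompleteSpace X] {p : ℝ} (hp : 1 ≤ p) {ν : Measure X}
    [IsProbabilityMeasure ν] {α B : ℝ} (hBα : B < α)
    (hψ : psi (distCost X p) ν ν α 0 < ENNReal.ofReal B) {E : Set X} (hE : MeasurableSet E)
    (hE0 : ν E ≠ 0) : ENNReal.ofReal (Real.exp (-B)) ≤ ν E := by
  have hB : 0 < B := ENNReal.ofReal_pos.1 (bot_le.trans_lt hψ)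
  by_contra! hlt
  obtain ⟨K, hKE, hK, hK0⟩ := hE.exists_lt_isCompact_of_ne_top (measure_ne_top ν E)
    (pos_iff_ne_zero.2 hE0)
  have hKr : 0 < ν.real K := ENNReal.toReal_pos hK0.ne' (measure_ne_top _ _)
  have hKlt : ν.real K < Real.exp (-B) := by
    rw [measureReal_def]
    exact (ENNReal.lt_ofReal_iff_toReal_lt (measure_ne_top _ _)).1 ((measure_mono hKE).trans_lt hlt)
  set β : ℝ := -Real.log (ν.real K) with hβ
  have hβB : B < β := by
    have := Real.log_lt_log hKr hKlt
    rw [Real.log_exp] at this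
    linarith
  have hβ0 : 0 < β := hB.trans hβB
  set δ : ℝ := (α - B) / 2 with hδ
  have hδ0 : 0 < δ := by rw [hδ]; linarith
  obtain ⟨K', hK', hK'δ⟩ : ∃ K' : Set X, IsCompact K' ∧ Real.exp (-δ) < ν.real K' := by
    obtain ⟨K', -, hK', h⟩ := MeasurableSet.univ.exists_lt_isCompact_of_ne_top
      (measure_ne_top ν _) (r := ENNReal.ofReal (Real.exp (-δ))) (by
        rw [measure_univ, ENNReal.ofReal_lt_one, Real.exp_lt_one_iff]; linarith)
    exact ⟨K', hK', (ENNReal.ofReal_lt_iff_lt_toReal (Real.exp_pos _).le (measure_ne_top _ _)).1 h⟩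
  have hK'r : 0 < ν.real K' := (Real.exp_pos _).trans hK'δ
  obtain ⟨κ₀, hκ₀, hc₀, hkl₀⟩ := exists_compact_conditional hK hK0.ne'
  obtain ⟨κ₁, hκ₁, hc₁, hkl₁⟩ := exists_compact_conditional hK' (ν := ν) (fun h => by
    rw [measureReal_def, h] at hK'r; simp at hK'r)
  have hd₁ : klDiv κ₁ ν ≤ ENNReal.ofReal δ := by
    rw [hkl₁]
    refine ENNReal.ofReal_le_ofReal ?_
    have := Real.log_lt_log (Real.exp_pos _) hK'δ
    rw [Real.log_exp] at this
    linarith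
  -- The weight is chosen so that `B < a * β ≤ (α + B) / 2`; the nearly unconditioned second law
  -- adds at most `(α - B) / 2`, so the family is feasible for `α`.
  set a : ℝ := min 1 ((α + B) / 2 / β) with ha
  have ha0 : 0 < a := lt_min one_pos (div_pos (by linarith) hβ0)
  have ha1 : a ≤ 1 := min_le_left _ _
  have haβ : a * β ≤ (α + B) / 2 := by
    rw [← le_div_iff₀ hβ0]; exact min_le_right _ _
  have haβB : B < a * β := by
    rcases min_choice 1 ((α + B) / 2 / β) with h | h
    · rw [ha, h, one_mul]; exact hβB
    · rw [ha, h, div_mul_cancel₀ _ hβ0.ne']; linarith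
  obtain ⟨u₀, v₀, u₁, v₁, h₀, h₁, hu, hv⟩ := exists_reach_of_psi_lt le_rfl hc₀ hc₁ hβ0.le hδ0.le
    hkl₀.le hd₁ ha0.le (sub_nonneg.2 ha1) (by ring) (by nlinarith) hψ
  have hr₀ := h₀ ha0
  have hb1 : 0 ≤ (1 - a) * v₁ ∧ 0 ≤ (1 - a) * u₁ := by
    rcases (sub_nonneg.2 ha1).eq_or_lt with h | h
    · rw [← h]; simp
    · exact ⟨mul_nonneg h.le (h₁ h).2.1, mul_nonneg h.le (h₁ h).1⟩
  -- No transport budget is left, so the law paired with `κ₀` is `κ₀` itself and contributes at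
  -- least `a * β > B`.
  have hv0 : v₀ = 0 := by
    have h1 : a * v₀ ≤ 0 := by linarith [hb1.1]
    exact le_antisymm (nonpos_of_mul_nonpos_right h1 ha0) hr₀.2.1
  obtain ⟨hu0, -, η, hη, h2, h3⟩ := hr₀
  rw [hv0, ENNReal.ofReal_zero, nonpos_iff_eq_zero] at h3
  rw [← eq_of_transportCost_eq_zero hp h3, hkl₀, ENNReal.ofReal_le_ofReal_iff hu0] at h2
  have h4 := mul_le_mul_of_nonneg_left h2 ha0.le
  linarith [hb1.2]

/-- If `psi ν ν α 0` exceeds `m`, then some non-null set has probability less than `exp (-m)`. -/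
lemma exists_small_of_lt_psi {p : ℝ} (hp : 1 ≤ p) {ν : Measure X} [IsProbabilityMeasure ν]
    {α m : ℝ} (hα : 0 ≤ α) (hm : 0 ≤ m) (hψ : ENNReal.ofReal m < psi (distCost X p) ν ν α 0) :
    ∃ E, MeasurableSet E ∧ ν E ≠ 0 ∧ ν E < ENNReal.ofReal (Real.exp (-m)) := by
  by_contra! hcon
  obtain ⟨κ₀, κ₁, a, b, d₀, d₁, hκ₀, hκ₁, -, -, ha, hb, hab, -, -, hd₀, hd₁, -, hfam⟩ :=
    exists_family_of_lt_psi hα hm hψ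
  -- If no non-null set were that small, every law of finite entropy would have entropy at most `m`
  -- and could be left in place.
  have hr : ∀ {κ : Measure X}, IsProbabilityMeasure κ → klDiv κ ν ≠ ⊤ →
      Reach (distCost X p) ν κ m 0 := by
    intro κ hκ hfin
    refine ⟨hm, le_rfl, κ, hκ, ?_, by simp [transportCost_self hp]⟩
    rw [← ENNReal.ofReal_toReal hfin]
    exact ENNReal.ofReal_le_ofReal (klDiv_le_log_of_forall hfin hcon)
  have h := hfam m 0 m 0 (hr hκ₀ (hd₀.trans_lt ENNReal.ofReal_lt_top).ne)
    (hr hκ₁ (hd₁.trans_lt ENNReal.ofReal_lt_top).ne) (by simp)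
  rw [← add_mul, hab, one_mul] at h
  exact lt_irrefl _ h

/-- The limit for equal laws at `τ = 0`. -/
lemma tendsto_isoExponent_zero [CompleteSpace X] {p : ℝ} (hp : 1 ≤ p) {ν : Measure X}
    [IsProbabilityMeasure ν] {α : ℝ} (hα : 0 < α) :
    Tendsto (fun n : ℕ => isoExponent (distCost X p) ν ν n α 0) atTop
      (𝓝 (psi (distCost X p) ν ν α 0 : EReal)) := by
  refine tendsto_isoExponent hα.le (fun b hb => Eventually.of_forall fun n => ?_) fun m hm0 hm => ?_
  · refine le_iInf fun A => le_iInf fun hA => le_iInf fun hAα => ?_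
    rw [mul_zero, enlargement_zero hp]
    -- For `α ≤ b` the constraint on `A` suffices; otherwise non-null sets are bounded below in one
    -- coordinate, hence in `n`.
    rcases le_or_gt α b with h | h
    · refine le_trans (ENNReal.ofReal_le_ofReal (Real.exp_le_exp.2 (neg_le_neg ?_))) hAα
      gcongr
    · have hA0 : Measure.pi (fun _ : Fin n => ν) A ≠ 0 :=
        (lt_of_lt_of_le (by simpa using Real.exp_pos _) hAα).ne'
      refine le_trans (le_of_eq ?_) (pow_le_pi_of_forall
        (fun E hE hE0 => exp_neg_le_of_psi_lt hp h hb hE hE0) n A hA hA0)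
      rw [← ENNReal.ofReal_pow (Real.exp_pos _).le, ← Real.exp_nat_mul]
      congr 2; ring
  · obtain ⟨E, hE, hE0, hEm⟩ := exists_small_of_lt_psi hp hα.le hm0 hm
    have hmα : m < α := by
      have := hm.trans_le (psi_self_le hp ν α 0)
      exact (ENNReal.ofReal_lt_ofReal_iff hα).1 this
    have hEr : 0 < ν.real E := ENNReal.toReal_pos hE0 (measure_ne_top _ _)
    set β : ℝ := -Real.log (ν.real E) with hβ
    have hEβ : ν E = ENNReal.ofReal (Real.exp (-β)) := by
      rw [hβ, neg_neg, Real.exp_log hEr]; simp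
    have hmβ : m < β := by
      rw [hEβ, ENNReal.ofReal_lt_ofReal_iff (Real.exp_pos _), Real.exp_lt_exp] at hEm
      linarith
    have hβ0 : 0 < β := hm0.trans_lt hmβ
    obtain ⟨N, hN⟩ := exists_nat_gt (β / (α - m))
    filter_upwards [eventually_ge_atTop N] with n hn
    have hnN : (N : ℝ) ≤ n := by exact_mod_cast hn
    have hn0 : (0 : ℝ) ≤ n := Nat.cast_nonneg n
    -- The number of coordinates confined to `E`. The constraint allows `j * β ≤ n * α`; rounding
    -- down loses less than `β`, which is below `n * (α - m)` for large `n`, and if `j = n` then `m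
    -- < β` suffices.
    set j : ℕ := min n ⌊n * α / β⌋₊ with hj
    have hjα : j * β ≤ n * α := by
      rw [← le_div_iff₀ hβ0]
      exact (Nat.cast_le.2 (min_le_right _ _)).trans (Nat.floor_le (by positivity))
    have hjm : n * m ≤ j * β := by
      rcases min_choice n ⌊n * α / β⌋₊ with h | h
      · rw [hj, h]; gcongr
      · rw [hj, h]
        have h1 := Nat.lt_floor_add_one (n * α / β)
        rw [div_lt_iff₀ hβ0] at h1
        rw [div_lt_iff₀ (by linarith)] at hN
        nlinarith
    set A : Set (Fin n → X) := Set.univ.pi fun i => if (i : ℕ) < j then E else Set.univ with hA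
    have hAm : MeasurableSet A := MeasurableSet.univ_pi fun i => by
      split_ifs
      · exact hE
      · exact MeasurableSet.univ
    have hAν : Measure.pi (fun _ : Fin n => ν) A = ENNReal.ofReal (Real.exp (-(j * β))) := by
      rw [hA, Measure.pi_pi]
      have h1 : ∀ i : Fin n, ν (if (i : ℕ) < j then E else Set.univ) =
          if (i : ℕ) < j then ν E else 1 := fun i => by split_ifs <;> simp
      simp only [h1]
      rw [Finset.prod_ite, Finset.prod_const_one, mul_one, Finset.prod_const,
        Fin.card_filter_val_lt, min_eq_right (min_le_left _ _), hEβ,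
        ← ENNReal.ofReal_pow (Real.exp_pos _).le, ← Real.exp_nat_mul]
      congr 2; ring
    refine le_trans (iInf_le_of_le A (iInf_le_of_le hAm (iInf_le_of_le ?_ le_rfl))) ?_
    · rw [hAν]
      exact ENNReal.ofReal_le_ofReal (Real.exp_le_exp.2 (neg_le_neg hjα))
    · rw [mul_zero, enlargement_zero hp, hAν]
      exact ENNReal.ofReal_le_ofReal (Real.exp_le_exp.2 (neg_le_neg hjm))

/-- The limit for equal laws at `α = 0`. -/
lemma tendsto_isoExponent_of_eq_zero {p : ℝ} (hp : 1 ≤ p) {ν : Measure X}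
    [IsProbabilityMeasure ν] {τ : ℝ} (hτ : 0 ≤ τ) :
    Tendsto (fun n : ℕ => isoExponent (distCost X p) ν ν n 0 τ) atTop
      (𝓝 (psi (distCost X p) ν ν 0 τ : EReal)) := by
  have h0 : psi (distCost X p) ν ν 0 τ = 0 := by
    simpa using psi_self_le hp ν 0 τ
  refine tendsto_isoExponent le_rfl (fun b hb => Eventually.of_forall fun n => ?_) fun m _ hm => ?_
  · have hb0 : 0 < b := ENNReal.ofReal_pos.1 (bot_le.trans_lt hb)
    refine le_iInf fun A => le_iInf fun hA => le_iInf fun hA1 => ?_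
    refine le_trans ?_ (hA1.trans (measure_mono (subset_enlargement hp A (by positivity))))
    refine ENNReal.ofReal_le_ofReal (Real.exp_le_exp.2 (neg_le_neg ?_))
    rw [mul_zero]; positivity
  · rw [h0] at hm
    exact absurd hm not_lt_bot

end EqualLaws

end

end ThickIsoperimetry

/-! ### The main theorem -/

open ThickIsoperimetry in
theorem mainTheorem5 {𝒳 : Type*} [MetricSpace 𝒳] [CompleteSpace 𝒳] [SecondCountableTopology 𝒳]
    [MeasurableSpace 𝒳] [BorelSpace 𝒳]
    (νX νY : Measure 𝒳) [IsProbabilityMeasure νX] [IsProbabilityMeasure νY]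
    (p q : ℝ) (hp : 1 ≤ p) (hpq : p < q) (x₀ : 𝒳)
    (hX : ConcentratedOnCompact νX ∨ expRate νX p x₀ < ⊤)
    (hY : ∫⁻ y, ENNReal.ofReal (dist y x₀ ^ q) ∂νY < ⊤) :
    (∀ α τ : ℝ, (α, τ) ∈ interior (domPsi (distCost 𝒳 p) νX νY) →
      Tendsto (fun n : ℕ => isoExponent (distCost 𝒳 p) νX νY n α τ) atTop
        (𝓝 (psi (distCost 𝒳 p) νX νY α τ : EReal))) ∧
    (νX = νY → ∀ α τ : ℝ, 0 ≤ α → 0 ≤ τ →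
      Tendsto (fun n : ℕ => isoExponent (distCost 𝒳 p) νX νY n α τ) atTop
        (𝓝 (psi (distCost 𝒳 p) νX νY α τ : EReal))) := by
  -- Both forms of the assumption on `νX` amount to what is needed: a bounded set of full measure.
  obtain ⟨R, hR⟩ : ∃ R, νX (Metric.closedBall x₀ R)ᶜ = 0 := by
    rcases hX with ⟨K, hK, hK0⟩ | hX
    · obtain ⟨R, hR⟩ := hK.isBounded.subset_closedBall x₀
      exact ⟨R, measure_mono_null (Set.compl_subset_compl.2 hR) hK0⟩
    · exact exists_closedBall_of_expRate_lt_top hp hX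
  constructor
  · intro α τ hατ
    -- Around an interior point, moving left in `α` shows `α > 0`, and moving down in `τ` gives a
    -- smaller constraint at which `psi` is finite.
    obtain ⟨δ, hδ, hball⟩ := Metric.mem_nhds_iff.1 (mem_interior_iff_mem_nhds.1 hατ)
    have hδ2 : |δ| / 2 < δ := by rw [abs_of_pos hδ]; linarith
    have h1 : (α - δ / 2, τ) ∈ domPsi (distCost 𝒳 p) νX νY := hball (by
      rw [Metric.mem_ball, Prod.dist_eq, max_lt_iff]
      exact ⟨by simpa [Real.dist_eq] using hδ2, by simpa using hδ⟩)
    have h2 : (α, τ - δ / 2) ∈ domPsi (distCost 𝒳 p) νX νY := hball (by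
      rw [Metric.mem_ball, Prod.dist_eq, max_lt_iff]
      exact ⟨by simpa using hδ, by simpa [Real.dist_eq] using hδ2⟩)
    have hα : 0 < α := by
      have : 0 ≤ α - δ / 2 := h1.1
      linarith
    exact tendsto_isoExponent_of_psi_lt_top hp hR hα h2.2.1 (by simp only; linarith) h2.2.2
  · rintro rfl α τ hα hτ
    -- Off the two edges, finiteness of `psi α 0` brings the case under the general limit theorem
    -- with `t = 0`.
    rcases hα.eq_or_lt with rfl | hα
    · exact tendsto_isoExponent_of_eq_zero hp hτ
    rcases hτ.eq_or_lt with rfl | hτ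
    · exact tendsto_isoExponent_zero hp hα
    · exact tendsto_isoExponent_of_psi_lt_top hp hR hα le_rfl hτ
        ((psi_self_le hp νX α 0).trans_lt ENNReal.ofReal_lt_top)
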